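/- Let $\lambda>0$ and $0<\theta<\pi/2$. Let $\mathcal P_\lambda$ be a homogeneous Poisson point process with intensity $\lambda$ on $\mathbb R^2$ (with Euclidean norm $|\cdot|$ and scalar product $\langle\cdot,\cdot\rangle$), and add the origin $o$ to it. For $v\in\mathbb R^2$ let $$\mathcal C_\theta(v):=\{v+(r\cos\varphi,r\sin\varphi)\colon r>0,\ |\varphi|\le\theta\},$$ and let $B(v,r)$ be the open ball of radius $r$ around $v$. The directed-$\theta$-navigation is defined by $V_0:=o$ and $$V_{i+1}:=\operatorname{argmin}\{|v-V_i|\colon v\in(\mathcal P_\lambda\cup\{o\})\cap\mathcal C_\theta(V_i)\},\qquad i\ge 0,$$ with progress variables $U_i:=V_i-V_{i-1}$, $i\ge1$. The history sets are $H_0:=\emptyset$ and $$H_n:=\mathcal C_\theta(V_{n-1}+U_n)\cap\big(H_{n-1}\cup B(V_{n-1},|U_n|)\big),\qquad n\ge1.$$ The renewal times are $\tau_0:=0$ and $\tau_k:=\inf\{n>\tau_{k-1}\colon H_n=\emptyset\}\in\{1,2,\dots,\infty\}$ for $k\ge1$, and the segment progress is $U'_i:=\sum_{j=\tau_{i-1}+1}^{\tau_i}U_j$.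 Then, almost surely, every argmin above exists and is unique, and $\tau_1<\infty$, so that $U'_1$ is almost surely well defined. Moreover, there is $\gamma=(\gamma_1,\gamma_2)$ with $\gamma_1,\gamma_2>0$, depending only on $\lambda$ and $\theta$, such that $$\mathbb E\big[\exp(\langle\gamma,U'_1\rangle)\big]<\infty.$$ -/

import Mathlib

open MeasureTheory ProbabilityTheory Set
open scoped NNReal ENNReal

noncomputable section

/-- The plane `ℝ²` with its Euclidean norm and scalar product. -/
abbrev Plane : Type := EuclideanSpace ℝ (Fin 2)

/-- `P` is a homogeneous Poisson point process of intensity `lam` on the plane, seen as a random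
set of points: the number of points in a Borel set is a random variable, it is Poisson distributed
with mean `lam * |B|` when the area `|B|` is finite, and the numbers of points in finitely many
pairwise disjoint Borel sets are independent. (Almost sure local finiteness follows.) -/
structure IsPoissonPointProcess {Ω : Type*} [MeasurableSpace Ω] (lam : ℝ≥0)
    (P : Ω → Set Plane) (μ : Measure Ω) : Prop where
  measurable_count : ∀ B : Set Plane, MeasurableSet B →
    Measurable (fun ω => (P ω ∩ B).encard)
  law_count : ∀ B : Set Plane, MeasurableSet B → volume B ≠ ∞ →
    HasLaw (fun ω => (P ω ∩ B).encard)
      ((poissonMeasure (lam * (volume B).toNNReal)).map (Nat.cast : ℕ → ℕ∞)) μ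
  indep_count : ∀ (m : ℕ) (B : Fin m → Set Plane), (∀ i, MeasurableSet (B i)) →
    Pairwise (Function.onFun Disjoint B) →
    iIndepFun (fun i ω => (P ω ∩ B i).encard) μ

/-- The cone `C_θ(v)` with apex `v` (not included) and angle `2θ`, facing to the right: all points
whose difference to `v` has polar coordinates `(r, φ)` with `r > 0` and `|φ| ≤ θ`. -/
def cone (θ : ℝ) (v : Plane) : Set Plane :=
  {w | ∃ r φ : ℝ, 0 < r ∧ |φ| ≤ θ ∧ w = v + !₂[r * Real.cos φ, r * Real.sin φ]}

/-- `w` is a point of `S` in the cone `C_θ(v)` that is closest to `v`. -/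
def IsSuccessor (θ : ℝ) (S : Set Plane) (v w : Plane) : Prop :=
  w ∈ S ∩ cone θ v ∧ ∀ w' ∈ S ∩ cone θ v, dist w v ≤ dist w' v

open Classical in
/-- The successor of `v`: the unique closest point to `v` of `S` in the cone `C_θ(v)`
(by convention `v` itself where there is no unique such point). -/
def successor (θ : ℝ) (S : Set Plane) (v : Plane) : Plane :=
  if h : ∃! w, IsSuccessor θ S v w then h.choose else v

/-- The waypoints `V_0 = o`, `V_{i+1} =` successor of `V_i`, of the directed-`θ`-navigation. -/
def waypoint (θ : ℝ) (S : Set Plane) : ℕ → Plane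
  | 0 => 0
  | i + 1 => successor θ S (waypoint θ S i)

/-- The `i`-th progress `U_i = V_i - V_{i-1}`, for `i ≥ 1`. -/
def progress (θ : ℝ) (S : Set Plane) (i : ℕ) : Plane :=
  waypoint θ S i - waypoint θ S (i - 1)

/-- The history sets `H_0 = ∅` and
`H_n = C_θ(V_{n-1} + U_n) ∩ (H_{n-1} ∪ B(V_{n-1}, |U_n|))` with open balls `B`. -/
def history (θ : ℝ) (S : Set Plane) : ℕ → Set Plane
  | 0 => ∅
  | n + 1 => cone θ (waypoint θ S n + progress θ S (n + 1)) ∩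
      (history θ S n ∪ Metric.ball (waypoint θ S n) ‖progress θ S (n + 1)‖)

/-- The renewal times `τ_0 = 0`, `τ_k = inf {n > τ_{k-1} : H_n = ∅}`, with values in
`{0, 1, …, ∞}`, where the infimum of the empty set is `∞`. -/
def renewalTime (θ : ℝ) (S : Set Plane) : ℕ → ℕ∞
  | 0 => 0
  | k + 1 => sInf {t : ℕ∞ | ∃ n : ℕ, t = n ∧ renewalTime θ S k < n ∧ history θ S n = ∅}

/-- The `i`-th segment progress `U'_i`, for `i ≥ 1`: the sum of the `U_j` over
`τ_{i-1} < j ≤ τ_i` (meaningful where `τ_i` is finite). -/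
def segmentProgress (θ : ℝ) (S : Set Plane) (i : ℕ) : Plane :=
  ∑ j ∈ Finset.Ioc (renewalTime θ S (i - 1)).toNat (renewalTime θ S i).toNat, progress θ S j

end

open Filter Topology

/-! Call the path alive while no renewal has occurred. Each step reveals only a sector with a single
point of the process, at its end. Given the waypoints so far, the process outside the explored
sectors is therefore again Poisson; `measure_inter_void_unexplored` states this for void
probabilities. It comes from rounding the path to a grid: for each of the countably many rounded
paths the enlarged explored region is deterministic, complete independence applies, and then the
mesh tends to zero.

The geometric fact is that the cone of slope min(tan θ, 1 / tan θ) at the current waypoint is never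
explored (`narrow_not_mem_explored`). Its directions make an angle of at most π/2 with every earlier
displacement, so its points are farther from V_j than V_n is, hence farther than V_{j+1}.
Consequently steps have Gaussian tails uniformly in the past, successors exist, and for each r a
narrow step of length at least r has conditional probability bounded below
(`measure_not_goodStep_le`). After a narrow step the new cone misses the ball just emptied; if the
step also passes the right end of all older balls, it misses those too, and this is a renewal
(`history_eq_empty`).

The lag is the distance by which emptied balls extend to the right of V_n. A step of length Y turns
it into at most max(lag - Y cos θ, Y), so a large lag shrinks, while a moderate one leaves a fixed
chance of renewal. With x_n the first coordinate of V_n, the expectation of 1_{alive} exp(a x_n) (1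
+ β exp(lag)) therefore contracts by a factor 1 - δ for suitable small a and β
(`potential_succ_le`). Geometric decay yields τ_1 < ∞ and summability of E[1_{alive} exp(a x_n)];
one conditional exponential moment for the last step then bounds E[exp(a x_{τ_1})]. Since y ≤ x tan
θ on the cone, γ = (a / 2, a / (2 tan θ)) works. -/

/-! ### Cones in Cartesian coordinates -/

/-- The closed cone `{(x, y) : |y| ≤ k x}` with apex at the origin. -/
def wedge (k : ℝ) : Set Plane := {w | |w 1| ≤ k * w 0}

lemma mem_wedge {k : ℝ} {w : Plane} : w ∈ wedge k ↔ |w 1| ≤ k * w 0 := Iff.rfl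

lemma plane_norm_sq (w : Plane) : ‖w‖ ^ 2 = w 0 ^ 2 + w 1 ^ 2 := by
  rw [EuclideanSpace.norm_sq_eq]; simp

lemma plane_inner (v w : Plane) : inner ℝ v w = v 0 * w 0 + v 1 * w 1 := by
  simp [PiLp.inner_apply, mul_comm]

lemma plane_ext {v w : Plane} (h0 : v 0 = w 0) (h1 : v 1 = w 1) : v = w := by
  ext i; fin_cases i <;> assumption

lemma continuous_coord (i : Fin 2) : Continuous fun w : Plane => w i := by fun_prop

lemma isClosed_wedge (k : ℝ) : IsClosed (wedge k) :=
  isClosed_le (continuous_coord 1).abs (continuous_const.mul (continuous_coord 0))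

lemma wedge_add {k : ℝ} {v w : Plane} (hv : v ∈ wedge k) (hw : w ∈ wedge k) :
    v + w ∈ wedge k := by
  rw [mem_wedge] at *
  have := abs_add_le (v 1) (w 1)
  simp only [PiLp.add_apply]
  linarith

lemma zero_mem_wedge (k : ℝ) : (0 : Plane) ∈ wedge k := by simp [mem_wedge]

lemma wedge_fst_nonneg {k : ℝ} (hk : 0 < k) {w : Plane} (hw : w ∈ wedge k) : 0 ≤ w 0 := by
  have := (abs_nonneg (w 1)).trans hw
  exact nonneg_of_mul_nonneg_right this hk

lemma wedge_mono {k l : ℝ} (hl : 0 < l) (h : l ≤ k) : wedge l ⊆ wedge k := fun w hw => by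
  have := wedge_fst_nonneg hl hw
  rw [mem_wedge] at *
  nlinarith

lemma wedge_fst_pos {k : ℝ} (hk : 0 < k) {w : Plane} (hw : w ∈ wedge k) (h : w ≠ 0) :
    0 < w 0 := by
  refine (wedge_fst_nonneg hk hw).lt_of_ne' fun h0 => h ?_
  have h1 : |w 1| ≤ 0 := by rw [mem_wedge, h0, mul_zero] at hw; exact hw
  exact plane_ext h0 (abs_nonpos_iff.1 h1)

/-- The norm on a wedge is controlled by the first coordinate. -/
lemma wedge_norm_le {θ : ℝ} (hθ : 0 < θ) (hθ' : θ < Real.pi / 2) {w : Plane}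
    (hw : w ∈ wedge (Real.tan θ)) : Real.cos θ * ‖w‖ ≤ w 0 := by
  have hk := Real.tan_pos_of_pos_of_lt_pi_div_two hθ hθ'
  have h0 := wedge_fst_nonneg hk hw
  have hc : 0 < Real.cos θ := Real.cos_pos_of_mem_Ioo ⟨by linarith, hθ'⟩
  have h1 : (w 1) ^ 2 ≤ (Real.tan θ * w 0) ^ 2 := sq_le_sq' (by
    have := neg_abs_le (w 1); have : |w 1| ≤ _ := hw; linarith) ((le_abs_self _).trans hw)
  refine abs_le_of_sq_le_sq' ?_ h0 |>.2
  rw [mul_pow, plane_norm_sq]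
  have h2 : Real.cos θ ^ 2 * (Real.tan θ * w 0) ^ 2 = Real.sin θ ^ 2 * (w 0) ^ 2 := by
    rw [Real.tan_eq_sin_div_cos]; field_simp
  have h3 := Real.sin_sq_add_cos_sq θ
  nlinarith [mul_le_mul_of_nonneg_left h1 (sq_nonneg (Real.cos θ))]

/-- With slopes written as tangents, `k * l ≤ 1` says that the two half-angles add up to at most
π/2, so no two such vectors form an obtuse angle. -/
lemma wedge_inner_nonneg {k l : ℝ} (hk : 0 < k) (hl : 0 < l) (hkl : k * l ≤ 1) {v w : Plane}
    (hv : v ∈ wedge k) (hw : w ∈ wedge l) : 0 ≤ (inner ℝ v w : ℝ) := by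
  have hv0 := wedge_fst_nonneg hk hv
  have hw0 := wedge_fst_nonneg hl hw
  rw [plane_inner]
  have h : |v 1 * w 1| ≤ (k * v 0) * (l * w 0) := by
    rw [abs_mul]; exact mul_le_mul hv hw (abs_nonneg _) (by positivity)
  have := neg_abs_le (v 1 * w 1)
  nlinarith [mul_nonneg hv0 hw0]

/-- The tangent is increasing on (-π/2, π/2), so the angular condition is linear in the coordinates.
Conversely, the angle is arctan(y / x) and the radius x √(1 + (y / x)²). -/
lemma mem_cone_iff {θ : ℝ} (hθ : 0 < θ) (hθ' : θ < Real.pi / 2) {v w : Plane} :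
    w ∈ cone θ v ↔ w - v ∈ wedge (Real.tan θ) ∧ w ≠ v := by
  have hk := Real.tan_pos_of_pos_of_lt_pi_div_two hθ hθ'
  constructor
  · rintro ⟨r, φ, hr, hφ, rfl⟩
    have hφ2 := abs_le.1 hφ
    have hc : 0 < Real.cos φ := Real.cos_pos_of_mem_Ioo ⟨by linarith, by linarith⟩
    have ht : |Real.tan φ| ≤ Real.tan θ := by
      have mono := Real.strictMonoOn_tan.monotoneOn
      rw [abs_le]
      constructor
      · rw [← Real.tan_neg]
        exact mono ⟨by linarith, by linarith⟩ ⟨by linarith, by linarith⟩ hφ2.1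
      · exact mono ⟨by linarith, by linarith⟩ ⟨by linarith, by linarith⟩ hφ2.2
    refine ⟨?_, ?_⟩
    · simp only [mem_wedge, add_sub_cancel_left]
      simp only [Matrix.cons_val_one, Matrix.cons_val_zero, Matrix.cons_val_fin_one]
      rw [show r * Real.sin φ = Real.tan φ * (r * Real.cos φ) by
        rw [Real.tan_eq_sin_div_cos]; field_simp, abs_mul, abs_of_pos (mul_pos hr hc)]
      exact mul_le_mul_of_nonneg_right ht (mul_pos hr hc).le
    · intro h
      have := congrArg (fun x : Plane => x 0) h
      simp at this
      rcases this with h | h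
      · exact hr.ne' h
      · exact hc.ne' h
  · rintro ⟨h, hne⟩
    have h0 := wedge_fst_pos hk h (sub_ne_zero.2 hne)
    set u := w - v with hu
    have hs : 0 < Real.sqrt (1 + (u 1 / u 0) ^ 2) := by positivity
    refine ⟨u 0 * Real.sqrt (1 + (u 1 / u 0) ^ 2), Real.arctan (u 1 / u 0), by positivity, ?_, ?_⟩
    · have ht : |u 1 / u 0| ≤ Real.tan θ := by
        rw [abs_div, abs_of_pos h0, div_le_iff₀ h0]; exact h
      have e : Real.arctan (Real.tan θ) = θ := Real.arctan_tan (by linarith) hθ'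
      rw [abs_le] at ht ⊢
      constructor
      · have := Real.arctan_strictMono.monotone ht.1
        rwa [Real.arctan_neg, e] at this
      · rw [← e]; exact Real.arctan_strictMono.monotone ht.2
    · rw [Real.cos_arctan, Real.sin_arctan]
      have : w = v + u := by simp [hu]
      rw [this]
      congr 1
      apply plane_ext
      · simp only [Matrix.cons_val_zero]; field_simp
      · simp only [Matrix.cons_val_one, Matrix.cons_val_fin_one]; field_simp

/-! ### Successors and waypoints of a fixed point set -/

lemma not_mem_cone_self {θ : ℝ} (hθ : 0 < θ) (hθ' : θ < Real.pi / 2) (v : Plane) :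
    v ∉ cone θ v := fun h => ((mem_cone_iff hθ hθ').1 h).2 rfl

lemma successor_eq_self_or {θ : ℝ} (S : Set Plane) (v : Plane) :
    IsSuccessor θ S v (successor θ S v) ∨ successor θ S v = v := by
  unfold successor
  split_ifs with h
  · exact Or.inl h.choose_spec.1
  · exact Or.inr rfl

/-- Excluding the default value `v`, existence, minimality and uniqueness merge into one condition:
no other point of the cone is as close as `w`. In this form the condition is a count, which serves
for measurability. -/
lemma successor_eq_iff {θ : ℝ} {S : Set Plane} {v w : Plane}
    (hw : w ≠ v) : successor θ S v = w ↔
      w ∈ S ∩ cone θ v ∧ ∀ w' ∈ S ∩ cone θ v, dist w' v ≤ dist w v → w' = w := by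
  constructor
  · intro h
    unfold successor at h
    split_ifs at h with hu
    · have h1 := hu.choose_spec
      rw [h] at h1
      refine ⟨h1.1.1, fun w' hw' hd => h1.2 _ ⟨hw', fun w'' hw'' => hd.trans (h1.1.2 _ hw'')⟩⟩
    · exact absurd h.symm hw
  · rintro ⟨h1, h2⟩
    have hs : IsSuccessor θ S v w := ⟨h1, fun w' hw' => by
      by_contra hlt
      push Not at hlt
      rw [h2 w' hw' hlt.le] at hlt
      exact lt_irrefl _ hlt⟩
    have hu : ∃! w, IsSuccessor θ S v w := ⟨w, hs, fun w' hw' => h2 w' hw'.1 (hw'.2 w h1)⟩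
    unfold successor
    rw [dif_pos hu]
    exact hu.unique hu.choose_spec.1 hs

/-- The apex lies outside its own cone, so the default value is never taken by a genuine successor.
-/
lemma successor_ne_iff {θ : ℝ} (hθ : 0 < θ) (hθ' : θ < Real.pi / 2) {S : Set Plane} {v : Plane} :
    successor θ S v ≠ v ↔ ∃! w, IsSuccessor θ S v w := by
  constructor
  · intro h
    by_contra hu
    unfold successor at h
    rw [dif_neg hu] at h
    exact h rfl
  · intro hu h
    unfold successor at h
    rw [dif_pos hu] at h
    have := hu.choose_spec.1.1.2
    rw [h] at this
    exact not_mem_cone_self hθ hθ' v this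

/-- `w` is the successor of `v` as soon as it is the only point of `S` in its sector. -/
lemma successor_congr {θ : ℝ} (hθ : 0 < θ) (hθ' : θ < Real.pi / 2) {S S' Q : Set Plane} {v : Plane}
    (hSS : S ∩ Q = S' ∩ Q) (hne : successor θ S v ≠ v)
    (hQ : {w | w - v ∈ wedge (Real.tan θ) ∧ ‖w - v‖ ≤ ‖successor θ S v - v‖} ⊆ Q) :
    successor θ S' v = successor θ S v := by
  have mem : ∀ w ∈ Q, (w ∈ S ↔ w ∈ S') := fun w hw => by
    have := Set.ext_iff.1 hSS w
    simpa [hw] using this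
  obtain ⟨h1, h2⟩ := (successor_eq_iff hne).1 rfl
  refine (successor_eq_iff hne).2 ⟨⟨?_, h1.2⟩, fun w' hw' hd => ?_⟩
  · refine (mem _ (hQ ⟨((mem_cone_iff hθ hθ').1 h1.2).1, le_rfl⟩)).1 h1.1
  · refine h2 w' ⟨(mem _ (hQ ⟨((mem_cone_iff hθ hθ').1 hw'.2).1, ?_⟩)).2 hw'.1, hw'.2⟩ hd
    simpa [dist_eq_norm] using hd

lemma successor_sub_mem_wedge {θ : ℝ} (hθ : 0 < θ) (hθ' : θ < Real.pi / 2) (S : Set Plane)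
    (v : Plane) : successor θ S v - v ∈ wedge (Real.tan θ) := by
  rcases successor_eq_self_or (θ := θ) S v with h | h
  · exact ((mem_cone_iff hθ hθ').1 h.1.2).1
  · rw [h, sub_self]; exact zero_mem_wedge _

lemma waypoint_sub_mem_wedge {θ : ℝ} (hθ : 0 < θ) (hθ' : θ < Real.pi / 2) (S : Set Plane)
    {i j : ℕ} (hij : i ≤ j) : waypoint θ S j - waypoint θ S i ∈ wedge (Real.tan θ) := by
  induction j, hij using Nat.le_induction with
  | base => rw [sub_self]; exact zero_mem_wedge _
  | succ j _ ih =>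
    have := wedge_add (successor_sub_mem_wedge hθ hθ' S (waypoint θ S j)) ih
    rwa [sub_add_sub_cancel] at this

lemma waypoint_mem {θ : ℝ} {S : Set Plane} {j : ℕ}
    (h : waypoint θ S (j + 1) ≠ waypoint θ S j) : waypoint θ S (j + 1) ∈ S := by
  rcases successor_eq_self_or (θ := θ) S (waypoint θ S j) with h' | h'
  · exact h'.1.1
  · exact absurd h' h

lemma waypoint_fst_lt {θ : ℝ} (hθ : 0 < θ) (hθ' : θ < Real.pi / 2) {S : Set Plane} {n : ℕ}
    (hnd : ∀ j < n, waypoint θ S (j + 1) ≠ waypoint θ S j) {i j : ℕ} (hij : i < j) (hj : j ≤ n) :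
    waypoint θ S i 0 < waypoint θ S j 0 := by
  have hk := Real.tan_pos_of_pos_of_lt_pi_div_two hθ hθ'
  have h1 := wedge_fst_nonneg hk (waypoint_sub_mem_wedge hθ hθ' S (show i + 1 ≤ j from hij))
  have h2 := wedge_fst_pos hk (waypoint_sub_mem_wedge hθ hθ' S (Nat.le_succ i))
    (sub_ne_zero.2 (hnd i (by omega)))
  simp only [PiLp.sub_apply] at h1 h2
  simp only [Nat.succ_eq_add_one] at h2
  linarith

lemma waypoint_fst_nonneg {θ : ℝ} (hθ : 0 < θ) (hθ' : θ < Real.pi / 2) (S : Set Plane) (n : ℕ) :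
    0 ≤ waypoint θ S n 0 := by
  have hk := Real.tan_pos_of_pos_of_lt_pi_div_two hθ hθ'
  simpa [waypoint] using wedge_fst_nonneg hk (waypoint_sub_mem_wedge hθ hθ' S (Nat.zero_le n))

lemma isSuccessor_congr {θ : ℝ} {S S' : Set Plane} {v : Plane}
    (h : S ∩ cone θ v = S' ∩ cone θ v) : IsSuccessor θ S v = IsSuccessor θ S' v := by
  funext w; simp only [IsSuccessor, h]

/-- The origin is never in a cone of a waypoint, so adding it does not change the navigation. -/
lemma insert_inter_cone {θ : ℝ} (hθ : 0 < θ) (hθ' : θ < Real.pi / 2) {S : Set Plane} {v : Plane}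
    (hv : 0 ≤ v 0) : insert 0 S ∩ cone θ v = S ∩ cone θ v := by
  refine Set.insert_inter_of_notMem fun h => ?_
  obtain ⟨h1, h2⟩ := (mem_cone_iff hθ hθ').1 h
  have := wedge_fst_pos (Real.tan_pos_of_pos_of_lt_pi_div_two hθ hθ') h1 (sub_ne_zero.2 h2)
  simp at this
  linarith

lemma waypoint_insert {θ : ℝ} (hθ : 0 < θ) (hθ' : θ < Real.pi / 2) (S : Set Plane) :
    waypoint θ (insert 0 S) = waypoint θ S := by
  funext n
  induction n with
  | zero => rfl
  | succ n ih =>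
    simp only [waypoint, ih]
    unfold successor
    rw [isSuccessor_congr (insert_inter_cone hθ hθ' (waypoint_fst_nonneg hθ hθ' S n))]

/-! ### Explored sets and what they determine -/

/-- The path with waypoints `v 0, …, v n` has explored the sectors of its steps, enlarged by `δ`. -/
def explored (k : ℝ) (n : ℕ) (δ : ℝ) (v : ℕ → Plane) : Set Plane :=
  ⋃ j ∈ Finset.range (n + 1), {w | |(w - v j) 1| - k * (w - v j) 0 ≤ δ ∧
    ‖w - v j‖ - ‖v (min (j + 1) n) - v j‖ ≤ δ}

lemma mem_explored {k : ℝ} {n : ℕ} {δ : ℝ} {v : ℕ → Plane} {w : Plane} :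
    w ∈ explored k n δ v ↔ ∃ j ≤ n, |(w - v j) 1| - k * (w - v j) 0 ≤ δ ∧
    ‖w - v j‖ - ‖v (min (j + 1) n) - v j‖ ≤ δ := by
  simp only [explored, Set.mem_iUnion, Finset.mem_range, Nat.lt_succ_iff, exists_prop,
    Set.mem_ofPred_eq]

lemma isClosed_explored (k : ℝ) (n : ℕ) (δ : ℝ) (v : ℕ → Plane) :
    IsClosed (explored k n δ v) := by
  refine isClosed_biUnion_finset fun j _ => ?_
  have h : Continuous fun w : Plane => w - v j := by fun_prop
  exact (isClosed_le (((continuous_coord 1).comp h).abs.sub (continuous_const.mul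
    ((continuous_coord 0).comp h))) continuous_const).inter
    (isClosed_le (h.norm.sub continuous_const) continuous_const)

/-- The first `n` steps depend only on the points in the explored set. -/
lemma waypoint_local {θ : ℝ} (hθ : 0 < θ) (hθ' : θ < Real.pi / 2) {S S' Q : Set Plane} {n : ℕ}
    (hSS : S ∩ Q = S' ∩ Q) (hnd : ∀ j < n, waypoint θ S (j + 1) ≠ waypoint θ S j)
    (hQ : explored (Real.tan θ) n 0 (waypoint θ S) ⊆ Q) :
    ∀ j ≤ n, waypoint θ S' j = waypoint θ S j := by
  intro j
  induction j with
  | zero => intro; rfl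
  | succ j ih =>
    intro hj
    simp only [waypoint]
    rw [ih (by omega)]
    refine successor_congr hθ hθ' hSS (hnd j (by omega)) (fun w hw => hQ ?_)
    refine mem_explored.2 ⟨j, by omega, ?_, ?_⟩
    · have : |(w - waypoint θ S j) 1| ≤ _ := hw.1
      linarith
    · rw [min_eq_left hj]
      have : ‖w - waypoint θ S j‖ ≤ ‖waypoint θ S (j + 1) - waypoint θ S j‖ := hw.2
      linarith

/-- Points of the process ahead of the current waypoint are unexplored. -/
lemma not_mem_explored {θ : ℝ} (hθ : 0 < θ) (hθ' : θ < Real.pi / 2) {S : Set Plane} {n : ℕ}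
    (hnd : ∀ j < n, waypoint θ S (j + 1) ≠ waypoint θ S j) {w : Plane} (hw : w ∈ S)
    (hc : w ∈ cone θ (waypoint θ S n)) :
    w ∉ explored (Real.tan θ) n 0 (waypoint θ S) := by
  have hk := Real.tan_pos_of_pos_of_lt_pi_div_two hθ hθ'
  intro h
  obtain ⟨j, hj, h1, h2⟩ := mem_explored.1 h
  obtain ⟨hc1, hc2⟩ := (mem_cone_iff hθ hθ').1 hc
  have hx := wedge_fst_pos hk hc1 (sub_ne_zero.2 hc2)
  rcases hj.lt_or_eq with hj | rfl
  · rw [min_eq_left (show j + 1 ≤ n from hj)] at h2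
    have hx2 := wedge_fst_nonneg hk (waypoint_sub_mem_wedge hθ hθ' S (show j + 1 ≤ n from hj))
    have hx3 := wedge_fst_nonneg hk (waypoint_sub_mem_wedge hθ hθ' S hj.le)
    simp only [PiLp.sub_apply] at hx hx2 hx3
    obtain ⟨-, h4⟩ := (successor_eq_iff (θ := θ) (S := S) (hnd j hj)).1 rfl
    have : w = waypoint θ S (j + 1) := by
      refine h4 w ⟨hw, (mem_cone_iff hθ hθ').2 ⟨?_, ?_⟩⟩ ?_
      · rw [mem_wedge]; linarith
      · rintro rfl; linarith
      · rw [dist_eq_norm, dist_eq_norm]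
        change _ ≤ ‖waypoint θ S (j + 1) - _‖
        linarith
    rw [this] at hx
    linarith
  -- For `j = n` the truncated index gives radius zero, so only the apex V_n counts as explored.
  · rw [min_eq_right (by omega)] at h2
    simp only [sub_self, norm_zero, sub_zero] at h2
    exact hc2 (sub_eq_zero.1 (norm_le_zero_iff.1 h2))

/-- Waypoints are outside the open balls emptied before. -/
lemma norm_progress_le {θ : ℝ} (hθ : 0 < θ) (hθ' : θ < Real.pi / 2) {S : Set Plane} {n : ℕ}
    (hnd : ∀ j < n, waypoint θ S (j + 1) ≠ waypoint θ S j) {j : ℕ} (hj : j < n) :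
    ‖waypoint θ S (j + 1) - waypoint θ S j‖ ≤ ‖waypoint θ S n - waypoint θ S j‖ := by
  -- The last step being genuine, V_n belongs to `S` and competes with V_{j+1} in the cone at V_j.
  obtain ⟨m, rfl⟩ : ∃ m, n = m + 1 := ⟨n - 1, by omega⟩
  rcases successor_eq_self_or (θ := θ) S (waypoint θ S j) with h | h
  · have := h.2 (waypoint θ S (m + 1)) ⟨waypoint_mem (hnd m (by omega)),
      (mem_cone_iff hθ hθ').2 ⟨waypoint_sub_mem_wedge hθ hθ' S hj.le, fun h => ?_⟩⟩
    · rw [dist_eq_norm, dist_eq_norm] at this; exact this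
    · have := waypoint_fst_lt hθ hθ' hnd hj le_rfl
      rw [h] at this
      exact lt_irrefl _ this
  · exact absurd h (hnd j hj)

/-- The narrow wedge at the current waypoint is unexplored. -/
lemma narrow_not_mem_explored {θ : ℝ} (hθ : 0 < θ) (hθ' : θ < Real.pi / 2) {S : Set Plane} {n : ℕ}
    (hnd : ∀ j < n, waypoint θ S (j + 1) ≠ waypoint θ S j) {l : ℝ} (hl : 0 < l)
    (hkl : Real.tan θ * l ≤ 1) {w : Plane} (hw : w - waypoint θ S n ∈ wedge l)
    (hne : w ≠ waypoint θ S n) :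
    w ∉ explored (Real.tan θ) n 0 (waypoint θ S) := by
  have hk := Real.tan_pos_of_pos_of_lt_pi_div_two hθ hθ'
  intro h
  obtain ⟨j, hj, -, h2⟩ := mem_explored.1 h
  have hpos : 0 < ‖w - waypoint θ S n‖ := norm_pos_iff.2 (sub_ne_zero.2 hne)
  rcases hj.lt_or_eq with hj | rfl
  · rw [min_eq_left (show j + 1 ≤ n from hj)] at h2
    -- A non-obtuse angle at V_n gives |w - V_j|² ≥ |V_n - V_j|² + |w - V_n|², which exceeds the
    -- squared radius |V_{j+1} - V_j|².
    have hi := wedge_inner_nonneg hk hl hkl (waypoint_sub_mem_wedge hθ hθ' S hj.le) hw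
    have h3 := norm_progress_le hθ hθ' hnd hj
    have h4 := norm_add_sq_real (waypoint θ S n - waypoint θ S j) (w - waypoint θ S n)
    rw [show waypoint θ S n - waypoint θ S j + (w - waypoint θ S n) = w - waypoint θ S j by abel]
      at h4
    have h5 : ‖w - waypoint θ S j‖ ≤ ‖waypoint θ S n - waypoint θ S j‖ := by linarith
    nlinarith [norm_nonneg (w - waypoint θ S j)]
  · rw [min_eq_right (by omega)] at h2
    simp only [sub_self, norm_zero, sub_zero] at h2
    linarith

/-! ### Measurability of the navigation -/

/-- A random set of points whose counts are random variables and all of whose realizations are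
locally finite. -/
structure IsLocallyFinitePattern {Ω : Type*} [MeasurableSpace Ω] (P : Ω → Set Plane) : Prop where
  measurable_count : ∀ B : Set Plane, MeasurableSet B →
    Measurable (fun ω => (P ω ∩ B).encard)
  finite : ∀ ω, ∀ r : ℝ, (P ω ∩ Metric.closedBall 0 r).Finite

namespace IsLocallyFinitePattern

variable {Ω : Type*} [MeasurableSpace Ω] {P : Ω → Set Plane}

lemma countable (hP : IsLocallyFinitePattern P) (ω : Ω) : (P ω).Countable := by
  have : P ω = ⋃ k : ℕ, P ω ∩ Metric.closedBall 0 k := by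
    rw [← inter_iUnion, Metric.iUnion_closedBall_nat, inter_univ]
  rw [this]
  exact countable_iUnion fun k => (hP.finite ω k).countable

lemma finite_of_bounded (hP : IsLocallyFinitePattern P) (ω : Ω) {B : Set Plane}
    (hB : Bornology.IsBounded B) : (P ω ∩ B).Finite := by
  obtain ⟨r, hr⟩ := hB.subset_closedBall 0
  exact (hP.finite ω r).subset (inter_subset_inter_right _ hr)

/-- The counting measures of a point process, as a kernel. -/
noncomputable def kernel (hP : IsLocallyFinitePattern P) : Kernel Ω Plane where
  toFun ω := Measure.count.restrict (P ω)
  measurable' := by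
    refine Measure.measurable_of_measurable_coe _ fun B hB => ?_
    have h : ∀ ω, (Measure.count.restrict (P ω)) B = ((P ω ∩ B).encard : ℝ≥0∞) := fun ω => by
      rw [Measure.restrict_apply hB, inter_comm,
        Measure.count_apply ((hP.countable ω).measurableSet.inter hB)]
    simp_rw [h]
    exact measurable_from_top.comp (hP.measurable_count B hB)

lemma kernel_apply (hP : IsLocallyFinitePattern P) (ω : Ω) {B : Set Plane} (hB : MeasurableSet B) :
    hP.kernel ω B = ((P ω ∩ B).encard : ℝ≥0∞) := by
  change (Measure.count.restrict (P ω)) B = _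
  rw [Measure.restrict_apply hB, inter_comm,
    Measure.count_apply ((hP.countable ω).measurableSet.inter hB)]

/-- The counts have no uniform bound in ω. Cutting the plane into annuli and Ω according to the
number of points in each annulus gives countably many finite kernels. -/
instance isSFiniteKernel (hP : IsLocallyFinitePattern P) : IsSFiniteKernel hP.kernel := by
  have hA : ∀ k : ℕ, MeasurableSet {w : Plane | ⌊‖w‖⌋₊ = k} := fun k =>
    (Nat.measurable_floor.comp measurable_norm) (measurableSet_singleton k)
  have hS : ∀ kj : ℕ × ℕ, MeasurableSet {ω | hP.kernel ω {w : Plane | ⌊‖w‖⌋₊ = kj.1} = kj.2} :=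
    fun kj => (Kernel.measurable_coe _ (hA kj.1)) (measurableSet_singleton _)
  classical
  have key : hP.kernel = Kernel.sum fun kj : ℕ × ℕ =>
      Kernel.piecewise (hS kj) (hP.kernel.restrict (hA kj.1)) 0 := by
    ext ω B hB
    rw [Kernel.sum_apply' _ _ hB]
    simp only [Kernel.piecewise_apply', Set.mem_ofPred_eq, Kernel.restrict_apply' _ _ _ hB,
      _root_.zero_apply, Measure.coe_zero, Pi.zero_apply]
    rw [ENNReal.tsum_prod']
    have h1 : ∀ k : ℕ, ∑' j : ℕ, (if hP.kernel ω {w : Plane | ⌊‖w‖⌋₊ = k} = j then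
        hP.kernel ω (B ∩ {w | ⌊‖w‖⌋₊ = k}) else 0) = hP.kernel ω (B ∩ {w | ⌊‖w‖⌋₊ = k}) := by
      intro k
      have hf : (P ω ∩ {w : Plane | ⌊‖w‖⌋₊ = k}).Finite := by
        refine (hP.finite ω (k + 1)).subset (inter_subset_inter_right _ fun w hw => ?_)
        rw [mem_closedBall_zero_iff]
        have hw' : ⌊‖w‖⌋₊ = k := hw
        rw [← hw']
        exact (Nat.lt_floor_add_one _).le
      have hk := hP.kernel_apply ω (hA k)
      rw [hf.encard_eq_coe] at hk
      rw [hk, tsum_eq_single (P ω ∩ {w : Plane | ⌊‖w‖⌋₊ = k}).ncard]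
      · exact if_pos rfl
      · intro j hj
        refine if_neg fun h => hj ?_
        have h' : (((P ω ∩ {w : Plane | ⌊‖w‖⌋₊ = k}).ncard : ℕ) : ℝ≥0∞) = j := h
        exact (Nat.cast_injective h').symm
    simp_rw [h1]
    rw [← measure_iUnion]
    · congr 1
      ext w
      simp
    · intro i j hij
      refine Set.disjoint_left.2 fun w hi hj => hij ?_
      exact hi.2.symm.trans hj.2
    · exact fun k => hB.inter (hA k)
  have : ∀ kj : ℕ × ℕ, IsSFiniteKernel
      (Kernel.piecewise (hS kj) (hP.kernel.restrict (hA kj.1)) (0 : Kernel Ω Plane)) := fun kj => by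
    have : IsFiniteKernel
        (Kernel.piecewise (hS kj) (hP.kernel.restrict (hA kj.1)) (0 : Kernel Ω Plane)) := by
      refine ⟨⟨kj.2, by simp, fun ω => ?_⟩⟩
      rw [Kernel.piecewise_apply']
      split_ifs with h
      · rw [Kernel.restrict_apply' _ _ _ MeasurableSet.univ, univ_inter]
        exact le_of_eq h
      · simp
    infer_instance
  rw [key]
  exact Kernel.isSFiniteKernel_sum

/-- Quantifiers over the random points become statements about counts in sections of jointly
measurable sets. -/
lemma measurable_kernel_section (hP : IsLocallyFinitePattern P) {X : Type*} [MeasurableSpace X]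
    {f : X → Ω} (hf : Measurable f) {t : Set (X × Plane)} (ht : MeasurableSet t) :
    Measurable fun x => hP.kernel (f x) (Prod.mk x ⁻¹' t) := by
  have := Kernel.measurable_kernel_prodMk_left (κ := hP.kernel.comap f hf) ht
  simpa using this

lemma measurableSet_wedge (k : ℝ) : MeasurableSet (wedge k) := (isClosed_wedge k).measurableSet

/-- By `successor_eq_iff` the event asks for a point of the process in `B` and in the cone that has
no competitor at most as far away. The absence of a competitor is a count of `t1` not above one, the
existence of the point a nonzero count of `t2`. -/
lemma measurableSet_successor {θ : ℝ} (hθ : 0 < θ) (hθ' : θ < Real.pi / 2)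
    (hP : IsLocallyFinitePattern P) {B : Set Plane} (hB : MeasurableSet B) :
    MeasurableSet {p : Ω × Plane | successor θ (P p.1) p.2 ≠ p.2 ∧
      successor θ (P p.1) p.2 ∈ B} := by
  let t1 : Set (((Ω × Plane) × Plane) × Plane) :=
    {q | q.2 - q.1.1.2 ∈ wedge (Real.tan θ) ∧ q.2 ≠ q.1.1.2 ∧
      dist q.2 q.1.1.2 ≤ dist q.1.2 q.1.1.2}
  have ht1 : MeasurableSet t1 := by
    refine MeasurableSet.inter ?_ (MeasurableSet.inter ?_ ?_)
    · exact (measurableSet_wedge _).preimage (by fun_prop)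
    · have : MeasurableSet {q : ((Ω × Plane) × Plane) × Plane | q.2 = q.1.1.2} :=
        measurableSet_eq_fun (by fun_prop) (by fun_prop)
      exact this.compl
    · have : MeasurableSet {q : ((Ω × Plane) × Plane) × Plane |
          dist q.2 q.1.1.2 ≤ dist q.1.2 q.1.1.2} :=
        measurableSet_le (by fun_prop) (by fun_prop)
      exact this
  have hm1 := hP.measurable_kernel_section (f := fun q : (Ω × Plane) × Plane => q.1.1)
    (by fun_prop) ht1
  let t2 : Set ((Ω × Plane) × Plane) :=
    {q | q.2 ∈ B ∧ q.2 - q.1.2 ∈ wedge (Real.tan θ) ∧ q.2 ≠ q.1.2 ∧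
      hP.kernel q.1.1 (Prod.mk q ⁻¹' t1) ≤ 1}
  have ht2 : MeasurableSet t2 := by
    refine MeasurableSet.inter ?_ (MeasurableSet.inter ?_ (MeasurableSet.inter ?_ ?_))
    · exact measurable_snd hB
    · exact (measurableSet_wedge _).preimage (by fun_prop)
    · have : MeasurableSet {q : (Ω × Plane) × Plane | q.2 = q.1.2} :=
        measurableSet_eq_fun (by fun_prop) (by fun_prop)
      exact this.compl
    · exact measurableSet_le hm1 measurable_const
  have hm2 := hP.measurable_kernel_section (f := fun q : Ω × Plane => q.1) (by fun_prop) ht2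
  have : {p : Ω × Plane | successor θ (P p.1) p.2 ≠ p.2 ∧ successor θ (P p.1) p.2 ∈ B} =
      {p | hP.kernel p.1 (Prod.mk p ⁻¹' t2) = 0}ᶜ := by
    ext ⟨ω, v⟩
    have hs2 : MeasurableSet (Prod.mk (ω, v) ⁻¹' t2) := measurable_prodMk_left ht2
    have hk2 : hP.kernel ω (Prod.mk (ω, v) ⁻¹' t2) ≠ 0 ↔
        ∃ w ∈ P ω, w ∈ Prod.mk (ω, v) ⁻¹' t2 := by
      rw [hP.kernel_apply _ hs2]
      simp [← Set.nonempty_iff_ne_empty, Set.Nonempty]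
    have hk1 : ∀ w, hP.kernel ω (Prod.mk ((ω, v), w) ⁻¹' t1) ≤ 1 ↔
        (P ω ∩ (Prod.mk ((ω, v), w) ⁻¹' t1)).encard ≤ 1 := fun w => by
      rw [hP.kernel_apply _ (measurable_prodMk_left ht1)]
      norm_cast
    change _ ↔ hP.kernel ω _ ≠ 0
    rw [hk2]
    simp only [Set.mem_ofPred_eq]
    constructor
    · rintro ⟨h1, h2⟩
      obtain ⟨h3, h4⟩ := (successor_eq_iff h1).1 rfl
      obtain ⟨h5, h6⟩ := (mem_cone_iff hθ hθ').1 h3.2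
      refine ⟨_, h3.1, h2, h5, h6, ?_⟩
      rw [hk1, Set.encard_le_one_iff]
      have h7 : ∀ a ∈ P ω ∩ (Prod.mk ((ω, v), successor θ (P ω) v) ⁻¹' t1),
          a = successor θ (P ω) v := fun a ha =>
        h4 a ⟨ha.1, (mem_cone_iff hθ hθ').2 ⟨ha.2.1, ha.2.2.1⟩⟩ ha.2.2.2
      exact fun a b ha hb => (h7 a ha).trans (h7 b hb).symm
    · rintro ⟨w, hw, hB, h5, h6, h7⟩
      rw [hk1, Set.encard_le_one_iff] at h7
      have hwc := (mem_cone_iff hθ hθ').2 ⟨h5, h6⟩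
      have h8 : successor θ (P ω) v = w := (successor_eq_iff h6).2
        ⟨⟨hw, hwc⟩, fun w' hw' hd => h7 w' w
          ⟨hw'.1, ((mem_cone_iff hθ hθ').1 hw'.2).1, ((mem_cone_iff hθ hθ').1 hw'.2).2, hd⟩
          ⟨hw, h5, h6, le_rfl⟩⟩
      rw [h8]
      exact ⟨h6, hB⟩
  rw [this]
  exact (hm2 (measurableSet_singleton 0)).compl

lemma measurable_successor {θ : ℝ} (hθ : 0 < θ) (hθ' : θ < Real.pi / 2)
    (hP : IsLocallyFinitePattern P) :
    Measurable fun p : Ω × Plane => successor θ (P p.1) p.2 := by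
  intro B hB
  have h1 := measurableSet_successor hθ hθ' hP hB
  have h2 := (measurableSet_successor hθ hθ' hP MeasurableSet.univ).compl
  have h3 : MeasurableSet {p : Ω × Plane | p.2 ∈ B} := measurable_snd hB
  convert! h1.union (h2.inter h3) using 1
  ext p
  by_cases hp : successor θ (P p.1) p.2 = p.2 <;> simp [hp]

lemma measurable_waypoint {θ : ℝ} (hθ : 0 < θ) (hθ' : θ < Real.pi / 2)
    (hP : IsLocallyFinitePattern P) (n : ℕ) : Measurable fun ω => waypoint θ (P ω) n := by
  induction n with
  | zero => exact measurable_const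
  | succ n ih => exact (measurable_successor hθ hθ' hP).comp (measurable_id.prodMk ih)

end IsLocallyFinitePattern

/-! ### Complete independence of the Poisson process -/

/-- The events that depend only on the points of `P` in `Q`. -/
@[reducible] noncomputable def localEvents {Ω : Type*} (P : Ω → Set Plane) (Q : Set Plane) :
    MeasurableSpace Ω :=
  ⨆ B : {B : Set Plane // MeasurableSet B},
    MeasurableSpace.comap (fun ω => (P ω ∩ Q ∩ B).encard) ⊤

/-- Applied to the restricted pattern, every measurability statement about patterns becomes
measurability with respect to the events local to `Q`. -/
lemma IsLocallyFinitePattern.restrict {Ω : Type*} [MeasurableSpace Ω] {P : Ω → Set Plane}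
    (hP : IsLocallyFinitePattern P) (Q : Set Plane) :
    @IsLocallyFinitePattern Ω (localEvents P Q) (fun ω => P ω ∩ Q) := by
  refine @IsLocallyFinitePattern.mk Ω (localEvents P Q) _ (fun B hB => ?_) fun ω r =>
    (hP.finite ω r).subset (inter_subset_inter_left _ inter_subset_left)
  rw [@measurable_iff_comap_le _ _ (localEvents P Q)]
  exact le_iSup (fun B : {B : Set Plane // MeasurableSet B} =>
    MeasurableSpace.comap (fun ω => (P ω ∩ Q ∩ B).encard) ⊤) ⟨B, hB⟩

/-- The cells of the partition of `Q` generated by finitely many sets. -/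
def cell (Q : Set Plane) {ι : Type*} (B : ι → Set Plane) (σ : ι → Bool) : Set Plane :=
  {w | w ∈ Q ∧ ∀ i, w ∈ B i ↔ σ i = true}

lemma measurableSet_cell {Q : Set Plane} (hQ : MeasurableSet Q) {ι : Type*} [Finite ι]
    {B : ι → Set Plane} (hB : ∀ i, MeasurableSet (B i)) (σ : ι → Bool) :
    MeasurableSet (cell Q B σ) := by
  have : cell Q B σ = Q ∩ ⋂ i, {w | w ∈ B i ↔ σ i = true} := by
    ext w; simp [cell]
  rw [this]
  refine hQ.inter (MeasurableSet.iInter fun i => ?_)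
  cases σ i
  · have : {w | w ∈ B i ↔ false = true} = (B i)ᶜ := by ext; simp
    rw [this]; exact (hB i).compl
  · have : {w | w ∈ B i ↔ true = true} = B i := by ext; simp
    rw [this]; exact hB i

lemma disjoint_cell (Q : Set Plane) {ι : Type*} (B : ι → Set Plane) {σ τ : ι → Bool}
    (h : σ ≠ τ) : Disjoint (cell Q B σ) (cell Q B τ) := by
  refine Set.disjoint_left.2 fun w h1 h2 => h (funext fun i => ?_)
  rw [Bool.eq_iff_iff, ← h1.2 i, h2.2 i]

/-- Independence is assumed for disjoint sets only. Counts in overlapping sets are recovered as sums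
of counts in the disjoint cells. -/
lemma encard_eq_sum_cell {ι : Type*} [Fintype ι] (S Q : Set Plane)
    (B : ι → Set Plane) (i : ι) :
    (S ∩ Q ∩ B i).encard = ∑ᶠ σ ∈ {σ : ι → Bool | σ i = true}, (S ∩ cell Q B σ).encard := by
  classical
  rw [← (Set.toFinite {σ : ι → Bool | σ i = true}).encard_biUnion]
  · congr 1
    ext w
    simp only [mem_inter_iff, mem_iUnion, Set.mem_ofPred_eq, exists_prop, cell]
    constructor
    · rintro ⟨⟨h1, h2⟩, h3⟩
      exact ⟨fun j => decide (w ∈ B j), by simpa using h3, h1, h2, fun j => by simp⟩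
    · rintro ⟨σ, h1, h2, h3, h4⟩
      exact ⟨⟨h2, h3⟩, (h4 i).2 h1⟩
  · intro σ _ τ _ hne
    exact (disjoint_cell Q B hne).mono inter_subset_right inter_subset_right

namespace IsPoissonPointProcess

variable {Ω : Type*} [MeasurableSpace Ω] {lam : ℝ≥0} {P : Ω → Set Plane} {μ : Measure Ω}

lemma iIndepFun_fintype (hP : IsPoissonPointProcess lam P μ) {ι : Type*} [Fintype ι]
    (B : ι → Set Plane) (hB : ∀ i, MeasurableSet (B i))
    (hd : Pairwise (Function.onFun Disjoint B)) :
    iIndepFun (fun i ω => (P ω ∩ B i).encard) μ := by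
  let e := Fintype.equivFin ι
  have h := hP.indep_count (Fintype.card ι) (fun j => B (e.symm j)) (fun j => hB _)
    (fun i j hij => hd (e.symm.injective.ne hij))
  exact iIndepFun.of_precomp e.symm.surjective h

/-- Together with `R`, indexed by `none`, the cells form one finite disjoint family; splitting its
index set keeps independence. -/
lemma indep_cells (hP : IsPoissonPointProcess lam P μ) {ι : Type*} [Fintype ι]
    {Q R : Set Plane} (hQ : MeasurableSet Q) (hR : MeasurableSet R) (hQR : Disjoint Q R)
    {B : ι → Set Plane} (hB : ∀ i, MeasurableSet (B i)) :
    IndepFun (fun ω (σ : ι → Bool) => (P ω ∩ cell Q B σ).encard)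
      (fun ω => (P ω ∩ R).encard) μ := by
  classical
  let C : Option (ι → Bool) → Set Plane := fun o => o.elim R (cell Q B)
  have hC : ∀ o, MeasurableSet (C o) := by
    rintro (_ | σ)
    · exact hR
    · exact measurableSet_cell hQ hB σ
  have hsub : ∀ σ, cell Q B σ ⊆ Q := fun σ w hw => hw.1
  have hd : Pairwise (Function.onFun Disjoint C) := by
    rintro (_ | σ) (_ | τ) hne
    · exact absurd rfl hne
    · exact (hQR.mono_left (hsub τ)).symm
    · exact hQR.mono_left (hsub σ)
    · exact disjoint_cell Q B fun h => hne (congrArg some h)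
  have h := (hP.iIndepFun_fintype C hC hd).indepFun_finset
    (Finset.univ.image some) ({none} : Finset (Option (ι → Bool)))
    (by simp) (fun o => hP.measurable_count _ (hC o))
  have h1 : Measurable fun (x : (Finset.univ.image (some : (ι → Bool) → _)) → ℕ∞)
      (σ : ι → Bool) => x ⟨some σ, Finset.mem_image_of_mem _ (Finset.mem_univ _)⟩ := by fun_prop
  have h2 : Measurable fun x : ({none} : Finset (Option (ι → Bool))) → ℕ∞ =>
      x ⟨none, Finset.mem_singleton_self _⟩ := measurable_pi_apply _
  exact h.comp h1 h2

lemma localEvents_le (hP : IsPoissonPointProcess lam P μ) {Q : Set Plane} (hQ : MeasurableSet Q) :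
    localEvents P Q ≤ ‹MeasurableSpace Ω› := by
  refine iSup_le fun B => ?_
  have := (hP.measurable_count (Q ∩ B) (hQ.inter B.2)).comap_le
  simpa only [inter_assoc] using! this

/-- Complete independence of a Poisson process. -/
lemma indep_localEvents [IsProbabilityMeasure μ] (hP : IsPoissonPointProcess lam P μ)
    {Q R : Set Plane} (hQ : MeasurableSet Q) (hR : MeasurableSet R) (hQR : Disjoint Q R) :
    Indep (localEvents P Q)
      (MeasurableSpace.comap (fun ω => (P ω ∩ R).encard) inferInstance) μ := by
  classical
  let M : {B : Set Plane // MeasurableSet B} → MeasurableSpace Ω := fun B =>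
    MeasurableSpace.comap (fun ω => (P ω ∩ Q ∩ B).encard) ⊤
  -- The σ-algebras generated by finitely many counts form a directed family, and independence
  -- passes to its supremum.
  have hM : localEvents P Q = ⨆ s : Finset {B : Set Plane // MeasurableSet B}, ⨆ B ∈ s, M B :=
    iSup_eq_iSup_finset M
  rw [hM]
  have hle : ∀ s : Finset {B : Set Plane // MeasurableSet B},
      ⨆ B ∈ s, M B ≤ ‹MeasurableSpace Ω› := fun s =>
    iSup₂_le fun B _ => (le_iSup M B).trans (hP.localEvents_le hQ)
  refine indep_iSup_of_directed_le (fun s => ?_) hle (hP.measurable_count R hR).comap_le ?_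
  · have h := hP.indep_cells (ι := s) hQ hR hQR (B := fun B => (B : {B // MeasurableSet B}).1)
      fun B => B.1.2
    refine indep_of_indep_of_le_left h (iSup₂_le fun B hB => ?_)
    rw [← measurable_iff_comap_le]
    have : (fun ω => (P ω ∩ Q ∩ B).encard) =
        (fun x : (s → Bool) → ℕ∞ => ∑ᶠ σ ∈ {σ : s → Bool | σ ⟨B, hB⟩ = true}, x σ) ∘
        fun ω (σ : s → Bool) =>
          (P ω ∩ cell Q (fun B : s => (B : {B // MeasurableSet B}).1) σ).encard := by
      funext ω
      exact encard_eq_sum_cell (P ω) Q (fun B : s => (B : {B // MeasurableSet B}).1) ⟨B, hB⟩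
    rw [this]
    refine Measurable.comp ?_ (Measurable.of_comap_le le_rfl)
    exact Measurable.of_discrete
  · exact (Monotone.directed_le fun s t hst => biSup_mono fun B hB =>
      Finset.mem_of_subset hst hB)

lemma measure_void (hP : IsPoissonPointProcess lam P μ) {B : Set Plane} (hB : MeasurableSet B)
    (hf : volume B ≠ ∞) :
    μ.real {ω | P ω ∩ B = ∅} = Real.exp (-(lam * volume.real B)) := by
  have h := (hP.law_count B hB hf).measureReal_eq (p := fun k => k = 0) (.of_discrete)
  simp only [encard_eq_zero] at h
  rw [h, map_measureReal_apply .of_discrete .of_discrete]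
  have : (Nat.cast : ℕ → ℕ∞) ⁻¹' {x | x = 0} = {0} := by ext; simp
  rw [this, poissonMeasure_real_singleton]
  simp [Measure.real, ENNReal.coe_toNNReal_eq_toReal]

lemma measurableSet_void (hP : IsPoissonPointProcess lam P μ) {B : Set Plane}
    (hB : MeasurableSet B) : MeasurableSet {ω | P ω ∩ B = ∅} := by
  have := hP.measurable_count B hB (measurableSet_singleton 0)
  simpa [Set.preimage] using! this

lemma measure_inter_void [IsProbabilityMeasure μ] (hP : IsPoissonPointProcess lam P μ)
    {Q R : Set Plane} (hQ : MeasurableSet Q) (hR : MeasurableSet R) (hQR : Disjoint Q R)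
    (hf : volume R ≠ ∞) {A : Set Ω} (hA : MeasurableSet[localEvents P Q] A) :
    μ.real (A ∩ {ω | P ω ∩ R = ∅}) = Real.exp (-(lam * volume.real R)) * μ.real A := by
  have h := (Indep_iff _ _ _).1 (hP.indep_localEvents hQ hR hQR) A {ω | P ω ∩ R = ∅} hA
    ⟨{0}, measurableSet_singleton 0, by ext; simp⟩
  rw [measureReal_def, h, ENNReal.toReal_mul, ← measureReal_def, ← measureReal_def,
    hP.measure_void hR hf, mul_comm]

/-- Almost surely, a Poisson process is locally finite. -/
lemma ae_finite (hP : IsPoissonPointProcess lam P μ) :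
    ∀ᵐ ω ∂μ, ∀ k : ℕ, (P ω ∩ Metric.closedBall 0 k).Finite := by
  rw [ae_all_iff]
  intro k
  have hf : volume (Metric.closedBall (0 : Plane) k) ≠ ∞ :=
    (isCompact_closedBall _ _).measure_lt_top.ne
  have h := (hP.law_count _ Metric.isClosed_closedBall.measurableSet hf)
  have h2 := h.measure_eq (p := fun k => ¬ (k ≠ ⊤)) .of_discrete
  rw [Measure.map_apply .of_discrete .of_discrete] at h2
  have h3 : (Nat.cast : ℕ → ℕ∞) ⁻¹' {x | ¬ (x ≠ ⊤)} = ∅ := by ext; simp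
  rw [h3, measure_empty] at h2
  filter_upwards [ae_iff.2 h2] with ω hω
  exact Set.encard_ne_top_iff.1 hω

/-- A Poisson process may be modified on a null set to be locally finite everywhere. -/
lemma exists_modification [IsProbabilityMeasure μ] (hP : IsPoissonPointProcess lam P μ) :
    ∃ P' : Ω → Set Plane, IsPoissonPointProcess lam P' μ ∧ IsLocallyFinitePattern P' ∧
      ∀ᵐ ω ∂μ, P ω = P' ω := by
  classical
  let G : Set Ω := {ω | ∀ k : ℕ, (P ω ∩ Metric.closedBall 0 k).Finite}
  have hG : MeasurableSet G := by
    have : G = ⋂ k : ℕ, {ω | (P ω ∩ Metric.closedBall 0 k).encard ≠ ⊤} := by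
      ext ω; simp [G]
    rw [this]
    exact MeasurableSet.iInter fun k => hP.measurable_count _
      Metric.isClosed_closedBall.measurableSet (MeasurableSet.of_discrete (s := {x | x ≠ ⊤}))
  let P' : Ω → Set Plane := fun ω => if ω ∈ G then P ω else ∅
  have hae : ∀ᵐ ω ∂μ, P ω = P' ω := by
    filter_upwards [hP.ae_finite] with ω hω
    exact (if_pos hω).symm
  have hm : ∀ B : Set Plane, MeasurableSet B → Measurable (fun ω => (P' ω ∩ B).encard) := by
    intro B hB
    have : (fun ω => (P' ω ∩ B).encard) = fun ω => if ω ∈ G then (P ω ∩ B).encard else 0 := by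
      funext ω
      by_cases h : ω ∈ G <;> simp [P', h]
    rw [this]
    exact Measurable.ite hG (hP.measurable_count B hB) measurable_const
  have hae' : ∀ B : Set Plane, (fun ω => (P ω ∩ B).encard) =ᵐ[μ] fun ω => (P' ω ∩ B).encard :=
    fun B => by filter_upwards [hae] with ω hω; rw [hω]
  refine ⟨P', ⟨hm, fun B hB hf => (hP.law_count B hB hf).congr (hae' B).symm,
    fun m B hB hd => (hP.indep_count m B hB hd).congr fun i => hae' (B i)⟩, ⟨hm, fun ω r => ?_⟩,
    hae⟩
  by_cases h : ω ∈ G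
  · obtain ⟨k, hk⟩ := exists_nat_ge r
    refine (h k).subset ?_
    simp only [P', if_pos h]
    exact inter_subset_inter_right _ (Metric.closedBall_subset_closedBall hk)
  · simp [P', h]

end IsPoissonPointProcess

/-! ### Stability of explored sets under perturbation of the path -/

lemma abs_coord_le_norm (w : Plane) (i : Fin 2) : |w i| ≤ ‖w‖ := by
  simpa using PiLp.norm_apply_le w i

/-- Moving every waypoint by at most `ε` changes the cone defect by at most `(1 + k) * ε` and the
radius defect by at most `3 * ε`; the constant `3 + k` covers both. -/
lemma explored_subset {k : ℝ} (hk : 0 ≤ k) {n : ℕ} {δ ε : ℝ} {v c : ℕ → Plane}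
    (h : ∀ j ≤ n, ‖v j - c j‖ ≤ ε) : explored k n δ v ⊆ explored k n (δ + (3 + k) * ε) c := by
  intro w hw
  obtain ⟨j, hj, h1, h2⟩ := mem_explored.1 hw
  have hj' := h j hj
  have hn' := h (min (j + 1) n) (min_le_right _ _)
  have hε : 0 ≤ ε := (norm_nonneg _).trans hj'
  refine mem_explored.2 ⟨j, hj, ?_, ?_⟩
  · have h3 := (abs_coord_le_norm (v j - c j) 0).trans hj'
    have h4 := (abs_coord_le_norm (v j - c j) 1).trans hj'
    simp only [PiLp.sub_apply] at *
    have h5 : |w 1 - c j 1| ≤ |w 1 - v j 1| + |v j 1 - c j 1| := abs_sub_le _ _ _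
    have h6 := (abs_le.1 h3).1
    nlinarith
  · have h3 : ‖w - c j‖ ≤ ‖w - v j‖ + ‖v j - c j‖ := norm_sub_le_norm_sub_add_norm_sub _ _ _
    have h4 : ‖v (min (j + 1) n) - v j‖ ≤
        ‖v (min (j + 1) n) - c (min (j + 1) n)‖ + ‖c (min (j + 1) n) - v j‖ :=
      norm_sub_le_norm_sub_add_norm_sub _ _ _
    have h5 : ‖c (min (j + 1) n) - v j‖ ≤ ‖c (min (j + 1) n) - c j‖ + ‖c j - v j‖ :=
      norm_sub_le_norm_sub_add_norm_sub _ _ _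
    rw [norm_sub_rev (c j)] at h5
    nlinarith [mul_nonneg hk hε]

/-- Each of the finitely many sectors misses `w` through a strict inequality, which tolerates a
small enlargement. -/
lemma eventually_not_mem_explored {k : ℝ} {n : ℕ} {v : ℕ → Plane} {w : Plane}
    (hw : w ∉ explored k n 0 v) : ∀ᶠ δ in 𝓝 (0 : ℝ), w ∉ explored k n δ v := by
  have h : ∀ᶠ δ in 𝓝 (0 : ℝ), ∀ j ∈ Finset.range (n + 1),
      ¬ (|(w - v j) 1| - k * (w - v j) 0 ≤ δ ∧ ‖w - v j‖ - ‖v (min (j + 1) n) - v j‖ ≤ δ) := by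
    rw [Finset.eventually_all]
    intro j hj
    by_cases h1 : |(w - v j) 1| - k * (w - v j) 0 ≤ 0
    · have h2 : 0 < ‖w - v j‖ - ‖v (min (j + 1) n) - v j‖ := by
        by_contra h2
        exact hw (mem_explored.2 ⟨j, Nat.lt_succ_iff.1 (Finset.mem_range.1 hj), h1, not_lt.1 h2⟩)
      filter_upwards [gt_mem_nhds h2] with δ hδ h
      exact absurd h.2 (not_le.2 hδ)
    · filter_upwards [gt_mem_nhds (not_le.1 h1)] with δ hδ h
      exact absurd h.1 (not_le.2 hδ)
  filter_upwards [h] with δ hδ hw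
  obtain ⟨j, hj, h1⟩ := mem_explored.1 hw
  exact hδ j (Finset.mem_range.2 (Nat.lt_succ_iff.2 hj)) h1

/-- The part of `v n + T` (enlarged by `ε`) that the path `v` has not explored. -/
def fresh (k : ℝ) (n : ℕ) (T : Set Plane) (ε : ℝ) (v : ℕ → Plane) : Set Plane :=
  {w | w - v n ∈ Metric.cthickening ε T} \ explored k n ((3 + k) * ε) v

lemma mem_fresh_zero {k : ℝ} {n : ℕ} {T : Set Plane} (hT : IsCompact T) {v : ℕ → Plane}
    {w : Plane} : w ∈ fresh k n T 0 v ↔ w - v n ∈ T ∧ w ∉ explored k n 0 v := by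
  simp only [fresh, Metric.cthickening_zero, hT.isClosed.closure_eq, mul_zero, Set.mem_sdiff,
    Set.mem_ofPred_eq]

lemma measurableSet_fresh (k : ℝ) (n : ℕ) (T : Set Plane) (ε : ℝ) (v : ℕ → Plane) :
    MeasurableSet (fresh k n T ε v) := by
  refine MeasurableSet.diff ?_ (isClosed_explored _ _ _ _).measurableSet
  have : Measurable fun w : Plane => w - v n := by fun_prop
  exact this Metric.isClosed_cthickening.measurableSet

lemma fresh_subset_closedBall {k : ℝ} {n : ℕ} {T : Set Plane} {r ε : ℝ} {v c : ℕ → Plane}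
    (hT : IsCompact T) (hr : T ⊆ Metric.closedBall 0 r) (hε : 0 ≤ ε) (h : ‖v n - c n‖ ≤ ε) :
    fresh k n T ε c ⊆ Metric.closedBall (v n) (r + 2 * ε) := by
  intro w hw
  have h1 : w - c n ∈ Metric.cthickening ε T := hw.1
  rw [hT.cthickening_eq_biUnion_closedBall hε] at h1
  simp only [mem_iUnion, exists_prop] at h1
  obtain ⟨x, hx, hwx⟩ := h1
  have h2 := mem_closedBall_zero_iff.1 (hr hx)
  rw [mem_closedBall_iff_norm] at hwx ⊢
  have h3 : w - v n = (w - c n - x) + x + (c n - v n) := by abel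
  rw [h3]
  rw [norm_sub_rev] at h
  linarith [norm_add₃_le (a := w - c n - x) (b := x) (c := c n - v n)]

lemma isBounded_fresh {k : ℝ} {n : ℕ} {T : Set Plane} {ε : ℝ} {v : ℕ → Plane}
    (hT : IsCompact T) (hε : 0 ≤ ε) : Bornology.IsBounded (fresh k n T ε v) := by
  obtain ⟨r, hr⟩ := hT.isBounded.subset_closedBall 0
  exact Metric.isBounded_closedBall.subset
    (fresh_subset_closedBall (v := v) hT hr hε (by simpa using hε))

lemma volume_fresh_ne_top {k : ℝ} {n : ℕ} {T : Set Plane} {ε : ℝ} {v : ℕ → Plane}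
    (hT : IsCompact T) (hε : 0 ≤ ε) : volume (fresh k n T ε v) ≠ ∞ :=
  (isBounded_fresh hT hε).measure_lt_top.ne

/-- Approximating the path changes the fresh part of `v n + T` near no fixed point. -/
lemma eventually_mem_fresh_iff {k : ℝ} (hk : 0 ≤ k) {n : ℕ} {T : Set Plane} (hT : IsCompact T)
    {v : ℕ → Plane} {c : ℕ → ℕ → Plane} {ε : ℕ → ℝ} (hε : Tendsto ε atTop (𝓝 0))
    (hε0 : ∀ m, 0 ≤ ε m) (h : ∀ m, ∀ j ≤ n, ‖v j - c m j‖ ≤ ε m) (w : Plane) :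
    ∀ᶠ m in atTop, (w ∈ fresh k n T (ε m) (c m) ↔ w ∈ fresh k n T 0 v) := by
  have h' : ∀ m, ∀ j ≤ n, ‖c m j - v j‖ ≤ ε m := fun m j hj => by
    rw [norm_sub_rev]; exact h m j hj
  rw [mem_fresh_zero hT]
  by_cases hw : w ∈ explored k n 0 v
  · refine Eventually.of_forall fun m => ?_
    have : w ∈ explored k n ((3 + k) * ε m) (c m) := by
      simpa using explored_subset hk (h m) hw
    exact ⟨fun h => absurd this h.2, fun h => absurd hw h.2⟩
  -- Comparing the enlarged approximation with the true path costs the same margin a second time.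
  have hlim : Tendsto (fun m => (3 + k) * ε m + (3 + k) * ε m) atTop (𝓝 0) := by
    simpa using (hε.const_mul (3 + k)).add (hε.const_mul (3 + k))
  have h1 : ∀ᶠ m in atTop, w ∉ explored k n ((3 + k) * ε m) (c m) := by
    filter_upwards [hlim.eventually (eventually_not_mem_explored hw)] with m hm hm'
    exact hm (explored_subset hk (h' m) hm')
  by_cases hw2 : w - v n ∈ T
  · filter_upwards [h1] with m hm
    refine iff_of_true ⟨?_, hm⟩ ⟨hw2, hw⟩
    refine Metric.mem_cthickening_of_dist_le (w - c m n) (w - v n) (ε m) T hw2 ?_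
    rw [dist_eq_norm, show w - c m n - (w - v n) = v n - c m n by abel]
    exact h m n le_rfl
  · have hlim2 : Tendsto (fun m => ε m + ε m) atTop (𝓝 0) := by simpa using hε.add hε
    -- A point outside the closed set `T` is outside some closed thickening of it.
    have h2 : ∃ δ > 0, w - v n ∉ Metric.cthickening δ T := by
      by_contra! h2
      refine hw2 ?_
      rw [← hT.isClosed.closure_eq, ← Metric.cthickening_zero,
        Metric.cthickening_eq_iInter_cthickening]
      simpa using h2
    obtain ⟨δ, hδ, h3⟩ := h2
    filter_upwards [hlim2.eventually (gt_mem_nhds hδ)] with m hm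
    refine iff_of_false (fun h4 => h3 ?_) (fun h4 => hw2 h4.1)
    have h5 : w - c m n ∈ Metric.cthickening (ε m) T := h4.1
    rw [hT.cthickening_eq_biUnion_closedBall (hε0 m)] at h5
    simp only [mem_iUnion, exists_prop] at h5
    obtain ⟨x, hx, hwx⟩ := h5
    refine Metric.mem_cthickening_of_dist_le _ x _ T hx ?_
    rw [Metric.mem_closedBall, dist_eq_norm] at hwx
    rw [dist_eq_norm, show w - v n - x = (w - c m n - x) + (c m n - v n) by abel]
    linarith [norm_add_le (w - c m n - x) (c m n - v n), h' m n le_rfl]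

/-! ### Rounding the path to a grid, and the conditional law of the unexplored process -/

/-- The index of the square of side `1 / (m + 1)` containing `v`. -/
noncomputable def gridIndex (m : ℕ) (v : Plane) : ℤ × ℤ :=
  (⌊(m + 1 : ℝ) * v 0⌋, ⌊(m + 1 : ℝ) * v 1⌋)

/-- The lower left corner of a square of side `1 / (m + 1)`. -/
noncomputable def gridPoint (m : ℕ) (z : ℤ × ℤ) : Plane :=
  !₂[(z.1 : ℝ) / (m + 1), (z.2 : ℝ) / (m + 1)]

lemma measurable_gridIndex (m : ℕ) : Measurable (gridIndex m) := by
  have h : ∀ i : Fin 2, Measurable fun v : Plane => ⌊(m + 1 : ℝ) * v i⌋ := fun i =>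
    Int.measurable_floor.comp ((continuous_const.mul (continuous_coord i)).measurable)
  exact (h 0).prodMk (h 1)

lemma norm_sub_gridPoint_le (m : ℕ) (v : Plane) :
    ‖v - gridPoint m (gridIndex m v)‖ ≤ 2 / (m + 1) := by
  have hm : (0 : ℝ) < m + 1 := by positivity
  have h : ∀ x : ℝ, (x - (⌊(m + 1 : ℝ) * x⌋ : ℝ) / (m + 1)) ^ 2 ≤ (1 / (m + 1)) ^ 2 := by
    intro x
    have h1 := Int.floor_le ((m + 1 : ℝ) * x)
    have h2 := (Int.lt_floor_add_one ((m + 1 : ℝ) * x)).le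
    have h3 : (⌊(m + 1 : ℝ) * x⌋ : ℝ) / (m + 1) ≤ x := by
      rw [div_le_iff₀ hm]; linarith
    have h4 : x ≤ (⌊(m + 1 : ℝ) * x⌋ : ℝ) / (m + 1) + 1 / (m + 1) := by
      rw [← add_div, le_div_iff₀ hm]; linarith
    exact pow_le_pow_left₀ (by linarith) (by linarith) 2
  refine abs_le_of_sq_le_sq' ?_ (by positivity) |>.2
  rw [plane_norm_sq]
  have h0 := h (v 0)
  have h1 := h (v 1)
  have h5 : (2 / (m + 1 : ℝ)) ^ 2 = 4 * (1 / (m + 1)) ^ 2 := by ring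
  have h6 : 0 ≤ (1 / (m + 1 : ℝ)) ^ 2 := by positivity
  simp only [gridPoint, gridIndex, PiLp.sub_apply, Matrix.cons_val_zero, Matrix.cons_val_one,
    Matrix.cons_val_fin_one]
  linarith

/-- The path through the corners of the squares with given indices. -/
noncomputable def gridPath (m n : ℕ) (z : Fin (n + 1) → ℤ × ℤ) (j : ℕ) : Plane :=
  if h : j < n + 1 then gridPoint m (z ⟨j, h⟩) else 0

lemma norm_sub_gridPath_le (m n : ℕ) (v : ℕ → Plane) {j : ℕ} (hj : j ≤ n) :
    ‖v j - gridPath m n (fun i => gridIndex m (v i)) j‖ ≤ 2 / (m + 1) := by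
  rw [gridPath, dif_pos (Nat.lt_succ_iff.2 hj)]
  exact norm_sub_gridPoint_le m (v j)

/-- The events that depend only on the waypoints `V_0, …, V_n`. -/
@[reducible] noncomputable def pastEvents {Ω : Type*} (θ : ℝ) (P : Ω → Set Plane) (n : ℕ) :
    MeasurableSpace Ω :=
  MeasurableSpace.comap (fun ω (i : Fin (n + 1)) => waypoint θ (P ω) i) inferInstance

/-- The unexplored part of `V_n + T`. -/
def unexplored (θ : ℝ) (S : Set Plane) (n : ℕ) (T : Set Plane) : Set Plane :=
  {w | w - waypoint θ S n ∈ T} \ explored (Real.tan θ) n 0 (waypoint θ S)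

lemma fresh_zero {θ : ℝ} {n : ℕ} {T : Set Plane} (hT : IsCompact T) (S : Set Plane) :
    fresh (Real.tan θ) n T 0 (waypoint θ S) = unexplored θ S n T := by
  ext w
  exact mem_fresh_zero hT

section

variable {Ω : Type*} [MeasurableSpace Ω] {θ : ℝ} {P : Ω → Set Plane}

lemma pastEvents_le (hθ : 0 < θ) (hθ' : θ < Real.pi / 2) (hF : IsLocallyFinitePattern P) (n : ℕ) :
    pastEvents θ P n ≤ ‹MeasurableSpace Ω› :=
  (measurable_pi_lambda (fun ω (i : Fin (n + 1)) => waypoint θ (P ω) i)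
    fun i => hF.measurable_waypoint hθ hθ' i).comap_le

omit [MeasurableSpace Ω] in
lemma measurable_waypoint_pastEvents (θ : ℝ) (P : Ω → Set Plane) {j n : ℕ} (hj : j ≤ n) :
    Measurable[pastEvents θ P n] fun ω => waypoint θ (P ω) j :=
  (measurable_pi_apply (⟨j, Nat.lt_succ_iff.2 hj⟩ : Fin (n + 1))).comp
    (Measurable.of_comap_le (m₁ := pastEvents θ P n) le_rfl)

/-- The discretized waypoints. -/
noncomputable def pathIndex (θ : ℝ) (n m : ℕ) (S : Set Plane) : Fin (n + 1) → ℤ × ℤ :=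
  fun i => gridIndex m (waypoint θ S i)

lemma measurable_pathIndex (hθ : 0 < θ) (hθ' : θ < Real.pi / 2) (hF : IsLocallyFinitePattern P)
    (n m : ℕ) : Measurable fun ω => pathIndex θ n m (P ω) :=
  measurable_pi_lambda _ fun i => (measurable_gridIndex m).comp (hF.measurable_waypoint hθ hθ' i)

/-- The discretized explored set. -/
noncomputable def gridExplored (θ : ℝ) (n m : ℕ) (z : Fin (n + 1) → ℤ × ℤ) : Set Plane :=
  explored (Real.tan θ) n ((3 + Real.tan θ) * (2 / (m + 1))) (gridPath m n z)

/-- The discretized unexplored set. -/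
noncomputable def gridFresh (θ : ℝ) (n m : ℕ) (T : Set Plane) (z : Fin (n + 1) → ℤ × ℤ) :
    Set Plane :=
  fresh (Real.tan θ) n T (2 / (m + 1)) (gridPath m n z)

lemma explored_subset_gridExplored (hθ : 0 < θ) (hθ' : θ < Real.pi / 2) (n m : ℕ)
    (S : Set Plane) : explored (Real.tan θ) n 0 (waypoint θ S) ⊆
      gridExplored θ n m (pathIndex θ n m S) := by
  have hk := Real.tan_pos_of_pos_of_lt_pi_div_two hθ hθ'
  have := explored_subset (δ := 0) (n := n) hk.le
    fun j hj => norm_sub_gridPath_le m n (waypoint θ S) hj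
  rwa [zero_add] at this

/-- The path belongs to a given family of non-stopped paths with given discretization. -/
def PathIn (θ : ℝ) (n m : ℕ) (A : Set (Fin (n + 1) → Plane)) (z : Fin (n + 1) → ℤ × ℤ)
    (S : Set Plane) : Prop :=
  (fun i : Fin (n + 1) => waypoint θ S i) ∈ A ∧
    (∀ j < n, waypoint θ S (j + 1) ≠ waypoint θ S j) ∧ pathIndex θ n m S = z

/-- The rounded explored set contains the true one and depends on `z` alone, so `waypoint_local`
applies with a deterministic region. -/
lemma PathIn.congr (hθ : 0 < θ) (hθ' : θ < Real.pi / 2) {n m : ℕ}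
    {A : Set (Fin (n + 1) → Plane)} {z : Fin (n + 1) → ℤ × ℤ} {S S' : Set Plane}
    (h : PathIn θ n m A z S) (hSS : S ∩ gridExplored θ n m z = S' ∩ gridExplored θ n m z) :
    PathIn θ n m A z S' := by
  obtain ⟨h1, h2, rfl⟩ := h
  have h3 := waypoint_local hθ hθ' hSS h2 (explored_subset_gridExplored hθ hθ' n m S)
  refine ⟨?_, fun j hj => ?_, ?_⟩
  · convert! h1 using 2 with i
    exact h3 i (Nat.lt_succ_iff.1 i.2)
  · rw [h3 (j + 1) hj, h3 j hj.le]
    exact h2 j hj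
  · funext i
    simp only [pathIndex]
    rw [h3 i (Nat.lt_succ_iff.1 i.2)]

lemma measurableSet_pathIn (hθ : 0 < θ) (hθ' : θ < Real.pi / 2) (hF : IsLocallyFinitePattern P)
    {n m : ℕ} {A : Set (Fin (n + 1) → Plane)} (hA : MeasurableSet A)
    (z : Fin (n + 1) → ℤ × ℤ) : MeasurableSet {ω | PathIn θ n m A z (P ω)} := by
  refine MeasurableSet.inter ?_ (MeasurableSet.inter ?_ ?_)
  · exact (measurable_pi_lambda _ fun i : Fin (n + 1) => hF.measurable_waypoint hθ hθ' i) hA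
  · have : {ω | ∀ j < n, waypoint θ (P ω) (j + 1) ≠ waypoint θ (P ω) j} =
        ⋂ j ∈ Set.Iio n, {ω | waypoint θ (P ω) (j + 1) = waypoint θ (P ω) j}ᶜ := by
      ext ω; simp
    refine (congrArg MeasurableSet this).mpr ?_
    exact MeasurableSet.biInter (Set.to_countable _) fun j _ => (measurableSet_eq_fun
      (hF.measurable_waypoint hθ hθ' _) (hF.measurable_waypoint hθ hθ' _)).compl
  · exact (measurable_pathIndex hθ hθ' hF n m) (measurableSet_singleton z)

/-- Restricting the process to the rounded explored set does not change the event, and for the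
restricted pattern measurability is local. -/
lemma measurableSet_pathIn_localEvents (hθ : 0 < θ) (hθ' : θ < Real.pi / 2)
    (hF : IsLocallyFinitePattern P) {n m : ℕ} {A : Set (Fin (n + 1) → Plane)} (hA : MeasurableSet A)
    (z : Fin (n + 1) → ℤ × ℤ) :
    MeasurableSet[localEvents P (gridExplored θ n m z)] {ω | PathIn θ n m A z (P ω)} := by
  have h := @measurableSet_pathIn Ω (localEvents P (gridExplored θ n m z)) θ _ hθ hθ'
    (hF.restrict _) n m A hA z
  convert! h using 1
  ext ω
  exact ⟨fun h => h.congr hθ hθ' (by rw [inter_assoc, inter_self]),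
    fun h => h.congr hθ hθ' (by rw [inter_assoc, inter_self])⟩

variable {μ : Measure Ω} [IsProbabilityMeasure μ] {lam : ℝ≥0}

/-- Conditional void probability for the discretized path. -/
lemma measure_pathIn_inter_void (hθ : 0 < θ) (hθ' : θ < Real.pi / 2)
    (hP : IsPoissonPointProcess lam P μ) (hF : IsLocallyFinitePattern P) {n m : ℕ}
    {A : Set (Fin (n + 1) → Plane)} (hA : MeasurableSet A) (z : Fin (n + 1) → ℤ × ℤ)
    {T : Set Plane} (hT : IsCompact T) :
    μ.real ({ω | PathIn θ n m A z (P ω)} ∩ {ω | P ω ∩ gridFresh θ n m T z = ∅}) =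
      Real.exp (-(lam * volume.real (gridFresh θ n m T z))) *
        μ.real {ω | PathIn θ n m A z (P ω)} := by
  refine hP.measure_inter_void (Q := gridExplored θ n m z) ?_ ?_ ?_ ?_ ?_
  · exact (isClosed_explored _ _ _ _).measurableSet
  · exact measurableSet_fresh _ _ _ _ _
  · exact disjoint_sdiff_self_right
  · exact volume_fresh_ne_top hT (by positivity)
  · exact measurableSet_pathIn_localEvents hθ hθ' hF hA z

open Classical in
/-- The indicator that the discretized unexplored set is empty. -/
noncomputable def gridVoid (θ : ℝ) (n m : ℕ) (T : Set Plane) (S : Set Plane) : ℝ :=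
  if S ∩ gridFresh θ n m T (pathIndex θ n m S) = ∅ then 1 else 0

omit [IsProbabilityMeasure μ] in
lemma measurable_gridVoid (hθ : 0 < θ) (hθ' : θ < Real.pi / 2)
    (hP : IsPoissonPointProcess lam P μ) (hF : IsLocallyFinitePattern P) (n m : ℕ) (T : Set Plane) :
    Measurable fun ω => gridVoid θ n m T (P ω) := by
  classical
  refine Measurable.ite ?_ measurable_const measurable_const
  have : {ω | P ω ∩ gridFresh θ n m T (pathIndex θ n m (P ω)) = ∅} =
      ⋃ z, {ω | pathIndex θ n m (P ω) = z} ∩ {ω | P ω ∩ gridFresh θ n m T z = ∅} := by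
    ext ω; simp
  rw [this]
  refine MeasurableSet.iUnion fun z => MeasurableSet.inter ?_ ?_
  · exact (measurable_pathIndex hθ hθ' hF n m) (measurableSet_singleton z)
  · exact hP.measurableSet_void (measurableSet_fresh _ _ _ _ _)

/-- The void probability of the discretized unexplored set. -/
noncomputable def gridProb (lam : ℝ≥0) (θ : ℝ) (n m : ℕ) (T : Set Plane) (S : Set Plane) : ℝ :=
  Real.exp (-(lam * volume.real (gridFresh θ n m T (pathIndex θ n m S))))

lemma measurable_gridProb (hθ : 0 < θ) (hθ' : θ < Real.pi / 2) (hF : IsLocallyFinitePattern P)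
    (n m : ℕ) (T : Set Plane) : Measurable fun ω => gridProb lam θ n m T (P ω) :=
  (Measurable.of_discrete (f := fun z : Fin (n + 1) → ℤ × ℤ =>
    Real.exp (-(lam * volume.real (gridFresh θ n m T z))))).comp
    (measurable_pathIndex hθ hθ' hF n m)

lemma gridVoid_norm_le (n m : ℕ) (T S : Set Plane) : ‖gridVoid θ n m T S‖ ≤ 1 := by
  unfold gridVoid; split_ifs <;> simp

lemma exp_neg_norm_le (lam : ℝ≥0) (B : Set Plane) :
    ‖Real.exp (-(lam * volume.real B))‖ ≤ 1 := by
  rw [Real.norm_eq_abs, Real.abs_exp, Real.exp_le_one_iff, neg_nonpos]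
  positivity

/-- There are countably many rounded paths, and on each corresponding event the fresh region is
deterministic, so the identity is a sum of instances of `measure_pathIn_inter_void`. By `hnd` the
pieces cover `A` up to a null set. -/
lemma setIntegral_gridVoid (hθ : 0 < θ) (hθ' : θ < Real.pi / 2)
    (hP : IsPoissonPointProcess lam P μ) (hF : IsLocallyFinitePattern P) {n : ℕ}
    (hnd : ∀ᵐ ω ∂μ, ∀ j < n, waypoint θ (P ω) (j + 1) ≠ waypoint θ (P ω) j)
    {A : Set Ω} (hA : MeasurableSet[pastEvents θ P n] A) (m : ℕ)
    {T : Set Plane} (hT : IsCompact T) :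
    ∫ ω in A, gridVoid θ n m T (P ω) ∂μ = ∫ ω in A, gridProb lam θ n m T (P ω) ∂μ := by
  obtain ⟨A', hA', rfl⟩ := hA
  let B : (Fin (n + 1) → ℤ × ℤ) → Set Ω := fun z => {ω | PathIn θ n m A' z (P ω)}
  have hB : ∀ z, MeasurableSet (B z) := fun z => measurableSet_pathIn hθ hθ' hF hA' z
  have hd : Pairwise (Function.onFun Disjoint B) := fun z z' hne =>
    Set.disjoint_left.2 fun ω h h' => hne (h.2.2.symm.trans h'.2.2)
  have hae : (fun ω (i : Fin (n + 1)) => waypoint θ (P ω) i) ⁻¹' A' =ᵐ[μ] ⋃ z, B z := by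
    filter_upwards [hnd] with ω hω
    refine propext ⟨fun h => mem_iUnion.2 ⟨_, h, hω, rfl⟩, fun h => ?_⟩
    obtain ⟨z, hz⟩ := mem_iUnion.1 h
    exact hz.1
  have i1 : Integrable (fun ω => gridVoid θ n m T (P ω)) μ :=
    .of_bound (measurable_gridVoid hθ hθ' hP hF n m T).aestronglyMeasurable 1
      (.of_forall fun ω => gridVoid_norm_le n m T (P ω))
  have i2 : Integrable (fun ω => gridProb lam θ n m T (P ω)) μ :=
    .of_bound (measurable_gridProb hθ hθ' hF n m T).aestronglyMeasurable 1
      (.of_forall fun ω => exp_neg_norm_le _ _)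
  rw [setIntegral_congr_set hae, setIntegral_congr_set hae,
    integral_iUnion hB hd i1.integrableOn, integral_iUnion hB hd i2.integrableOn]
  congr 1
  funext z
  have hmf : MeasurableSet {ω | P ω ∩ gridFresh θ n m T z = ∅} :=
    hP.measurableSet_void (measurableSet_fresh _ _ _ _ _)
  have h1 : ∫ ω in B z, gridProb lam θ n m T (P ω) ∂μ =
      ∫ _ in B z, Real.exp (-(lam * volume.real (gridFresh θ n m T z))) ∂μ :=
    setIntegral_congr_fun (hB z) fun ω hω => by simp only [gridProb]; rw [hω.2.2]
  have h2 : ∫ ω in B z, gridVoid θ n m T (P ω) ∂μ =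
      ∫ ω in B z, {ω | P ω ∩ gridFresh θ n m T z = ∅}.indicator (fun _ => (1 : ℝ)) ω ∂μ :=
    setIntegral_congr_fun (hB z) fun ω hω => by
      simp only [gridVoid, Set.indicator_apply, Set.mem_ofPred_eq]; rw [hω.2.2]
  rw [h1, h2, setIntegral_const, setIntegral_indicator hmf, setIntegral_const,
    measure_pathIn_inter_void hθ hθ' hP hF hA' z hT]
  simp only [smul_eq_mul, mul_one]
  rw [mul_comm]

lemma tendsto_two_div : Tendsto (fun m : ℕ => 2 / ((m : ℝ) + 1)) atTop (𝓝 0) := by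
  simpa [div_eq_mul_inv] using (tendsto_one_div_add_atTop_nhds_zero_nat (𝕜 := ℝ)).const_mul 2

lemma two_div_le (m : ℕ) : 2 / ((m : ℝ) + 1) ≤ 2 := by
  rw [div_le_iff₀ (by positivity)]; nlinarith [(Nat.cast_nonneg m : (0 : ℝ) ≤ m)]

lemma eventually_mem_gridFresh_iff (hθ : 0 < θ) (hθ' : θ < Real.pi / 2) (n : ℕ) {T : Set Plane}
    (hT : IsCompact T) (S : Set Plane) (w : Plane) :
    ∀ᶠ m in atTop, (w ∈ gridFresh θ n m T (pathIndex θ n m S) ↔ w ∈ unexplored θ S n T) := by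
  rw [← fresh_zero hT]
  exact eventually_mem_fresh_iff (Real.tan_pos_of_pos_of_lt_pi_div_two hθ hθ').le hT
    tendsto_two_div (fun m => by positivity)
    (fun m j hj => norm_sub_gridPath_le m n (waypoint θ S) hj) w

lemma gridFresh_subset (n : ℕ) {T : Set Plane} (hT : IsCompact T) (S : Set Plane) {r : ℝ}
    (hr : T ⊆ Metric.closedBall 0 r) (m : ℕ) :
    gridFresh θ n m T (pathIndex θ n m S) ⊆ Metric.closedBall (waypoint θ S n) (r + 4) := by
  refine (fresh_subset_closedBall (v := waypoint θ S) hT hr (by positivity)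
    (norm_sub_gridPath_le m n (waypoint θ S) le_rfl)).trans
    (Metric.closedBall_subset_closedBall ?_)
  linarith [two_div_le m]

lemma tendsto_gridProb (hθ : 0 < θ) (hθ' : θ < Real.pi / 2) (n : ℕ) {T : Set Plane}
    (hT : IsCompact T) (S : Set Plane) :
    Tendsto (fun m => gridProb lam θ n m T S) atTop
      (𝓝 (Real.exp (-(lam * volume.real (unexplored θ S n T))))) := by
  obtain ⟨r, hr⟩ := hT.isBounded.subset_closedBall 0
  have h := tendsto_measure_of_tendsto_indicator (μ := (volume : Measure Plane)) atTop
    (As := fun m => gridFresh θ n m T (pathIndex θ n m S)) (A := unexplored θ S n T)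
    (fun m => measurableSet_fresh _ _ _ _ _)
    (B := Metric.closedBall (waypoint θ S n) (r + 4)) Metric.isClosed_closedBall.measurableSet
    (isCompact_closedBall _ _).measure_lt_top.ne
    (.of_forall fun m => gridFresh_subset n hT S hr m) (eventually_mem_gridFresh_iff hθ hθ' n hT S)
  have hfin : volume (unexplored θ S n T) ≠ ∞ := by
    rw [← fresh_zero hT]; exact volume_fresh_ne_top hT le_rfl
  have h2 := (ENNReal.tendsto_toReal hfin).comp h
  exact (Real.continuous_exp.tendsto _).comp ((h2.const_mul (lam : ℝ)).neg)

-- Only finitely many points of the process lie near V_n, so convergence of membership at each fixed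
-- point is eventually simultaneous for all of them.
open Classical in
lemma tendsto_gridVoid (hθ : 0 < θ) (hθ' : θ < Real.pi / 2) (hF : IsLocallyFinitePattern P) (n : ℕ)
    {T : Set Plane} (hT : IsCompact T) (ω : Ω) :
    Tendsto (fun m => gridVoid θ n m T (P ω)) atTop
      (𝓝 (if P ω ∩ unexplored θ (P ω) n T = ∅ then 1 else 0)) := by
  obtain ⟨r, hr⟩ := hT.isBounded.subset_closedBall 0
  have hfin : (P ω ∩ Metric.closedBall (waypoint θ (P ω) n) (r + 4)).Finite :=
    hF.finite_of_bounded ω Metric.isBounded_closedBall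
  have hev := (Set.Finite.eventually_all hfin).2 fun w _ =>
    eventually_mem_gridFresh_iff hθ hθ' n hT (P ω) w
  have hsub : unexplored θ (P ω) n T ⊆ Metric.closedBall (waypoint θ (P ω) n) (r + 4) := by
    intro w hw
    have := mem_closedBall_zero_iff.1 (hr hw.1)
    rw [mem_closedBall_iff_norm]
    linarith
  refine tendsto_const_nhds.congr' ?_
  filter_upwards [hev] with m hm
  have : P ω ∩ gridFresh θ n m T (pathIndex θ n m (P ω)) = P ω ∩ unexplored θ (P ω) n T := by
    ext w
    refine ⟨fun h => ⟨h.1, (hm w ⟨h.1, gridFresh_subset n hT _ hr m h.2⟩).1 h.2⟩,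
      fun h => ⟨h.1, (hm w ⟨h.1, hsub h.2⟩).2 h.2⟩⟩
  rw [gridVoid, this]

omit [IsProbabilityMeasure μ] in
lemma measurableSet_void_unexplored (hθ : 0 < θ) (hθ' : θ < Real.pi / 2)
    (hP : IsPoissonPointProcess lam P μ) (hF : IsLocallyFinitePattern P) (n : ℕ) {T : Set Plane}
    (hT : IsCompact T) : MeasurableSet {ω | P ω ∩ unexplored θ (P ω) n T = ∅} := by
  classical
  have h := measurable_of_tendsto_metrizable (fun m => measurable_gridVoid hθ hθ' hP hF n m T)
    (tendsto_pi_nhds.2 fun ω => tendsto_gridVoid hθ hθ' hF n hT ω)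
  have h2 := h (measurableSet_singleton 1)
  convert! h2 using 1
  ext ω
  by_cases h : P ω ∩ unexplored θ (P ω) n T = ∅ <;> simp [h]

lemma measurable_exp_unexplored (hθ : 0 < θ) (hθ' : θ < Real.pi / 2)
    (lam : ℝ≥0) (hF : IsLocallyFinitePattern P) (n : ℕ) {T : Set Plane}
    (hT : IsCompact T) :
    Measurable fun ω => Real.exp (-(lam * volume.real (unexplored θ (P ω) n T))) :=
  measurable_of_tendsto_metrizable (fun m => measurable_gridProb hθ hθ' hF n m T)
    (tendsto_pi_nhds.2 fun ω => tendsto_gridProb hθ hθ' n hT (P ω))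

/-- Given the past, the unexplored part of the process is again a Poisson process: its conditional
void probabilities. -/
theorem measure_inter_void_unexplored (hθ : 0 < θ) (hθ' : θ < Real.pi / 2)
    (hP : IsPoissonPointProcess lam P μ) (hF : IsLocallyFinitePattern P) {n : ℕ}
    (hnd : ∀ᵐ ω ∂μ, ∀ j < n, waypoint θ (P ω) (j + 1) ≠ waypoint θ (P ω) j)
    {A : Set Ω} (hA : MeasurableSet[pastEvents θ P n] A) {T : Set Plane} (hT : IsCompact T) :
    μ.real (A ∩ {ω | P ω ∩ unexplored θ (P ω) n T = ∅}) =
      ∫ ω in A, Real.exp (-(lam * volume.real (unexplored θ (P ω) n T))) ∂μ := by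
  classical
  have hAm : MeasurableSet A := pastEvents_le hθ hθ' hF n _ hA
  have h1 : Tendsto (fun m => ∫ ω in A, gridVoid θ n m T (P ω) ∂μ) atTop
      (𝓝 (∫ ω in A, (if P ω ∩ unexplored θ (P ω) n T = ∅ then 1 else 0) ∂μ)) :=
    tendsto_integral_of_dominated_convergence (fun _ => 1)
      (fun m => (measurable_gridVoid hθ hθ' hP hF n m T).aestronglyMeasurable)
      (integrable_const _) (fun m => .of_forall fun ω => gridVoid_norm_le n m T (P ω))
      (.of_forall fun ω => tendsto_gridVoid hθ hθ' hF n hT ω)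
  have h2 : Tendsto (fun m => ∫ ω in A, gridProb lam θ n m T (P ω) ∂μ) atTop
      (𝓝 (∫ ω in A, Real.exp (-(lam * volume.real (unexplored θ (P ω) n T))) ∂μ)) :=
    tendsto_integral_of_dominated_convergence (fun _ => 1)
      (fun m => (measurable_gridProb hθ hθ' hF n m T).aestronglyMeasurable)
      (integrable_const _) (fun m => .of_forall fun ω => exp_neg_norm_le _ _)
      (.of_forall fun ω => tendsto_gridProb hθ hθ' n hT (P ω))
  -- The two sequences agree for every mesh, hence so do their limits.
  simp_rw [setIntegral_gridVoid hθ hθ' hP hF hnd hA _ hT] at h1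
  rw [← tendsto_nhds_unique h1 h2]
  have h3 : (fun ω => if P ω ∩ unexplored θ (P ω) n T = ∅ then (1 : ℝ) else 0) =
      {ω | P ω ∩ unexplored θ (P ω) n T = ∅}.indicator fun _ => (1 : ℝ) := by
    funext ω; simp [Set.indicator_apply]
  rw [h3, setIntegral_indicator (measurableSet_void_unexplored hθ hθ' hP hF n hT),
    setIntegral_const, smul_eq_mul, mul_one]

end

/-! ### Areas of unexplored sets and the narrow cone -/

lemma measurableSet_unexplored (θ : ℝ) (S : Set Plane) (n : ℕ) {T : Set Plane}
    (hT : MeasurableSet T) : MeasurableSet (unexplored θ S n T) := by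
  refine MeasurableSet.diff ?_ (isClosed_explored _ _ _ _).measurableSet
  have : Measurable fun w : Plane => w - waypoint θ S n := by fun_prop
  exact this hT

lemma volume_translate (v : Plane) (T : Set Plane) :
    volume {w : Plane | w - v ∈ T} = volume T :=
  by simpa only [sub_eq_add_neg] using! measure_preimage_add_right volume (-v) T

lemma volume_unexplored_le (θ : ℝ) (S : Set Plane) (n : ℕ) {T : Set Plane}
    (hT : volume T ≠ ∞) : volume.real (unexplored θ S n T) ≤ volume.real T := by
  refine ENNReal.toReal_mono hT ?_
  rw [← volume_translate (waypoint θ S n) T]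
  exact measure_mono sdiff_subset

lemma volume_unexplored_ne_top (θ : ℝ) (S : Set Plane) (n : ℕ) {T : Set Plane}
    (hT : volume T ≠ ∞) : volume (unexplored θ S n T) ≠ ∞ := by
  refine ne_top_of_le_ne_top hT ?_
  rw [← volume_translate (waypoint θ S n) T]
  exact measure_mono sdiff_subset

lemma volume_unexplored_union (θ : ℝ) (S : Set Plane) (n : ℕ) {T T' : Set Plane}
    (hT' : MeasurableSet T') (hd : Disjoint T T')
    (hf : volume T ≠ ∞) (hf' : volume T' ≠ ∞) :
    volume.real (unexplored θ S n (T ∪ T')) =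
      volume.real (unexplored θ S n T) + volume.real (unexplored θ S n T') := by
  rw [← measureReal_union _ (measurableSet_unexplored θ S n hT')
    (volume_unexplored_ne_top θ S n hf) (volume_unexplored_ne_top θ S n hf')]
  · congr 1
    ext w
    simp only [unexplored, Set.mem_sdiff, Set.mem_ofPred_eq, Set.mem_union]
    tauto
  · exact Set.disjoint_left.2 fun w h h' => Set.disjoint_left.1 hd h.1 h'.1

/-- The slope of a cone that is narrow enough to avoid all explored sets. -/
noncomputable def narrowSlope (θ : ℝ) : ℝ := min (Real.tan θ) (Real.tan θ)⁻¹

lemma narrowSlope_pos {θ : ℝ} (hθ : 0 < θ) (hθ' : θ < Real.pi / 2) : 0 < narrowSlope θ := by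
  have hk := Real.tan_pos_of_pos_of_lt_pi_div_two hθ hθ'
  exact lt_min hk (inv_pos.2 hk)

lemma narrowSlope_le (θ : ℝ) : narrowSlope θ ≤ Real.tan θ := min_le_left _ _

lemma tan_mul_narrowSlope_le {θ : ℝ} (hθ : 0 < θ) (hθ' : θ < Real.pi / 2) :
    Real.tan θ * narrowSlope θ ≤ 1 := by
  have hk := Real.tan_pos_of_pos_of_lt_pi_div_two hθ hθ'
  calc Real.tan θ * narrowSlope θ ≤ Real.tan θ * (Real.tan θ)⁻¹ :=
        mul_le_mul_of_nonneg_left (min_le_right _ _) hk.le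
    _ = 1 := mul_inv_cancel₀ hk.ne'

/-- By `narrow_not_mem_explored` at most the apex is removed, and a point has no area. This makes
the bounds below uniform in the past. -/
lemma volume_unexplored_narrow {θ : ℝ} (hθ : 0 < θ) (hθ' : θ < Real.pi / 2) {S : Set Plane}
    {n : ℕ} (hnd : ∀ j < n, waypoint θ S (j + 1) ≠ waypoint θ S j) {T : Set Plane}
    (hT : T ⊆ wedge (narrowSlope θ)) : volume.real (unexplored θ S n T) = volume.real T := by
  rw [measureReal_def, measureReal_def, ← volume_translate (waypoint θ S n) T]
  congr 1
  refine le_antisymm (measure_mono sdiff_subset) ?_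
  calc volume {w : Plane | w - waypoint θ S n ∈ T}
      ≤ volume (unexplored θ S n T ∪ {waypoint θ S n}) := measure_mono fun w hw => by
        by_cases h : w = waypoint θ S n
        · exact Or.inr h
        · exact Or.inl ⟨hw, narrow_not_mem_explored hθ hθ' hnd (narrowSlope_pos hθ hθ')
            (tan_mul_narrowSlope_le hθ hθ') (hT hw) h⟩
    _ ≤ volume (unexplored θ S n T) + volume {waypoint θ S n} := measure_union_le _ _
    _ = volume (unexplored θ S n T) := by rw [measure_singleton, add_zero]

/-- A sector of radius `r`. -/
def sector (k r : ℝ) : Set Plane := wedge k ∩ Metric.closedBall 0 r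

lemma mem_sector {k r : ℝ} {w : Plane} : w ∈ sector k r ↔ w ∈ wedge k ∧ ‖w‖ ≤ r := by
  simp [sector]

lemma sector_subset_wedge (k r : ℝ) : sector k r ⊆ wedge k := inter_subset_left

lemma isCompact_sector (k r : ℝ) : IsCompact (sector k r) :=
  (isCompact_closedBall _ _).inter_left (isClosed_wedge k)

lemma volume_sector_pos {k : ℝ} (hk : 0 < k) : 0 < volume.real (sector k 1) := by
  rw [measureReal_def]
  refine ENNReal.toReal_pos (ne_of_gt ?_) (isCompact_sector k 1).measure_lt_top.ne
  have ho : IsOpen ({w : Plane | |w 1| < k * w 0} ∩ Metric.ball 0 1) :=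
    (isOpen_lt (continuous_coord 1).abs (continuous_const.mul (continuous_coord 0))).inter
      Metric.isOpen_ball
  have hne : ({w : Plane | |w 1| < k * w 0} ∩ Metric.ball 0 1).Nonempty := by
    refine ⟨!₂[1 / 2, 0], by simpa using hk, ?_⟩
    rw [mem_ball_zero_iff, ← abs_of_nonneg (norm_nonneg _), ← sq_lt_one_iff_abs_lt_one,
      plane_norm_sq]
    norm_num
  exact (ho.measure_pos volume hne).trans_le (measure_mono fun w hw =>
    ⟨mem_wedge.2 (le_of_lt hw.1), Metric.ball_subset_closedBall hw.2⟩)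

open scoped Pointwise in
lemma volume_sector {k : ℝ} {r : ℝ} (hr : 0 ≤ r) :
    r ^ 2 * volume.real (sector k 1) ≤ volume.real (sector k r) := by
  have h : r • sector k 1 ⊆ sector k r := by
    rintro _ ⟨w, hw, rfl⟩
    obtain ⟨h1, h2⟩ := mem_sector.1 hw
    refine mem_sector.2 ⟨?_, ?_⟩
    · rw [mem_wedge] at *
      simp only [PiLp.smul_apply, smul_eq_mul, abs_mul, abs_of_nonneg hr]
      nlinarith
    · change ‖r • w‖ ≤ r
      rw [norm_smul, Real.norm_eq_abs, abs_of_nonneg hr]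
      nlinarith
  have h2 := measureReal_mono h (μ := volume) (isCompact_sector k r).measure_lt_top.ne
  rw [measureReal_def, Measure.addHaar_smul] at h2
  simpa [ENNReal.toReal_mul, abs_of_nonneg, hr, measureReal_def] using h2

/-! ### Step lengths and existence of successors -/

section

variable {Ω : Type*} [MeasurableSpace Ω] {θ : ℝ} {P : Ω → Set Plane}
  {μ : Measure Ω} [IsProbabilityMeasure μ] {lam : ℝ≥0}

/-- A point of the process near `V_n` in the cone bounds the next step. -/
lemma norm_step_le {S : Set Plane} {n : ℕ} {p : Plane} (hp : p ∈ S)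
    (hc : p ∈ cone θ (waypoint θ S n)) :
    ‖waypoint θ S (n + 1) - waypoint θ S n‖ ≤ ‖p - waypoint θ S n‖ := by
  rcases successor_eq_self_or (θ := θ) S (waypoint θ S n) with h | h
  · simpa [waypoint, dist_eq_norm] using h.2 p ⟨hp, hc⟩
  · simp [waypoint, h]

lemma mem_cone_of_mem_unexplored (hθ : 0 < θ) (hθ' : θ < Real.pi / 2) {S : Set Plane} {n : ℕ}
    {T : Set Plane} (hT : T ⊆ wedge (Real.tan θ)) {p : Plane} (hp : p ∈ unexplored θ S n T) :
    p ∈ cone θ (waypoint θ S n) := by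
  refine (mem_cone_iff hθ hθ').2 ⟨hT hp.1, ?_⟩
  rintro rfl
  exact hp.2 (mem_explored.2 ⟨n, le_rfl, by simp, by simp⟩)

lemma setIntegral_exp_le (hθ : 0 < θ) (hθ' : θ < Real.pi / 2) (hF : IsLocallyFinitePattern P) {n : ℕ}
    {T : Set Plane} (hT : IsCompact T) {a : ℝ}
    (ha : ∀ᵐ ω ∂μ, a ≤ volume.real (unexplored θ (P ω) n T)) (A : Set Ω) :
    ∫ ω in A, Real.exp (-(lam * volume.real (unexplored θ (P ω) n T))) ∂μ ≤
      Real.exp (-(lam * a)) * μ.real A := by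
  calc _ ≤ ∫ _ in A, Real.exp (-(lam * a)) ∂μ := by
        refine integral_mono_ae ?_ (integrable_const _) ?_
        · exact .of_bound (measurable_exp_unexplored hθ hθ' lam hF n hT).aestronglyMeasurable 1
            (.of_forall fun ω => exp_neg_norm_le _ _)
        · filter_upwards [ae_restrict_of_ae ha] with ω hω
          gcongr
    _ = _ := by rw [setIntegral_const, smul_eq_mul, mul_comm]

/-- Gaussian tails of the steps. -/
lemma measure_step_gt_le (hθ : 0 < θ) (hθ' : θ < Real.pi / 2)
    (hP : IsPoissonPointProcess lam P μ) (hF : IsLocallyFinitePattern P) {n : ℕ}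
    (hnd : ∀ᵐ ω ∂μ, ∀ j < n, waypoint θ (P ω) (j + 1) ≠ waypoint θ (P ω) j)
    {A : Set Ω} (hA : MeasurableSet[pastEvents θ P n] A) {r : ℝ} (hr : 0 ≤ r) :
    μ.real (A ∩ {ω | r < ‖waypoint θ (P ω) (n + 1) - waypoint θ (P ω) n‖}) ≤
      Real.exp (-(lam * (r ^ 2 * volume.real (sector (narrowSlope θ) 1)))) * μ.real A := by
  have hT := isCompact_sector (narrowSlope θ) r
  have hsub : sector (narrowSlope θ) r ⊆ wedge (Real.tan θ) :=
    (sector_subset_wedge _ _).trans (wedge_mono (narrowSlope_pos hθ hθ') (narrowSlope_le θ))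
  -- Any point in the narrow sector of radius `r` would stop the step within distance `r`, so a
  -- longer step requires this sector to be void.
  refine le_trans (measureReal_mono (inter_subset_inter_right A
    (t := {ω | P ω ∩ unexplored θ (P ω) n (sector (narrowSlope θ) r) = ∅}) fun ω hω => ?_)) ?_
  · refine Set.eq_empty_iff_forall_notMem.2 fun p hp => ?_
    have h1 := norm_step_le hp.1 (mem_cone_of_mem_unexplored hθ hθ' hsub hp.2)
    have h2 := (mem_sector.1 hp.2.1).2
    exact absurd (lt_of_lt_of_le hω (h1.trans h2)) (lt_irrefl _)
  · rw [measure_inter_void_unexplored hθ hθ' hP hF hnd hA hT]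
    refine setIntegral_exp_le hθ hθ' hF hT ?_ A
    filter_upwards [hnd] with ω hω
    rw [volume_unexplored_narrow hθ hθ' hω (sector_subset_wedge _ _)]
    exact volume_sector hr

lemma exists_isSuccessor (hF : IsLocallyFinitePattern P) (ω : Ω) {v p : Plane} (hp : p ∈ P ω)
    (hc : p ∈ cone θ v) : ∃ w, IsSuccessor θ (P ω) v w := by
  have hfin : (P ω ∩ cone θ v ∩ Metric.closedBall v (dist p v)).Finite :=
    (hF.finite_of_bounded ω Metric.isBounded_closedBall).subset
      (inter_subset_inter_left _ inter_subset_left)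
  obtain ⟨w, hw, hmin⟩ := hfin.exists_minimalFor (fun w => dist w v) _
    ⟨p, ⟨hp, hc⟩, Metric.mem_closedBall.2 le_rfl⟩
  refine ⟨w, hw.1, fun w' hw' => ?_⟩
  by_contra! hlt
  have hw'' : w' ∈ P ω ∩ cone θ v ∩ Metric.closedBall v (dist p v) :=
    ⟨hw', hlt.le.trans hw.2⟩
  exact absurd (hmin hw'' hlt.le) (not_le.2 hlt)

/-- Without a successor the narrow sectors of all radii are void, and their void probabilities tend
to zero. -/
lemma ae_exists_isSuccessor (hlam : 0 < lam) (hθ : 0 < θ) (hθ' : θ < Real.pi / 2)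
    (hP : IsPoissonPointProcess lam P μ) (hF : IsLocallyFinitePattern P) {n : ℕ}
    (hnd : ∀ᵐ ω ∂μ, ∀ j < n, waypoint θ (P ω) (j + 1) ≠ waypoint θ (P ω) j) :
    ∀ᵐ ω ∂μ, ∃ w, IsSuccessor θ (P ω) (waypoint θ (P ω) n) w := by
  set c := volume.real (sector (narrowSlope θ) 1) with hc
  have hc0 : 0 < c := volume_sector_pos (narrowSlope_pos hθ hθ')
  have hl0 : (0 : ℝ) < lam := hlam
  have key : ∀ r : ℕ, μ.real {ω | ¬ ∃ w, IsSuccessor θ (P ω) (waypoint θ (P ω) n) w} ≤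
      Real.exp (-(lam * (r ^ 2 * c))) := fun r => by
    have hT := isCompact_sector (narrowSlope θ) (r : ℝ)
    have hsub : sector (narrowSlope θ) r ⊆ wedge (Real.tan θ) :=
      (sector_subset_wedge _ _).trans (wedge_mono (narrowSlope_pos hθ hθ') (narrowSlope_le θ))
    refine le_trans (measureReal_mono (s₂ := univ ∩
      {ω | P ω ∩ unexplored θ (P ω) n (sector (narrowSlope θ) r) = ∅}) fun ω hω => ?_) ?_
    · refine ⟨mem_univ _, Set.eq_empty_iff_forall_notMem.2 fun p hp => hω ?_⟩
      exact exists_isSuccessor hF ω hp.1 (mem_cone_of_mem_unexplored hθ hθ' hsub hp.2)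
    · rw [measure_inter_void_unexplored hθ hθ' hP hF hnd MeasurableSet.univ hT]
      have := setIntegral_exp_le (μ := μ) (n := n) (lam := lam) (a := r ^ 2 * c) hθ hθ' hF hT ?_ univ
      · simpa using this
      · filter_upwards [hnd] with ω hω
        rw [volume_unexplored_narrow hθ hθ' hω (sector_subset_wedge _ _)]
        exact volume_sector (Nat.cast_nonneg r)
  have hlim : Tendsto (fun r : ℕ => Real.exp (-(lam * ((r : ℝ) ^ 2 * c)))) atTop (𝓝 0) := by
    refine Real.tendsto_exp_neg_atTop_nhds_zero.comp ?_
    refine Tendsto.const_mul_atTop hl0 (Tendsto.atTop_mul_const hc0 ?_)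
    exact (tendsto_pow_atTop two_ne_zero).comp tendsto_natCast_atTop_atTop
  have h0 := ge_of_tendsto' hlim key
  rw [ae_iff]
  exact (measureReal_eq_zero_iff).1 (le_antisymm h0 measureReal_nonneg)

/-- Two disjoint sets are both hit with small probability. -/
lemma measure_both_hit_le (hθ : 0 < θ) (hθ' : θ < Real.pi / 2)
    (hP : IsPoissonPointProcess lam P μ) (hF : IsLocallyFinitePattern P) {n : ℕ}
    (hnd : ∀ᵐ ω ∂μ, ∀ j < n, waypoint θ (P ω) (j + 1) ≠ waypoint θ (P ω) j)
    {T T' : Set Plane} (hT : IsCompact T) (hT' : IsCompact T') (hd : Disjoint T T') {α : ℝ}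
    (h : volume.real T ≤ α) (h' : volume.real T' ≤ α) :
    μ.real ({ω | P ω ∩ unexplored θ (P ω) n T = ∅}ᶜ ∩
      {ω | P ω ∩ unexplored θ (P ω) n T' = ∅}ᶜ) ≤ (lam * α) ^ 2 := by
  set N := {ω | P ω ∩ unexplored θ (P ω) n T = ∅} with hN
  set N' := {ω | P ω ∩ unexplored θ (P ω) n T' = ∅} with hN'
  have mN : MeasurableSet N := measurableSet_void_unexplored hθ hθ' hP hF n hT
  have mN' : MeasurableSet N' := measurableSet_void_unexplored hθ hθ' hP hF n hT'
  have e1 := measure_inter_void_unexplored hθ hθ' hP hF hnd MeasurableSet.univ hT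
  have e2 := measure_inter_void_unexplored hθ hθ' hP hF hnd MeasurableSet.univ hT'
  have e3 := measure_inter_void_unexplored hθ hθ' hP hF hnd MeasurableSet.univ (hT.union hT')
  have hNN : {ω | P ω ∩ unexplored θ (P ω) n (T ∪ T') = ∅} = N ∩ N' := by
    ext ω
    have : unexplored θ (P ω) n (T ∪ T') = unexplored θ (P ω) n T ∪ unexplored θ (P ω) n T' := by
      ext w
      simp only [unexplored, Set.mem_sdiff, Set.mem_ofPred_eq, Set.mem_union]
      tauto
    simp only [Set.mem_ofPred_eq, this, inter_union_distrib_left, union_empty_iff, mem_inter_iff,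
      hN, hN']
  rw [hNN] at e3
  simp only [univ_inter, Measure.restrict_univ] at e1 e2 e3
  rw [← compl_union, measureReal_compl (mN.union mN')]
  have e4 := measureReal_union_add_inter (μ := μ) (s := N) (t := N') mN'
  have int : ∀ {T : Set Plane}, IsCompact T → Integrable (fun ω =>
      Real.exp (-(lam * volume.real (unexplored θ (P ω) n T)))) μ := fun hT =>
    .of_bound (measurable_exp_unexplored hθ hθ' lam hF n hT).aestronglyMeasurable 1
      (.of_forall fun ω => exp_neg_norm_le _ _)
  have i1 : Integrable (fun ω =>
      1 - Real.exp (-(lam * volume.real (unexplored θ (P ω) n T)))) μ :=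
    (integrable_const _).sub (int hT)
  have i2 : Integrable (fun ω => 1 - Real.exp (-(lam * volume.real (unexplored θ (P ω) n T)))
      - Real.exp (-(lam * volume.real (unexplored θ (P ω) n T')))) μ := i1.sub (int hT')
  -- Inclusion-exclusion. Since the unexplored areas x and y of the disjoint sets add up, the
  -- integrand is (1 - exp(-λx)) (1 - exp(-λy)), with each factor at most λα.
  have e5 : (1 : ℝ) - μ.real (N ∪ N') = ∫ ω, (1
      - Real.exp (-(lam * volume.real (unexplored θ (P ω) n T)))
      - Real.exp (-(lam * volume.real (unexplored θ (P ω) n T')))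
      + Real.exp (-(lam * volume.real (unexplored θ (P ω) n (T ∪ T'))))) ∂μ := by
    rw [integral_add i2 (int (hT.union hT')), integral_sub i1 (int hT'),
      integral_sub (integrable_const _) (int hT), ← e1, ← e2, ← e3]
    simp
    linarith
  have e6 : μ.real univ = 1 := by simp
  rw [e6, e5]
  have hbound : ∀ ω, 1 - Real.exp (-(lam * volume.real (unexplored θ (P ω) n T)))
      - Real.exp (-(lam * volume.real (unexplored θ (P ω) n T')))
      + Real.exp (-(lam * volume.real (unexplored θ (P ω) n (T ∪ T')))) ≤ (lam * α) ^ 2 := by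
    intro ω
    rw [volume_unexplored_union θ _ n hT'.measurableSet hd hT.measure_lt_top.ne
      hT'.measure_lt_top.ne]
    have hx := (volume_unexplored_le θ (P ω) n hT.measure_lt_top.ne).trans h
    have hy := (volume_unexplored_le θ (P ω) n hT'.measure_lt_top.ne).trans h'
    have hx0 : 0 ≤ volume.real (unexplored θ (P ω) n T) := measureReal_nonneg
    have hy0 : 0 ≤ volume.real (unexplored θ (P ω) n T') := measureReal_nonneg
    generalize volume.real (unexplored θ (P ω) n T) = x at *
    generalize volume.real (unexplored θ (P ω) n T') = y at *
    rw [mul_add, neg_add, Real.exp_add]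
    have hl : (0 : ℝ) ≤ lam := lam.2
    have h1 := Real.add_one_le_exp (-(lam * x))
    have h2 := Real.add_one_le_exp (-(lam * y))
    have h3 : Real.exp (-(lam * x)) ≤ 1 := Real.exp_le_one_iff.2 (by
      have := mul_nonneg hl hx0; linarith)
    have h4 : Real.exp (-(lam * y)) ≤ 1 := Real.exp_le_one_iff.2 (by
      have := mul_nonneg hl hy0; linarith)
    have h5 : (lam : ℝ) * x ≤ lam * α := mul_le_mul_of_nonneg_left hx hl
    have h6 : (lam : ℝ) * y ≤ lam * α := mul_le_mul_of_nonneg_left hy hl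
    have h7 : (1 - Real.exp (-(lam * x))) * (1 - Real.exp (-(lam * y))) ≤
        (lam * α) * (lam * α) := mul_le_mul (by linarith) (by linarith) (by linarith)
        (mul_nonneg hl (hx0.trans hx))
    nlinarith
  calc _ ≤ ∫ _, (lam * α : ℝ) ^ 2 ∂μ := integral_mono
        (i2.add (int (hT.union hT')))
        (integrable_const _) hbound
    _ = _ := by simp

end

/-! ### Absence of ties and uniqueness of successors -/

/-- A part of an annulus of width `1 / m` in a cone. -/
def ringPart (k : ℝ) (F : Set ℝ) (m i : ℕ) : Set Plane :=
  {w | w ∈ wedge k ∧ w 1 ∈ F ∧ (i : ℝ) / m ≤ ‖w‖ ∧ ‖w‖ ≤ (i + 1 : ℝ) / m}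

lemma isCompact_ringPart (k : ℝ) {F : Set ℝ} (hF : IsClosed F) (m i : ℕ) :
    IsCompact (ringPart k F m i) := by
  refine (isCompact_closedBall (0 : Plane) ((i + 1 : ℝ) / m)).of_isClosed_subset ?_ fun w hw =>
    mem_closedBall_zero_iff.2 hw.2.2.2
  exact (isClosed_wedge k).inter ((hF.preimage (continuous_coord 1)).inter
    ((isClosed_le continuous_const continuous_norm).inter
      (isClosed_le continuous_norm continuous_const)))

lemma volume_ringPart_le (k : ℝ) (F : Set ℝ) {m : ℕ} (hm : 0 < m) (i : ℕ) :
    volume.real (ringPart k F m i) ≤ (2 * i + 1) * Real.pi / m ^ 2 := by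
  have hm' : (0 : ℝ) < m := Nat.cast_pos.2 hm
  have h1 : ringPart k F m i ⊆
      Metric.closedBall (0 : Plane) ((i + 1 : ℝ) / m) \ Metric.ball 0 ((i : ℝ) / m) :=
    fun w hw => ⟨mem_closedBall_zero_iff.2 hw.2.2.2, fun h =>
      absurd (mem_ball_zero_iff.1 h) (not_lt.2 hw.2.2.1)⟩
  have hfin : volume (Metric.closedBall (0 : Plane) ((i + 1 : ℝ) / m)) ≠ ∞ :=
    (isCompact_closedBall _ _).measure_lt_top.ne
  have h2 := measureReal_mono h1 (μ := volume) (ne_top_of_le_ne_top hfin (measure_mono sdiff_subset))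
  have hsub : Metric.ball (0 : Plane) ((i : ℝ) / m) ⊆ Metric.closedBall 0 ((i + 1 : ℝ) / m) :=
    Metric.ball_subset_closedBall.trans (Metric.closedBall_subset_closedBall (by gcongr; linarith))
  have hv : ∀ r : ℝ, 0 ≤ r → volume.real (Metric.ball (0 : Plane) r) = r ^ 2 * Real.pi ∧
      volume.real (Metric.closedBall (0 : Plane) r) = r ^ 2 * Real.pi := fun r hr => by
    rw [measureReal_def, measureReal_def, EuclideanSpace.volume_ball_fin_two,
      EuclideanSpace.volume_closedBall_fin_two]
    simp [ENNReal.toReal_mul, hr, Real.pi_nonneg]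
  rw [measureReal_sdiff hsub Metric.isOpen_ball.measurableSet, (hv _ (by positivity)).1,
    (hv _ (by positivity)).2] at h2
  refine h2.trans (le_of_eq ?_)
  field_simp
  ring

lemma exists_ring {m : ℕ} (hm : 0 < m) {R : ℕ} {t : ℝ} (ht : 0 ≤ t) (htR : t ≤ R) :
    ∃ i ∈ Finset.range (R * m + 1), (i : ℝ) / m ≤ t ∧ t ≤ (i + 1 : ℝ) / m := by
  have hm' : (0 : ℝ) < m := Nat.cast_pos.2 hm
  have h0 : 0 ≤ t * m := by positivity
  refine ⟨⌊t * m⌋₊, Finset.mem_range.2 (Nat.lt_succ_iff.2 ?_), ?_, ?_⟩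
  · refine Nat.floor_le_of_le ?_
    push_cast
    gcongr
  · rw [div_le_iff₀ hm']
    exact Nat.floor_le h0
  · rw [le_div_iff₀ hm']
    exact (Nat.lt_floor_add_one _).le

section

variable {Ω : Type*} [MeasurableSpace Ω] {θ : ℝ} {P : Ω → Set Plane}
  {μ : Measure Ω} [IsProbabilityMeasure μ] {lam : ℝ≥0}

/-- Two points of `S` in the cone at `V_n` are at the same distance from `V_n`. -/
def Tie (θ : ℝ) (n : ℕ) (s s' : ℝ) (R : ℕ) (S : Set Plane) : Prop :=
  ∃ p ∈ S ∩ cone θ (waypoint θ S n), ∃ q ∈ S ∩ cone θ (waypoint θ S n),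
    ‖p - waypoint θ S n‖ = ‖q - waypoint θ S n‖ ∧ ‖p - waypoint θ S n‖ ≤ R ∧
    (p - waypoint θ S n) 1 ≤ s ∧ s' ≤ (q - waypoint θ S n) 1

/-- Tied points lie in a common ring of width 1/m, and the gap between `s` and `s'` places them in
disjoint parts of it. Each part has area at most 3Rπ/m, so both are hit with probability of order
(R/m)²; summing over at most 2Rm rings leaves order R³/m. -/
lemma measure_tie_le (hθ : 0 < θ) (hθ' : θ < Real.pi / 2)
    (hP : IsPoissonPointProcess lam P μ) (hF : IsLocallyFinitePattern P) {n : ℕ}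
    (hnd : ∀ᵐ ω ∂μ, ∀ j < n, waypoint θ (P ω) (j + 1) ≠ waypoint θ (P ω) j)
    {s s' : ℝ} (hs : s < s') {R : ℕ} (hR : 1 ≤ R) {m : ℕ} (hm : 0 < m) :
    μ.real {ω | Tie θ n s s' R (P ω)} ≤ (18 * lam ^ 2 * Real.pi ^ 2 * R ^ 3) / m := by
  have hm' : (0 : ℝ) < m := Nat.cast_pos.2 hm
  have hR' : (1 : ℝ) ≤ R := by exact_mod_cast hR
  have hm1 : (1 : ℝ) ≤ m := by exact_mod_cast hm
  have hRm : (1 : ℝ) ≤ R * m := one_le_mul_of_one_le_of_one_le hR' hm1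
  let N : Set ℝ → ℕ → Set Ω := fun F i =>
    {ω | P ω ∩ unexplored θ (P ω) n (ringPart (Real.tan θ) F m i) = ∅}ᶜ
  have h1 : {ω | Tie θ n s s' R (P ω)} ≤ᵐ[μ]
      (⋃ i ∈ Finset.range (R * m + 1), N (Iic s) i ∩ N (Ici s') i : Set Ω) := by
    filter_upwards [hnd] with ω hω h
    obtain ⟨p, hp, q, hq, hpq, hpR, hps, hqs⟩ := h
    obtain ⟨i, hi, hi1, hi2⟩ := exists_ring hm (norm_nonneg _) hpR
    refine mem_iUnion₂.2 ⟨i, hi, fun h => ?_, fun h => ?_⟩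
    · refine Set.eq_empty_iff_forall_notMem.1 h p ⟨hp.1, ⟨⟨((mem_cone_iff hθ hθ').1 hp.2).1,
        hps, hi1, hi2⟩, not_mem_explored hθ hθ' hω hp.1 hp.2⟩⟩
    · rw [hpq] at hi1 hi2
      refine Set.eq_empty_iff_forall_notMem.1 h q ⟨hq.1, ⟨⟨((mem_cone_iff hθ hθ').1 hq.2).1,
        hqs, hi1, hi2⟩, not_mem_explored hθ hθ' hω hq.1 hq.2⟩⟩
  have hα : ∀ F, ∀ i ∈ Finset.range (R * m + 1), volume.real (ringPart (Real.tan θ) F m i) ≤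
      3 * R * Real.pi / m := fun F i hi => by
    refine (volume_ringPart_le _ F hm i).trans ?_
    have hi' : (i : ℝ) ≤ R * m := by exact_mod_cast Nat.lt_succ_iff.1 (Finset.mem_range.1 hi)
    rw [div_le_div_iff₀ (by positivity) hm']
    have := Real.pi_pos
    have h3 : (2 * i + 1 : ℝ) ≤ 3 * (R * m) := by linarith
    calc (2 * i + 1) * Real.pi * m ≤ (3 * (R * m)) * Real.pi * m := by gcongr
      _ = _ := by ring
  calc μ.real {ω | Tie θ n s s' R (P ω)}
      ≤ μ.real (⋃ i ∈ Finset.range (R * m + 1), N (Iic s) i ∩ N (Ici s') i) :=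
        ENNReal.toReal_mono (measure_ne_top _ _) (measure_mono_ae h1)
    _ ≤ ∑ i ∈ Finset.range (R * m + 1), μ.real (N (Iic s) i ∩ N (Ici s') i) :=
        measureReal_biUnion_finset_le _ _
    _ ≤ ∑ i ∈ Finset.range (R * m + 1), (lam * (3 * R * Real.pi / m)) ^ 2 := by
        refine Finset.sum_le_sum fun i hi => ?_
        refine measure_both_hit_le hθ hθ' hP hF hnd (isCompact_ringPart _ isClosed_Iic m i)
          (isCompact_ringPart _ isClosed_Ici m i) ?_ (hα _ i hi) (hα _ i hi)
        refine Set.disjoint_left.2 fun w h h' => ?_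
        have a1 : w 1 ≤ s := h.2.1
        have a2 : s' ≤ w 1 := h'.2.1
        linarith
    _ = (R * m + 1) * (lam * (3 * R * Real.pi / m)) ^ 2 := by
        rw [Finset.sum_const, Finset.card_range]; simp
    _ ≤ (2 * (R * m)) * (lam * (3 * R * Real.pi / m)) ^ 2 := by
        gcongr; linarith
    _ = _ := by field_simp; ring

lemma ae_not_tie (hθ : 0 < θ) (hθ' : θ < Real.pi / 2)
    (hP : IsPoissonPointProcess lam P μ) (hF : IsLocallyFinitePattern P) {n : ℕ}
    (hnd : ∀ᵐ ω ∂μ, ∀ j < n, waypoint θ (P ω) (j + 1) ≠ waypoint θ (P ω) j)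
    {s s' : ℝ} (hs : s < s') {R : ℕ} (hR : 1 ≤ R) :
    ∀ᵐ ω ∂μ, ¬ Tie θ n s s' R (P ω) := by
  have hlim : Tendsto (fun m : ℕ => (18 * lam ^ 2 * Real.pi ^ 2 * R ^ 3 : ℝ) / ((m + 1 : ℕ) : ℝ))
      atTop (𝓝 0) :=
    (tendsto_const_div_atTop_nhds_zero_nat _).comp (tendsto_add_atTop_nat 1)
  have h0 := ge_of_tendsto' hlim fun m =>
    measure_tie_le hθ hθ' hP hF hnd hs hR (Nat.succ_pos m)
  rw [ae_iff]
  simp only [not_not]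
  exact (measureReal_eq_zero_iff).1 (le_antisymm h0 measureReal_nonneg)

/-- Rational separators and integer radii reduce all possible ties to countably many null events. -/
lemma exists_tie {S : Set Plane} {n : ℕ} {p q : Plane}
    (hp : p ∈ S ∩ cone θ (waypoint θ S n)) (hq : q ∈ S ∩ cone θ (waypoint θ S n))
    (hpq : ‖p - waypoint θ S n‖ = ‖q - waypoint θ S n‖)
    (hlt : (p - waypoint θ S n) 1 < (q - waypoint θ S n) 1) :
    ∃ (s s' : ℚ) (R : ℕ), (s : ℝ) < s' ∧ Tie θ n s s' (R + 1) S := by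
  obtain ⟨s, hs1, hs2⟩ := exists_rat_btwn hlt
  obtain ⟨s', hs3, hs4⟩ := exists_rat_btwn hs2
  obtain ⟨R, hR⟩ := exists_nat_ge ‖p - waypoint θ S n‖
  refine ⟨s, s', R, hs3, p, hp, q, hq, hpq, ?_, hs1.le, hs4.le⟩
  push_cast
  linarith

lemma ae_existsUnique_isSuccessor_of (hlam : 0 < lam) (hθ : 0 < θ) (hθ' : θ < Real.pi / 2)
    (hP : IsPoissonPointProcess lam P μ) (hF : IsLocallyFinitePattern P) {n : ℕ}
    (hnd : ∀ᵐ ω ∂μ, ∀ j < n, waypoint θ (P ω) (j + 1) ≠ waypoint θ (P ω) j) :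
    ∀ᵐ ω ∂μ, ∃! w, IsSuccessor θ (P ω) (waypoint θ (P ω) n) w := by
  have hk := Real.tan_pos_of_pos_of_lt_pi_div_two hθ hθ'
  have htie : ∀ᵐ ω ∂μ, ∀ (s s' : ℚ) (R : ℕ), (s : ℝ) < s' → ¬ Tie θ n s s' (R + 1) (P ω) := by
    simp only [ae_all_iff]
    exact fun s s' R hs => ae_not_tie hθ hθ' hP hF hnd hs (by omega)
  filter_upwards [htie, ae_exists_isSuccessor hlam hθ hθ' hP hF hnd] with ω h1 h2
  obtain ⟨p, hp⟩ := h2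
  refine ⟨p, hp, fun q hq => ?_⟩
  have hpq : ‖p - waypoint θ (P ω) n‖ = ‖q - waypoint θ (P ω) n‖ := by
    rw [← dist_eq_norm, ← dist_eq_norm]
    exact le_antisymm (hp.2 q hq.1) (hq.2 p hp.1)
  have no : ∀ {p q : Plane}, p ∈ P ω ∩ cone θ (waypoint θ (P ω) n) →
      q ∈ P ω ∩ cone θ (waypoint θ (P ω) n) →
      ‖p - waypoint θ (P ω) n‖ = ‖q - waypoint θ (P ω) n‖ →
      ¬ (p - waypoint θ (P ω) n) 1 < (q - waypoint θ (P ω) n) 1 := by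
    intro p q hp hq hpq hlt
    obtain ⟨s, s', R, hs, ht⟩ := exists_tie hp hq hpq hlt
    exact h1 s s' R hs ht
  have e1 : (p - waypoint θ (P ω) n) 1 = (q - waypoint θ (P ω) n) 1 :=
    le_antisymm (not_lt.1 (no hq.1 hp.1 hpq.symm)) (not_lt.1 (no hp.1 hq.1 hpq))
  -- Equal norms and equal second coordinates determine the first up to sign, and it is nonnegative
  -- in the cone.
  have e2 : (p - waypoint θ (P ω) n) 0 = (q - waypoint θ (P ω) n) 0 := by
    have h3 := plane_norm_sq (p - waypoint θ (P ω) n)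
    have h4 := plane_norm_sq (q - waypoint θ (P ω) n)
    rw [hpq, h4, e1] at h3
    exact (sq_eq_sq₀ (wedge_fst_nonneg hk ((mem_cone_iff hθ hθ').1 hp.1.2).1)
      (wedge_fst_nonneg hk ((mem_cone_iff hθ hθ').1 hq.1.2).1)).1 (by linarith)
  exact (sub_left_inj.1 (plane_ext e2 e1)).symm

/-- Almost surely, all steps are well defined. -/
lemma ae_waypoint_ne (hlam : 0 < lam) (hθ : 0 < θ) (hθ' : θ < Real.pi / 2)
    (hP : IsPoissonPointProcess lam P μ) (hF : IsLocallyFinitePattern P) :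
    ∀ᵐ ω ∂μ, ∀ j, waypoint θ (P ω) (j + 1) ≠ waypoint θ (P ω) j := by
  have h : ∀ n, ∀ᵐ ω ∂μ, ∀ j < n, waypoint θ (P ω) (j + 1) ≠ waypoint θ (P ω) j := by
    intro n
    induction n with
    | zero => exact .of_forall fun ω j hj => absurd hj (Nat.not_lt_zero j)
    | succ n ih =>
      filter_upwards [ih, ae_existsUnique_isSuccessor_of hlam hθ hθ' hP hF ih] with ω h1 h2 j hj
      rcases (Nat.lt_succ_iff.1 hj).lt_or_eq with hj | rfl
      · exact h1 j hj
      · exact (successor_ne_iff hθ hθ').2 h2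
  filter_upwards [ae_all_iff.2 h] with ω hω j
  exact hω (j + 1) j (Nat.lt_succ_self j)

/-! ### Lower bounds for long steps and for good steps -/

/-- Each step is longer than `1` with conditional probability bounded below. -/
lemma measure_step_le_one (hlam : 0 < lam) (hθ : 0 < θ) (hθ' : θ < Real.pi / 2)
    (hP : IsPoissonPointProcess lam P μ) (hF : IsLocallyFinitePattern P) {n : ℕ}
    {A : Set Ω} (hA : MeasurableSet[pastEvents θ P n] A) :
    μ.real (A ∩ {ω | ‖waypoint θ (P ω) (n + 1) - waypoint θ (P ω) n‖ ≤ 1}) ≤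
      (1 - Real.exp (-(lam * volume.real (sector (Real.tan θ) 1)))) * μ.real A := by
  have hnd := ae_waypoint_ne hlam hθ hθ' hP hF
  have hT := isCompact_sector (Real.tan θ) 1
  set N := {ω | P ω ∩ unexplored θ (P ω) n (sector (Real.tan θ) 1) = ∅} with hN
  have hNm : MeasurableSet N := measurableSet_void_unexplored hθ hθ' hP hF n hT
  -- A step of length at most one ends at an unexplored point of the unit sector, so this sector is
  -- not void.
  have h1 : (A ∩ {ω | ‖waypoint θ (P ω) (n + 1) - waypoint θ (P ω) n‖ ≤ 1} : Set Ω) ≤ᵐ[μ]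
      (A \ N : Set Ω) := by
    filter_upwards [hnd] with ω hω h
    refine ⟨h.1, fun h2 => ?_⟩
    have hm := waypoint_mem (hω n)
    have hc := (mem_cone_iff hθ hθ').2 ⟨waypoint_sub_mem_wedge hθ hθ' (P ω) (Nat.le_succ n), hω n⟩
    exact Set.eq_empty_iff_forall_notMem.1 h2 _
      ⟨hm, mem_sector.2 ⟨((mem_cone_iff hθ hθ').1 hc).1, h.2⟩,
        not_mem_explored hθ hθ' (fun j _ => hω j) hm hc⟩
  have h2 : μ.real (A ∩ N) + μ.real (A \ N) = μ.real A := measureReal_inter_add_sdiff hNm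
  have h3 := measure_inter_void_unexplored hθ hθ' hP hF (n := n)
    (hnd.mono fun ω h j _ => h j) hA hT
  have h4 : Real.exp (-(lam * volume.real (sector (Real.tan θ) 1))) * μ.real A ≤
      ∫ ω in A, Real.exp (-(lam * volume.real
        (unexplored θ (P ω) n (sector (Real.tan θ) 1)))) ∂μ := by
    calc _ = ∫ _ in A, Real.exp (-(lam * volume.real (sector (Real.tan θ) 1))) ∂μ := by
          rw [setIntegral_const, smul_eq_mul, mul_comm]
      _ ≤ _ := by
        refine integral_mono (integrable_const _) ?_ fun ω => ?_
        · exact .of_bound (measurable_exp_unexplored hθ hθ' lam hF n hT).aestronglyMeasurable 1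
            (.of_forall fun ω => exp_neg_norm_le _ _)
        · have := volume_unexplored_le θ (P ω) n hT.measure_lt_top.ne
          dsimp only
          gcongr
  have h5 : μ.real (A ∩ {ω | ‖waypoint θ (P ω) (n + 1) - waypoint θ (P ω) n‖ ≤ 1}) ≤
      μ.real (A \ N) := ENNReal.toReal_mono (measure_ne_top _ _) (measure_mono_ae h1)
  linarith

/-- The step goes in a narrow direction and at least `K` to the right. -/
def GoodStep (θ K : ℝ) (S : Set Plane) (n : ℕ) : Prop :=
  waypoint θ S (n + 1) - waypoint θ S n ∈ wedge (narrowSlope θ) ∧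
    K ≤ (waypoint θ S (n + 1) - waypoint θ S n) 0

/-- The region whose emptiness forces a good step. -/
def badRegion (k l r : ℝ) : Set Plane :=
  {w | w ∈ sector k (r + 1) ∧ (‖w‖ ≤ r ∨ l * w 0 ≤ |w 1|)}

lemma isCompact_badRegion (k l r : ℝ) : IsCompact (badRegion k l r) := by
  refine (isCompact_sector k (r + 1)).inter_right ?_
  exact (isClosed_le continuous_norm continuous_const).union
    (isClosed_le (continuous_const.mul (continuous_coord 0)) (continuous_coord 1).abs)

lemma volume_sector_sdiff_badRegion_pos {k l r : ℝ} (hr : 0 ≤ r) (hl : 0 < l) (hlk : l ≤ k) :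
    0 < volume.real (sector k (r + 1) \ badRegion k l r) := by
  have ho : IsOpen {w : Plane | |w 1| < l * w 0 ∧ r < ‖w‖ ∧ ‖w‖ < r + 1} :=
    (isOpen_lt (continuous_coord 1).abs (continuous_const.mul (continuous_coord 0))).inter
      ((isOpen_lt continuous_const continuous_norm).inter
        (isOpen_lt continuous_norm continuous_const))
  have hne : {w : Plane | |w 1| < l * w 0 ∧ r < ‖w‖ ∧ ‖w‖ < r + 1}.Nonempty := by
    have hn : ‖(!₂[r + 1 / 2, 0] : Plane)‖ = r + 1 / 2 := by
      rw [← abs_of_nonneg (norm_nonneg (!₂[r + 1 / 2, 0] : Plane)),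
        ← abs_of_nonneg (show 0 ≤ r + 1 / 2 by linarith), ← sq_eq_sq_iff_abs_eq_abs,
        plane_norm_sq]
      simp
    refine ⟨!₂[r + 1 / 2, 0], ?_, ?_, ?_⟩
    · simp; positivity
    · rw [hn]; linarith
    · rw [hn]; linarith
  rw [measureReal_def]
  refine ENNReal.toReal_pos (ne_of_gt ?_)
    (ne_top_of_le_ne_top (isCompact_sector k (r + 1)).measure_lt_top.ne (measure_mono sdiff_subset))
  refine (ho.measure_pos volume hne).trans_le (measure_mono fun w hw => ?_)
  have h0 : w ∈ wedge l := mem_wedge.2 hw.1.le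
  refine ⟨mem_sector.2 ⟨wedge_mono hl hlk h0, hw.2.2.le⟩, fun h => ?_⟩
  rcases h.2 with h | h
  · exact absurd hw.2.1 (not_lt.2 h)
  · exact absurd hw.1 (not_lt.2 h)

/-- Good steps have conditional probability bounded below. -/
lemma measure_not_goodStep_le (hlam : 0 < lam) (hθ : 0 < θ) (hθ' : θ < Real.pi / 2)
    (r : ℝ) (hP : IsPoissonPointProcess lam P μ) (hF : IsLocallyFinitePattern P) {n : ℕ}
    {A : Set Ω} (hA : MeasurableSet[pastEvents θ P n] A) :
    μ.real (A ∩ {ω | ¬ GoodStep θ (Real.cos θ * r) (P ω) n}) ≤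
      (1 - Real.exp (-(lam * volume.real (badRegion (Real.tan θ) (narrowSlope θ) r))) *
        (1 - Real.exp (-(lam * volume.real (sector (Real.tan θ) (r + 1) \
          badRegion (Real.tan θ) (narrowSlope θ) r))))) * μ.real A := by
  have hnd := ae_waypoint_ne hlam hθ hθ' hP hF
  have hc : 0 < Real.cos θ := Real.cos_pos_of_mem_Ioo ⟨by linarith, hθ'⟩
  set T := badRegion (Real.tan θ) (narrowSlope θ) r with hTdef
  set W := sector (Real.tan θ) (r + 1) with hWdef
  have hT : IsCompact T := isCompact_badRegion _ _ _
  have hW : IsCompact W := isCompact_sector _ _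
  have hTW : T ⊆ W := fun w hw => hw.1
  have hnarrow : W \ T ⊆ wedge (narrowSlope θ) := fun w hw => by
    by_contra h
    exact hw.2 ⟨hw.1, Or.inr (le_of_lt (not_le.1 h))⟩
  set N := {ω | P ω ∩ unexplored θ (P ω) n T = ∅} with hN
  set M := {ω | P ω ∩ unexplored θ (P ω) n W = ∅} with hM
  have hNm : MeasurableSet N := measurableSet_void_unexplored hθ hθ' hP hF n hT
  have hMm : MeasurableSet M := measurableSet_void_unexplored hθ hθ' hP hF n hW
  -- If `T` is void but `W` is not, the step ends in `W \ T`: it is narrow and longer than `r`.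
  -- Hence a bad step needs a point in `T` or a void `W`.
  have h1 : (A ∩ {ω | ¬ GoodStep θ (Real.cos θ * r) (P ω) n} : Set Ω) ≤ᵐ[μ]
      ((A \ N) ∪ (A ∩ M) : Set Ω) := by
    filter_upwards [hnd] with ω hω h
    by_contra hcon
    have hωN : ω ∈ N := by
      by_contra h'; exact hcon (Or.inl ⟨h.1, h'⟩)
    have hωM : ω ∉ M := fun h' => hcon (Or.inr ⟨h.1, h'⟩)
    obtain ⟨p, hpS, hp⟩ := Set.nonempty_iff_ne_empty.2 hωM
    have hpc := mem_cone_of_mem_unexplored hθ hθ' (sector_subset_wedge _ _) hp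
    have hle := (norm_step_le hpS hpc).trans (mem_sector.1 hp.1).2
    have hm := waypoint_mem (hω n)
    have hw := waypoint_sub_mem_wedge hθ hθ' (P ω) (Nat.le_succ n)
    have hcn := (mem_cone_iff hθ hθ').2 ⟨hw, hω n⟩
    have hsW : waypoint θ (P ω) (n + 1) - waypoint θ (P ω) n ∈ W := mem_sector.2 ⟨hw, hle⟩
    have hsT : waypoint θ (P ω) (n + 1) - waypoint θ (P ω) n ∉ T := fun h' =>
      Set.eq_empty_iff_forall_notMem.1 hωN _
        ⟨hm, h', not_mem_explored hθ hθ' (fun j _ => hω j) hm hcn⟩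
    refine h.2 ⟨hnarrow ⟨hsW, hsT⟩, ?_⟩
    -- In the cone, length `r` guarantees an advance of `cos θ * r` to the right.
    refine le_trans ?_ (wedge_norm_le hθ hθ' hw)
    refine mul_le_mul_of_nonneg_left ?_ hc.le
    by_contra h'
    exact hsT ⟨hsW, Or.inl (not_le.1 h').le⟩
  have h2 : μ.real (A ∩ N) + μ.real (A \ N) = μ.real A := measureReal_inter_add_sdiff hNm
  have hnd' : ∀ᵐ ω ∂μ, ∀ j < n, waypoint θ (P ω) (j + 1) ≠ waypoint θ (P ω) j :=
    hnd.mono fun ω h j _ => h j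
  have h3 := measure_inter_void_unexplored hθ hθ' hP hF hnd' hA hT
  have h3' := measure_inter_void_unexplored hθ hθ' hP hF hnd' hA hW
  have int : ∀ {T : Set Plane}, IsCompact T → Integrable (fun ω =>
      Real.exp (-(lam * volume.real (unexplored θ (P ω) n T)))) (μ.restrict A) := fun hT =>
    .of_bound (measurable_exp_unexplored hθ hθ' lam hF n hT).aestronglyMeasurable 1
      (.of_forall fun ω => exp_neg_norm_le _ _)
  have h4 : Real.exp (-(lam * volume.real T)) * (1 - Real.exp (-(lam * volume.real (W \ T)))) *
      μ.real A ≤ μ.real (A ∩ N) - μ.real (A ∩ M) := by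
    rw [h3, h3', ← integral_sub (int hT) (int hW)]
    calc _ = ∫ _ in A, Real.exp (-(lam * volume.real T)) *
          (1 - Real.exp (-(lam * volume.real (W \ T)))) ∂μ := by
          rw [setIntegral_const, smul_eq_mul, mul_comm]
      _ ≤ _ := by
        refine integral_mono_ae (integrable_const _) ((int hT).sub (int hW)) ?_
        filter_upwards [ae_restrict_of_ae hnd'] with ω hω
        -- The part `W \ T` is narrow, so all its area is unexplored; for `T` the inequality by the
        -- full area suffices.
        have e : volume.real (unexplored θ (P ω) n W) =
            volume.real (unexplored θ (P ω) n T) + volume.real (W \ T) := by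
          rw [← volume_unexplored_narrow hθ hθ' hω hnarrow,
            ← volume_unexplored_union θ (P ω) n (hW.measurableSet.diff hT.measurableSet)
              disjoint_sdiff_self_right hT.measure_lt_top.ne
              (ne_top_of_le_ne_top hW.measure_lt_top.ne (measure_mono sdiff_subset)),
            Set.union_sdiff_cancel hTW]
        rw [e, mul_add, neg_add, Real.exp_add]
        have h5 := volume_unexplored_le θ (P ω) n hT.measure_lt_top.ne
        have h6 : 0 ≤ 1 - Real.exp (-(lam * volume.real (W \ T))) := by
          rw [sub_nonneg, Real.exp_le_one_iff, neg_nonpos]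
          positivity
        have h7 : Real.exp (-(lam * volume.real T)) ≤
            Real.exp (-(lam * volume.real (unexplored θ (P ω) n T))) := by gcongr
        have := mul_le_mul_of_nonneg_right h7 h6
        linarith
  have h5 : μ.real (A ∩ {ω | ¬ GoodStep θ (Real.cos θ * r) (P ω) n}) ≤
      μ.real (A \ N) + μ.real (A ∩ M) :=
    (ENNReal.toReal_mono (measure_ne_top _ _) (measure_mono_ae h1)).trans
      (measureReal_union_le _ _)
  linarith

end

/-! ### History sets, lag and renewal -/

/-- The rightmost extent of the balls emptied in the first `n` steps. -/
noncomputable def reach (θ : ℝ) (S : Set Plane) : ℕ → ℝ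
  | 0 => 0
  | n + 1 => max (reach θ S n)
      (waypoint θ S n 0 + ‖waypoint θ S (n + 1) - waypoint θ S n‖)

/-- How far the emptied balls extend to the right of the current waypoint. -/
noncomputable def lag (θ : ℝ) (S : Set Plane) (n : ℕ) : ℝ := reach θ S n - waypoint θ S n 0

/-- No renewal has happened in the first `n` steps. -/
def Alive (θ : ℝ) (S : Set Plane) (n : ℕ) : Prop :=
  ∀ k < n, (history θ S (k + 1)).Nonempty

lemma history_succ (θ : ℝ) (S : Set Plane) (n : ℕ) :
    history θ S (n + 1) = cone θ (waypoint θ S (n + 1)) ∩ (history θ S n ∪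
      Metric.ball (waypoint θ S n) ‖waypoint θ S (n + 1) - waypoint θ S n‖) := by
  simp [history, progress]

/-- The old right end stays in place while the waypoint advances by at least `cos θ` times the step
length. The new ball is centred to the left of the new waypoint or level with it, so it extends
beyond by at most its radius. -/
lemma lag_succ_le {θ : ℝ} (hθ : 0 < θ) (hθ' : θ < Real.pi / 2) (S : Set Plane) (n : ℕ) :
    lag θ S (n + 1) ≤ max (lag θ S n - Real.cos θ * ‖waypoint θ S (n + 1) - waypoint θ S n‖)
      ‖waypoint θ S (n + 1) - waypoint θ S n‖ := by
  have hk := Real.tan_pos_of_pos_of_lt_pi_div_two hθ hθ'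
  have hw := waypoint_sub_mem_wedge hθ hθ' S (Nat.le_succ n)
  have h1 := wedge_norm_le hθ hθ' hw
  have h2 := wedge_fst_nonneg hk hw
  simp only [PiLp.sub_apply, Nat.succ_eq_add_one] at h1 h2
  simp only [lag, reach]
  rw [sub_le_iff_le_add, max_add, max_le_iff]
  exact ⟨le_max_of_le_left (by linarith), le_max_of_le_right (by linarith)⟩

lemma history_subset (θ : ℝ) (S : Set Plane) (n : ℕ) :
    ∀ w ∈ history θ S n, w 0 < reach θ S n := by
  induction n with
  | zero => intro w hw; exact absurd hw (Set.notMem_empty w)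
  | succ n ih =>
    intro w hw
    rw [history_succ] at hw
    rcases hw.2 with h | h
    · exact (ih w h).trans_le (le_max_left _ _)
    · refine lt_of_lt_of_le ?_ (le_max_right _ _)
      have h1 := (le_abs_self _).trans (abs_coord_le_norm (w - waypoint θ S n) 0)
      rw [mem_ball_iff_norm] at h
      simp only [PiLp.sub_apply] at h1
      linarith

/-- A good step that passes the emptied balls is a renewal. -/
lemma history_eq_empty {θ : ℝ} (hθ : 0 < θ) (hθ' : θ < Real.pi / 2) {S : Set Plane} {n : ℕ}
    {K : ℝ} (hg : GoodStep θ K S n) (hlag : lag θ S n ≤ K) : history θ S (n + 1) = ∅ := by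
  have hk := Real.tan_pos_of_pos_of_lt_pi_div_two hθ hθ'
  refine Set.eq_empty_iff_forall_notMem.2 fun w hw => ?_
  rw [history_succ] at hw
  have hc := ((mem_cone_iff hθ hθ').1 hw.1).1
  rcases hw.2 with h | h
  -- Older history lies strictly to the left of the reach, hence of V_{n+1}.
  · have h1 := history_subset θ S n w h
    have h2 := wedge_fst_nonneg hk hc
    have h3 := hg.2
    simp only [lag, PiLp.sub_apply] at *
    linarith
  -- The angle between the narrow step and the new cone is not obtuse, so `w` is at least as far
  -- from V_n as V_{n+1} is, outside the open ball.
  · have hi := wedge_inner_nonneg hk (narrowSlope_pos hθ hθ') (tan_mul_narrowSlope_le hθ hθ')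
      hc hg.1
    have h4 := norm_add_sq_real (w - waypoint θ S (n + 1))
      (waypoint θ S (n + 1) - waypoint θ S n)
    rw [sub_add_sub_cancel] at h4
    rw [mem_ball_iff_norm] at h
    nlinarith [norm_nonneg (w - waypoint θ S n), sq_nonneg ‖w - waypoint θ S (n + 1)‖]

/-- Unrolling the recursion, a point of an emptied ball remains in the history as long as every
later cone contains it. -/
lemma mem_history_iff {θ : ℝ} {S : Set Plane} {n : ℕ} {w : Plane} : w ∈ history θ S n ↔
    ∃ j < n, dist w (waypoint θ S j) < ‖waypoint θ S (j + 1) - waypoint θ S j‖ ∧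
      ∀ i ∈ Finset.Ioc j n, w ∈ cone θ (waypoint θ S i) := by
  induction n with
  | zero => simp [history]
  | succ n ih =>
    rw [history_succ]
    constructor
    · rintro ⟨hc, h | h⟩
      · obtain ⟨j, hj, h1, h2⟩ := ih.1 h
        refine ⟨j, by omega, h1, fun i hi => ?_⟩
        rw [Finset.mem_Ioc] at hi
        rcases hi.2.lt_or_eq with hi' | rfl
        · exact h2 i (Finset.mem_Ioc.2 ⟨hi.1, by omega⟩)
        · exact hc
      · refine ⟨n, by omega, h, fun i hi => ?_⟩
        rw [Finset.mem_Ioc] at hi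
        obtain rfl : i = n + 1 := by omega
        exact hc
    · rintro ⟨j, hj, h1, h2⟩
      refine ⟨h2 (n + 1) (Finset.mem_Ioc.2 ⟨hj, le_rfl⟩), ?_⟩
      rcases (Nat.lt_succ_iff.1 hj).lt_or_eq with hj' | rfl
      · exact Or.inl (ih.2 ⟨j, hj', h1, fun i hi => h2 i
          (Finset.Ioc_subset_Ioc_right (Nat.le_succ n) hi)⟩)
      · exact Or.inr h1

/-- History sets have nonempty interior unless they are empty. -/
lemma history_nonempty_iff {θ : ℝ} (hθ : 0 < θ) (hθ' : θ < Real.pi / 2) {S : Set Plane} {n : ℕ} :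
    (history θ S n).Nonempty ↔ ∃ j < n, ∃ q : ℕ,
      dist (TopologicalSpace.denseSeq Plane q) (waypoint θ S j) <
        ‖waypoint θ S (j + 1) - waypoint θ S j‖ ∧
      ∀ i ∈ Finset.Ioc j n, |(TopologicalSpace.denseSeq Plane q - waypoint θ S i) 1| <
        Real.tan θ * (TopologicalSpace.denseSeq Plane q - waypoint θ S i) 0 := by
  have hk := Real.tan_pos_of_pos_of_lt_pi_div_two hθ hθ'
  constructor
  · rintro ⟨w, hw⟩
    obtain ⟨j, hj, h1, h2⟩ := mem_history_iff.1 hw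
    let O : Set Plane := {u | dist u (waypoint θ S j) <
        ‖waypoint θ S (j + 1) - waypoint θ S j‖} ∩
      ⋂ i ∈ Finset.Ioc j n, {u | |(u - waypoint θ S i) 1| < Real.tan θ * (u - waypoint θ S i) 0}
    have hO : IsOpen O := by
      refine (isOpen_lt (by fun_prop) continuous_const).inter
        (isOpen_biInter_finset fun i _ => ?_)
      have h : Continuous fun u : Plane => u - waypoint θ S i := by fun_prop
      exact isOpen_lt ((continuous_coord 1).comp h).abs
        (continuous_const.mul ((continuous_coord 0).comp h))
    -- A small shift to the right enters the interior of every cone involved while staying in the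
    -- open ball.
    have hne : O.Nonempty := by
      have hcont : Continuous fun ε : ℝ => dist (w + !₂[ε, 0]) (waypoint θ S j) := by fun_prop
      have hlim : Tendsto (fun ε : ℝ => dist (w + !₂[ε, 0]) (waypoint θ S j)) (𝓝[>] 0)
          (𝓝 (dist w (waypoint θ S j))) := by
        have h := (hcont.tendsto 0).mono_left (nhdsWithin_le_nhds (s := Ioi 0))
        have e : (!₂[(0 : ℝ), 0] : Plane) = 0 := plane_ext (by simp) (by simp)
        rwa [e, add_zero] at h
      obtain ⟨ε, h3, hε⟩ := ((hlim.eventually (gt_mem_nhds h1)).and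
        self_mem_nhdsWithin).exists
      refine ⟨w + !₂[ε, 0], h3, mem_iInter₂.2 fun i hi => ?_⟩
      have h4 := ((mem_cone_iff hθ hθ').1 (h2 i hi)).1
      rw [mem_wedge] at h4
      have hε' : (0 : ℝ) < ε := hε
      simp only [PiLp.sub_apply, PiLp.add_apply, Matrix.cons_val_zero, Matrix.cons_val_one,
        Matrix.cons_val_fin_one, add_zero, Set.mem_ofPred_eq] at h4 ⊢
      nlinarith [mul_pos hk hε']
    obtain ⟨_, hq, q, rfl⟩ := (TopologicalSpace.denseRange_denseSeq Plane).inter_open_nonempty O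
      hO hne
    exact ⟨j, hj, q, hq.1, fun i hi => mem_iInter₂.1 hq.2 i hi⟩
  · rintro ⟨j, hj, q, h1, h2⟩
    refine ⟨_, mem_history_iff.2 ⟨j, hj, h1, fun i hi => (mem_cone_iff hθ hθ').2
      ⟨mem_wedge.2 (h2 i hi).le, fun h => ?_⟩⟩⟩
    have := h2 i hi
    rw [h] at this
    simp at this

/-- Testing the history only at a dense sequence makes the event countable in the waypoints. The
σ-algebra is arbitrary so that the result also applies to `pastEvents`. -/
lemma measurableSet_alive {Ω : Type*} [MeasurableSpace Ω] {P : Ω → Set Plane} {θ : ℝ}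
    (hθ : 0 < θ) (hθ' : θ < Real.pi / 2) {n : ℕ}
    (hm : ∀ j ≤ n, Measurable fun ω => waypoint θ (P ω) j) :
    MeasurableSet {ω | Alive θ (P ω) n} := by
  have : {ω | Alive θ (P ω) n} = ⋂ k ∈ Finset.range n, ⋃ j ∈ Finset.range (k + 1), ⋃ q : ℕ,
      {ω | dist (TopologicalSpace.denseSeq Plane q) (waypoint θ (P ω) j) <
        ‖waypoint θ (P ω) (j + 1) - waypoint θ (P ω) j‖} ∩
      ⋂ i ∈ Finset.Ioc j (k + 1),
        {ω | |(TopologicalSpace.denseSeq Plane q - waypoint θ (P ω) i) 1| <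
        Real.tan θ * (TopologicalSpace.denseSeq Plane q - waypoint θ (P ω) i) 0} := by
    ext ω
    simp only [Alive, history_nonempty_iff hθ hθ', Set.mem_ofPred_eq, mem_iInter, mem_iUnion,
      mem_inter_iff, Finset.mem_range, exists_prop]
  rw [this]
  refine Finset.measurableSet_biInter _ fun k hk => Finset.measurableSet_biUnion _ fun j hj =>
    MeasurableSet.iUnion fun q => MeasurableSet.inter ?_
      (Finset.measurableSet_biInter _ fun i hi => ?_)
  · rw [Finset.mem_range] at hk hj
    exact measurableSet_lt (measurable_const.dist (hm j (by omega)))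
      ((hm (j + 1) (by omega)).sub (hm j (by omega))).norm
  · rw [Finset.mem_range] at hk
    rw [Finset.mem_Ioc] at hi
    have h := measurable_const (a := TopologicalSpace.denseSeq Plane q).sub (hm i (by omega))
    exact measurableSet_lt ((continuous_coord 1).abs.measurable.comp h)
      (((continuous_coord 0).measurable.comp h).const_mul _)

lemma measurable_lag {Ω : Type*} [MeasurableSpace Ω] {P : Ω → Set Plane} {θ : ℝ} {n : ℕ}
    (hm : ∀ j ≤ n, Measurable fun ω => waypoint θ (P ω) j) :
    Measurable fun ω => lag θ (P ω) n := by
  have hx : ∀ j ≤ n, Measurable fun ω => waypoint θ (P ω) j 0 := fun j hj =>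
    (continuous_coord 0).measurable.comp (hm j hj)
  have : ∀ j ≤ n, Measurable fun ω => reach θ (P ω) j := by
    intro j
    induction j with
    | zero => intro _; exact measurable_const
    | succ j ih =>
      intro hj
      exact (ih (by omega)).max ((hx j (by omega)).add
        ((hm (j + 1) hj).sub (hm j (by omega))).norm)
  exact (this n le_rfl).sub (hx n le_rfl)

/-! ### Conditional exponential moments of the steps -/

/-- A uniform bound of conditional probabilities is a bound of integrals. -/
lemma setLIntegral_le_of_measure_inter_le {Ω : Type*} {m m0 : MeasurableSpace Ω} {μ : Measure Ω}
    [IsFiniteMeasure μ] (hm : m ≤ m0) {E : Set Ω} {q : ℝ}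
    (h : ∀ A, MeasurableSet[m] A → μ.real (A ∩ E) ≤ q * μ.real A)
    {f : Ω → ℝ≥0∞} (hf : Measurable[m] f) :
    ∫⁻ ω in E, f ω ∂μ ≤ ENNReal.ofReal q * ∫⁻ ω, f ω ∂μ := by
  -- The hypothesis compares the two measures on the sub-σ-algebra, which is all that matters for an
  -- `m`-measurable integrand.
  have hle : (μ.restrict E).trim hm ≤ ENNReal.ofReal q • μ.trim hm := by
    refine Measure.le_iff.2 fun s hs => ?_
    rw [trim_measurableSet_eq hm hs, Measure.smul_apply, trim_measurableSet_eq hm hs,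
      Measure.restrict_apply (hm s hs), smul_eq_mul]
    have h1 := h s hs
    rw [← ofReal_measureReal (measure_ne_top μ (s ∩ E)),
      ← ofReal_measureReal (measure_ne_top μ s), ← ENNReal.ofReal_mul' measureReal_nonneg]
    exact ENNReal.ofReal_le_ofReal h1
  calc ∫⁻ ω in E, f ω ∂μ = ∫⁻ ω, f ω ∂((μ.restrict E).trim hm) := (lintegral_trim hm hf).symm
    _ ≤ ∫⁻ ω, f ω ∂(ENNReal.ofReal q • μ.trim hm) := lintegral_mono' hle le_rfl
    _ = _ := by rw [lintegral_smul_measure, lintegral_trim hm hf, smul_eq_mul]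

/-- A bound for the conditional exponential moments of the step lengths. -/
noncomputable def stepMoment (lam : ℝ≥0) (θ s : ℝ) : ℝ :=
  1 + ∑' k : ℕ, Real.exp (s * (k + 1)) *
    Real.exp (-(lam * ((k : ℝ) ^ 2 * volume.real (sector (narrowSlope θ) 1))))

lemma summable_stepMoment {lam : ℝ≥0} (hlam : 0 < lam) {θ : ℝ} (hθ : 0 < θ)
    (hθ' : θ < Real.pi / 2) (s : ℝ) : Summable fun k : ℕ => Real.exp (s * (k + 1)) *
      Real.exp (-(lam * ((k : ℝ) ^ 2 * volume.real (sector (narrowSlope θ) 1)))) := by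
  set a := (lam : ℝ) * volume.real (sector (narrowSlope θ) 1) with ha
  have ha0 : 0 < a := mul_pos hlam (volume_sector_pos (narrowSlope_pos hθ hθ'))
  refine Summable.of_nonneg_of_le (fun k => by positivity) (fun k => ?_)
    (Real.summable_exp_neg_nat.mul_left (Real.exp (s + (s + 1) ^ 2 / (4 * a))))
  rw [← Real.exp_add, ← Real.exp_add, Real.exp_le_exp]
  -- Completing the square bounds (s + 1)k - ak²; the extra 1 leaves the summable factor exp(-k).
  have h1 : (s + 1) * k - a * (k : ℝ) ^ 2 ≤ (s + 1) ^ 2 / (4 * a) := by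
    rw [le_div_iff₀ (by positivity)]
    nlinarith [sq_nonneg (2 * a * k - (s + 1))]
  have h2 : (lam : ℝ) * ((k : ℝ) ^ 2 * volume.real (sector (narrowSlope θ) 1)) =
      a * (k : ℝ) ^ 2 := by rw [ha]; ring
  rw [h2]
  linarith

lemma one_le_stepMoment (lam : ℝ≥0) (θ s : ℝ) : 1 ≤ stepMoment lam θ s :=
  le_add_of_nonneg_right (tsum_nonneg fun k => by positivity)

section

variable {Ω : Type*} [MeasurableSpace Ω] {θ : ℝ} {P : Ω → Set Plane}
  {μ : Measure Ω} [IsProbabilityMeasure μ] {lam : ℝ≥0}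

lemma measurable_step (hθ : 0 < θ) (hθ' : θ < Real.pi / 2) (hF : IsLocallyFinitePattern P) (n : ℕ) :
    Measurable fun ω => ‖waypoint θ (P ω) (n + 1) - waypoint θ (P ω) n‖ :=
  ((hF.measurable_waypoint hθ hθ' _).sub (hF.measurable_waypoint hθ hθ' _)).norm

/-- For positive `Y` the single term with k < Y ≤ k + 1 suffices; the summand 1 covers `Y = 0`. The
right side involves only the tail events of `Y`. -/
lemma ofReal_exp_le_tsum {s Y : ℝ} (hs : 0 ≤ s) (hY : 0 ≤ Y) :
    ENNReal.ofReal (Real.exp (s * Y)) ≤ 1 + ∑' k : ℕ,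
      (if (k : ℝ) < Y then ENNReal.ofReal (Real.exp (s * (k + 1))) else 0) := by
  rcases hY.eq_or_lt with rfl | hY
  · simp
  · obtain ⟨k, hk⟩ : ∃ k, ⌈Y⌉₊ = k + 1 :=
      Nat.exists_eq_succ_of_ne_zero (Nat.ceil_pos.2 hY).ne'
    have h1 : (k : ℝ) < Y := Nat.lt_ceil.1 (by omega)
    have h2 : Y ≤ k + 1 := by
      have := Nat.le_ceil Y
      rw [hk] at this
      exact_mod_cast this
    refine le_trans ?_ (le_add_of_nonneg_left zero_le)
    refine le_trans ?_ (ENNReal.le_tsum k)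
    rw [if_pos h1]
    gcongr

/-- Conditional exponential moments of the step lengths. -/
lemma lintegral_mul_exp_step_le (hlam : 0 < lam) (hθ : 0 < θ) (hθ' : θ < Real.pi / 2)
    (hP : IsPoissonPointProcess lam P μ) (hF : IsLocallyFinitePattern P) {n : ℕ} {s : ℝ} (hs : 0 ≤ s)
    {f : Ω → ℝ≥0∞} (hf : Measurable[pastEvents θ P n] f) :
    ∫⁻ ω, f ω * ENNReal.ofReal
      (Real.exp (s * ‖waypoint θ (P ω) (n + 1) - waypoint θ (P ω) n‖)) ∂μ ≤
      ENNReal.ofReal (stepMoment lam θ s) * ∫⁻ ω, f ω ∂μ := by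
  have hle := pastEvents_le hθ hθ' hF n
  have hfm : Measurable f := hf.mono hle le_rfl
  set Y : Ω → ℝ := fun ω => ‖waypoint θ (P ω) (n + 1) - waypoint θ (P ω) n‖ with hY
  have hYm : Measurable Y := measurable_step hθ hθ' hF n
  have hnd : ∀ᵐ ω ∂μ, ∀ j < n, waypoint θ (P ω) (j + 1) ≠ waypoint θ (P ω) j :=
    (ae_waypoint_ne hlam hθ hθ' hP hF).mono fun ω h j _ => h j
  have hE : ∀ k : ℕ, MeasurableSet {ω | (k : ℝ) < Y ω} := fun k =>
    measurableSet_lt measurable_const hYm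
  calc ∫⁻ ω, f ω * ENNReal.ofReal (Real.exp (s * Y ω)) ∂μ
      ≤ ∫⁻ ω, (f ω + ∑' k : ℕ, ENNReal.ofReal (Real.exp (s * (k + 1))) *
          {ω | (k : ℝ) < Y ω}.indicator f ω) ∂μ := by
        refine lintegral_mono fun ω => ?_
        refine (mul_le_mul_right (ofReal_exp_le_tsum hs (norm_nonneg _)) (f ω)).trans ?_
        rw [mul_add, mul_one, ← ENNReal.tsum_mul_left]
        refine add_le_add le_rfl (ENNReal.tsum_le_tsum fun k => ?_)
        change f ω * (if (k : ℝ) < Y ω then _ else 0) ≤ _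
        by_cases h : (k : ℝ) < Y ω
        · rw [if_pos h, Set.indicator_of_mem (by exact h), mul_comm]
        · rw [if_neg h, mul_zero]; exact zero_le
    _ = ∫⁻ ω, f ω ∂μ + ∑' k : ℕ, ENNReal.ofReal (Real.exp (s * (k + 1))) *
          ∫⁻ ω in {ω | (k : ℝ) < Y ω}, f ω ∂μ := by
        rw [lintegral_add_left hfm, lintegral_tsum]
        · congr 2
          funext k
          rw [lintegral_const_mul _ (hfm.indicator (hE k)), lintegral_indicator (hE k)]
        · exact fun k => ((hfm.indicator (hE k)).const_mul _).aemeasurable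
    _ ≤ ∫⁻ ω, f ω ∂μ + ∑' k : ℕ, ENNReal.ofReal (Real.exp (s * (k + 1))) *
          (ENNReal.ofReal (Real.exp (-(lam * ((k : ℝ) ^ 2 *
            volume.real (sector (narrowSlope θ) 1))))) * ∫⁻ ω, f ω ∂μ) := by
        gcongr with k
        exact setLIntegral_le_of_measure_inter_le hle (fun A hA =>
          measure_step_gt_le hθ hθ' hP hF hnd hA (Nat.cast_nonneg k)) hf
    _ = _ := by
        have e : ∀ x y : ℝ, ENNReal.ofReal (Real.exp x) * (ENNReal.ofReal (Real.exp y) *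
            ∫⁻ ω, f ω ∂μ) = ENNReal.ofReal (Real.exp x * Real.exp y) * ∫⁻ ω, f ω ∂μ := fun x y => by
          rw [← mul_assoc, ← ENNReal.ofReal_mul (Real.exp_nonneg _)]
        simp_rw [e]
        rw [ENNReal.tsum_mul_right, ← ENNReal.ofReal_tsum_of_nonneg (fun k => by positivity)
          (summable_stepMoment hlam hθ hθ' s), stepMoment,
          ENNReal.ofReal_add zero_le_one (tsum_nonneg fun k => by positivity), add_mul,
          ENNReal.ofReal_one, one_mul]

/-- A bound for the conditional moment `exp (-s Y)` of the step length `Y`. -/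
noncomputable def stepDecay (lam : ℝ≥0) (θ s : ℝ) : ℝ :=
  Real.exp (-s) + (1 - Real.exp (-s)) *
    (1 - Real.exp (-(lam * volume.real (sector (Real.tan θ) 1))))

lemma one_sub_exp_nonneg (lam : ℝ≥0) (B : Set Plane) :
    0 ≤ 1 - Real.exp (-(lam * volume.real B)) := by
  rw [sub_nonneg, Real.exp_le_one_iff, neg_nonpos]
  positivity

lemma stepDecay_nonneg (lam : ℝ≥0) (θ : ℝ) {s : ℝ} (hs : 0 < s) : 0 ≤ stepDecay lam θ s := by
  have h1 : Real.exp (-s) ≤ 1 := Real.exp_le_one_iff.2 (by linarith)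
  have h2 := one_sub_exp_nonneg lam (sector (Real.tan θ) 1)
  have := mul_nonneg (sub_nonneg.2 h1) h2
  have := Real.exp_pos (-s)
  unfold stepDecay
  linarith

lemma stepDecay_lt_one (lam : ℝ≥0) (θ : ℝ) {s : ℝ} (hs : 0 < s) : stepDecay lam θ s < 1 := by
  have h1 : Real.exp (-s) < 1 := Real.exp_lt_one_iff.2 (by linarith)
  have h2 := Real.exp_pos (-(lam * volume.real (sector (Real.tan θ) 1)))
  unfold stepDecay
  nlinarith [mul_pos (sub_pos.2 h1) h2]

/-- Pointwise exp(-sY) ≤ exp(-s) + (1 - exp(-s)) 1_{Y ≤ 1}, and `measure_step_le_one` keeps the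
conditional probability of a short step away from one. -/
lemma lintegral_mul_exp_neg_step_le (hlam : 0 < lam) (hθ : 0 < θ) (hθ' : θ < Real.pi / 2)
    (hP : IsPoissonPointProcess lam P μ) (hF : IsLocallyFinitePattern P) {n : ℕ} {s : ℝ} (hs : 0 < s)
    {f : Ω → ℝ≥0∞} (hf : Measurable[pastEvents θ P n] f) :
    ∫⁻ ω, f ω * ENNReal.ofReal
      (Real.exp (-s * ‖waypoint θ (P ω) (n + 1) - waypoint θ (P ω) n‖)) ∂μ ≤
      ENNReal.ofReal (stepDecay lam θ s) * ∫⁻ ω, f ω ∂μ := by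
  have hle := pastEvents_le hθ hθ' hF n
  have hfm : Measurable f := hf.mono hle le_rfl
  set Y : Ω → ℝ := fun ω => ‖waypoint θ (P ω) (n + 1) - waypoint θ (P ω) n‖ with hY
  have hYm : Measurable Y := measurable_step hθ hθ' hF n
  have hE : MeasurableSet {ω | Y ω ≤ 1} := measurableSet_le hYm measurable_const
  have h1 : 0 ≤ 1 - Real.exp (-s) := sub_nonneg.2 (Real.exp_le_one_iff.2 (by linarith))
  calc ∫⁻ ω, f ω * ENNReal.ofReal (Real.exp (-s * Y ω)) ∂μ
      ≤ ∫⁻ ω, (ENNReal.ofReal (Real.exp (-s)) * f ω + ENNReal.ofReal (1 - Real.exp (-s)) *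
          {ω | Y ω ≤ 1}.indicator f ω) ∂μ := by
        refine lintegral_mono fun ω => ?_
        dsimp only
        by_cases h : Y ω ≤ 1
        · rw [Set.indicator_of_mem (by exact h), ← add_mul,
            ← ENNReal.ofReal_add (Real.exp_nonneg _) h1, mul_comm]
          gcongr
          have : Real.exp (-s * Y ω) ≤ 1 := Real.exp_le_one_iff.2 (by
            have := mul_nonneg hs.le (norm_nonneg (waypoint θ (P ω) (n + 1) - waypoint θ (P ω) n))
            simp only [hY]; linarith)
          linarith
        · rw [Set.indicator_of_notMem (by exact h), mul_zero, add_zero, mul_comm]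
          gcongr
          nlinarith
    _ = ENNReal.ofReal (Real.exp (-s)) * ∫⁻ ω, f ω ∂μ + ENNReal.ofReal (1 - Real.exp (-s)) *
          ∫⁻ ω in {ω | Y ω ≤ 1}, f ω ∂μ := by
        rw [lintegral_add_left (hfm.const_mul _), lintegral_const_mul _ hfm,
          lintegral_const_mul _ (hfm.indicator hE), lintegral_indicator hE]
    _ ≤ ENNReal.ofReal (Real.exp (-s)) * ∫⁻ ω, f ω ∂μ + ENNReal.ofReal (1 - Real.exp (-s)) *
          (ENNReal.ofReal (1 - Real.exp (-(lam * volume.real (sector (Real.tan θ) 1)))) *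
            ∫⁻ ω, f ω ∂μ) := by
        gcongr
        exact setLIntegral_le_of_measure_inter_le hle (fun A hA =>
          measure_step_le_one hlam hθ hθ' hP hF hA) hf
    _ = _ := by
        rw [← mul_assoc, ← ENNReal.ofReal_mul h1, ← add_mul, ← ENNReal.ofReal_add
          (Real.exp_nonneg _) (mul_nonneg h1 (one_sub_exp_nonneg _ _)), stepDecay]

/-- A lower bound for the conditional probability of a good step. -/
noncomputable def goodProb (lam : ℝ≥0) (θ r : ℝ) : ℝ :=
  Real.exp (-(lam * volume.real (badRegion (Real.tan θ) (narrowSlope θ) r))) *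
    (1 - Real.exp (-(lam * volume.real (sector (Real.tan θ) (r + 1) \
      badRegion (Real.tan θ) (narrowSlope θ) r))))

lemma goodProb_pos (hlam : 0 < lam) (hθ : 0 < θ) (hθ' : θ < Real.pi / 2) {r : ℝ} (hr : 0 ≤ r) :
    0 < goodProb lam θ r := by
  refine mul_pos (Real.exp_pos _) (sub_pos.2 (Real.exp_lt_one_iff.2 ?_))
  have := volume_sector_sdiff_badRegion_pos hr (narrowSlope_pos hθ hθ') (narrowSlope_le θ)
  have h2 : (0 : ℝ) < lam := hlam
  have := mul_pos h2 this
  linarith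

lemma goodProb_le_one (lam : ℝ≥0) (θ r : ℝ) : goodProb lam θ r ≤ 1 := by
  refine mul_le_one₀ (Real.exp_le_one_iff.2 ?_) (one_sub_exp_nonneg _ _) ?_
  · rw [neg_nonpos]; positivity
  · have := Real.exp_pos (-(lam * volume.real (sector (Real.tan θ) (r + 1) \
      badRegion (Real.tan θ) (narrowSlope θ) r)))
    linarith

lemma setLIntegral_not_goodStep_le (hlam : 0 < lam) (hθ : 0 < θ) (hθ' : θ < Real.pi / 2)
    (hP : IsPoissonPointProcess lam P μ) (hF : IsLocallyFinitePattern P) {n : ℕ} (r : ℝ)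
    {f : Ω → ℝ≥0∞} (hf : Measurable[pastEvents θ P n] f) :
    ∫⁻ ω in {ω | ¬ GoodStep θ (Real.cos θ * r) (P ω) n}, f ω ∂μ ≤
      ENNReal.ofReal (1 - goodProb lam θ r) * ∫⁻ ω, f ω ∂μ :=
  setLIntegral_le_of_measure_inter_le (pastEvents_le hθ hθ' hF n) (fun _ hA =>
    measure_not_goodStep_le hlam hθ hθ' r hP hF hA) hf

end

/-! ### The Lyapunov function and its contraction -/

/-- The choice of the parameters of the Lyapunov function. -/
lemma exists_parameters {s M₁ M₂ ρ : ℝ} {p : ℝ → ℝ} (hs : 0 < s) (hM₁ : 1 ≤ M₁) (hM₂ : 1 ≤ M₂)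
    (hρ0 : 0 ≤ ρ) (hρ : ρ < 1) (hp : ∀ r, 0 ≤ r → 0 < p r) :
    ∃ a β δ r : ℝ, 0 < a ∧ a ≤ 1 ∧ a ≤ s / 2 ∧ 0 < β ∧ 0 < δ ∧ δ < 1 ∧ 0 ≤ r ∧ ∀ D : ℝ,
      (if D ≤ s * r then 1 - p r else 1) + a * M₁ + β * ρ * Real.exp D + β * M₂ ≤
        (1 - δ) * (1 + β * Real.exp D) := by
  -- The threshold `s * r = L` is such that beyond it the gain (1 - ρ)/2 · β exp(D) pays for all
  -- constant terms. Up to it the renewal chance pays, since `p r = β * (M₂ + 2)`. Then `a` is small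
  -- enough for `a * M₁ ≤ β`, and δ is at most β and (1 - ρ)/2.
  set L := 2 * (M₂ + 2) / (1 - ρ) with hL
  have hρ' : 0 < 1 - ρ := by linarith
  have hL0 : 0 < L := by positivity
  set r := L / s with hr
  have hr0 : 0 ≤ r := by positivity
  have hpr := hp r hr0
  set β := p r / (M₂ + 2) with hβ
  have hβ0 : 0 < β := by positivity
  have hβ1 : β * (M₂ + 2) = p r := by rw [hβ]; field_simp
  refine ⟨min (min (s / 2) 1) (β / M₁), β, min β ((1 - ρ) / 2), r, ?_, ?_, ?_, hβ0, ?_, ?_, hr0,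
    fun D => ?_⟩
  · exact lt_min (lt_min (by positivity) one_pos) (by positivity)
  · exact (min_le_left _ _).trans (min_le_right _ _)
  · exact (min_le_left _ _).trans (min_le_left _ _)
  · exact lt_min hβ0 (by linarith)
  · exact (min_le_right _ _).trans_lt (by linarith)
  · have ha : min (min (s / 2) 1) (β / M₁) * M₁ ≤ β := by
      rw [← le_div_iff₀ (by linarith)]
      exact min_le_right _ _
    have hδ1 : min β ((1 - ρ) / 2) ≤ β := min_le_left _ _
    have hδ2 : min β ((1 - ρ) / 2) ≤ (1 - ρ) / 2 := min_le_right _ _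
    generalize min (min (s / 2) 1) (β / M₁) = a at *
    generalize min β ((1 - ρ) / 2) = δ at *
    have hE := Real.exp_pos D
    have hβE : 0 < β * Real.exp D := mul_pos hβ0 hE
    split_ifs with hD
    · nlinarith
    · have h1 : L ≤ Real.exp D := by
        have h2 : s * r = L := by rw [hr]; field_simp
        rw [h2] at hD
        have := Real.add_one_le_exp D
        linarith [not_le.1 hD]
      have h3 : M₂ + 2 ≤ (1 - ρ) / 2 * Real.exp D := by
        calc M₂ + 2 = (1 - ρ) / 2 * L := by rw [hL]; field_simp
          _ ≤ _ := by gcongr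
      have h4 : β * (M₂ + 2) ≤ (1 - ρ) / 2 * (β * Real.exp D) := by nlinarith
      nlinarith

open Classical in
/-- The exponential weight of the position, as long as no renewal has happened. -/
noncomputable def weight (θ a : ℝ) (S : Set Plane) (n : ℕ) : ℝ≥0∞ :=
  if Alive θ S n then ENNReal.ofReal (Real.exp (a * waypoint θ S n 0)) else 0

lemma Alive.of_succ {θ : ℝ} {S : Set Plane} {n : ℕ} (h : Alive θ S (n + 1)) : Alive θ S n :=
  fun k hk => h k (by omega)

lemma exp_mul_fst_succ_le {a : ℝ} (ha : 0 ≤ a) (θ : ℝ) (S : Set Plane) (n : ℕ) :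
    Real.exp (a * waypoint θ S (n + 1) 0) ≤ Real.exp (a * waypoint θ S n 0) *
      Real.exp (a * ‖waypoint θ S (n + 1) - waypoint θ S n‖) := by
  have h := (le_abs_self _).trans
    (abs_coord_le_norm (waypoint θ S (n + 1) - waypoint θ S n) 0)
  simp only [PiLp.sub_apply] at h
  rw [← Real.exp_add, Real.exp_le_exp, ← mul_add]
  exact mul_le_mul_of_nonneg_left (by linarith) ha

/-- The elementary inequality behind the drift of the Lyapunov function. -/
lemma exp_drift_le {a β D Y s : ℝ} (ha : 0 ≤ a) (ha1 : a ≤ 1) (has : a ≤ s / 2) (hβ : 0 ≤ β)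
    (hY : 0 ≤ Y) : Real.exp (a * Y) * (1 + β * Real.exp (max (D - s * Y) Y)) ≤
      1 + a * Real.exp (1 * Y) + β * Real.exp D * Real.exp (-(s / 2) * Y) +
        β * Real.exp (2 * Y) := by
  have h1 : Real.exp (a * Y) ≤ 1 + a * Real.exp (1 * Y) := by
    -- Convexity between 0 and Y gives exp(aY) ≤ (1 - a) + a exp(Y), with a coefficient `a` that can
    -- be made small.
    have h := convexOn_exp.2 (mem_univ 0) (mem_univ Y) (sub_nonneg.2 ha1) ha (by ring)
    simp only [smul_eq_mul, mul_zero, zero_add, Real.exp_zero, mul_one] at h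
    rw [one_mul]
    linarith
  have h2 : Real.exp (max (D - s * Y) Y) ≤ Real.exp (D - s * Y) + Real.exp Y := by
    rcases max_choice (D - s * Y) Y with h | h <;> rw [h]
    · linarith [Real.exp_pos Y]
    · linarith [Real.exp_pos (D - s * Y)]
  have h3 : Real.exp (a * Y) * Real.exp (D - s * Y) ≤ Real.exp D * Real.exp (-(s / 2) * Y) := by
    rw [← Real.exp_add, ← Real.exp_add, Real.exp_le_exp]
    nlinarith
  have h4 : Real.exp (a * Y) * Real.exp Y ≤ Real.exp (2 * Y) := by
    rw [← Real.exp_add, Real.exp_le_exp]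
    nlinarith
  have h5 := mul_le_mul_of_nonneg_left h2 (Real.exp_pos (a * Y)).le
  rw [mul_add] at h5
  have h6 := mul_le_mul_of_nonneg_left (h5.trans (add_le_add h3 h4)) hβ
  calc _ = Real.exp (a * Y) + β * (Real.exp (a * Y) * Real.exp (max (D - s * Y) Y)) := by ring
    _ ≤ _ := (add_le_add h1 h6).trans (le_of_eq (by ring))

-- If the path is alive after the step, no good step occurred at lag at most `K`, so the indicator
-- is one; otherwise the left side vanishes. The rest is `exp_drift_le` with D the lag, Y the step
-- length and s = cos θ.
open Classical in
lemma weight_mul_succ_le {θ : ℝ} (hθ : 0 < θ) (hθ' : θ < Real.pi / 2) {a β : ℝ} (ha : 0 ≤ a)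
    (ha1 : a ≤ 1) (has : a ≤ Real.cos θ / 2) (hβ : 0 ≤ β) (K : ℝ) (S : Set Plane) (n : ℕ) :
    weight θ a S (n + 1) * ENNReal.ofReal (1 + β * Real.exp (lag θ S (n + 1))) ≤
      weight θ a S n * (if GoodStep θ K S n ∧ lag θ S n ≤ K then 0 else 1) +
      ENNReal.ofReal a * (weight θ a S n *
        ENNReal.ofReal (Real.exp (1 * ‖waypoint θ S (n + 1) - waypoint θ S n‖))) +
      weight θ a S n * ENNReal.ofReal (β * Real.exp (lag θ S n)) *
        ENNReal.ofReal (Real.exp (-(Real.cos θ / 2) *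
          ‖waypoint θ S (n + 1) - waypoint θ S n‖)) +
      ENNReal.ofReal β * (weight θ a S n *
        ENNReal.ofReal (Real.exp (2 * ‖waypoint θ S (n + 1) - waypoint θ S n‖))) := by
  by_cases hal : Alive θ S (n + 1)
  swap
  · rw [weight, if_neg hal, zero_mul]; exact zero_le
  have hgood : ¬ (GoodStep θ K S n ∧ lag θ S n ≤ K) := fun h => by
    have h1 := hal n (Nat.lt_succ_self n)
    rw [history_eq_empty hθ hθ' h.1 h.2] at h1
    exact Set.not_nonempty_empty h1
  rw [if_neg hgood, weight, if_pos hal, weight, if_pos hal.of_succ, mul_one]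
  set Y := ‖waypoint θ S (n + 1) - waypoint θ S n‖ with hY
  set X := waypoint θ S n 0
  have hX := Real.exp_pos (a * X)
  have h1 := exp_drift_le (D := lag θ S n) ha ha1 has hβ (norm_nonneg _ : 0 ≤ Y)
  have h2 : Real.exp (a * waypoint θ S (n + 1) 0) * (1 + β * Real.exp (lag θ S (n + 1))) ≤
      Real.exp (a * X) + a * (Real.exp (a * X) * Real.exp (1 * Y)) +
        Real.exp (a * X) * (β * Real.exp (lag θ S n)) * Real.exp (-(Real.cos θ / 2) * Y) +
        β * (Real.exp (a * X) * Real.exp (2 * Y)) := by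
    calc _ ≤ (Real.exp (a * X) * Real.exp (a * Y)) *
          (1 + β * Real.exp (max (lag θ S n - Real.cos θ * Y) Y)) := by
          gcongr
          · exact exp_mul_fst_succ_le ha θ S n
          · exact lag_succ_le hθ hθ' S n
      _ = Real.exp (a * X) * (Real.exp (a * Y) *
          (1 + β * Real.exp (max (lag θ S n - Real.cos θ * Y) Y))) := by ring
      _ ≤ _ := (mul_le_mul_of_nonneg_left h1 hX.le).trans (le_of_eq (by ring))
  rw [← ENNReal.ofReal_mul (Real.exp_nonneg _), ← ENNReal.ofReal_mul (Real.exp_nonneg _),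
    ← ENNReal.ofReal_mul ha, ← ENNReal.ofReal_mul (Real.exp_nonneg _),
    ← ENNReal.ofReal_mul (show 0 ≤ Real.exp (a * X) * (β * Real.exp (lag θ S n)) by positivity),
    ← ENNReal.ofReal_mul (Real.exp_nonneg _), ← ENNReal.ofReal_mul hβ,
    ← ENNReal.ofReal_add (by positivity) (by positivity),
    ← ENNReal.ofReal_add (by positivity) (by positivity),
    ← ENNReal.ofReal_add (by positivity) (by positivity)]
  exact ENNReal.ofReal_le_ofReal h2

lemma measurable_weight {Ω : Type*} [MeasurableSpace Ω] {P : Ω → Set Plane} {θ : ℝ}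
    (hθ : 0 < θ) (hθ' : θ < Real.pi / 2) (a : ℝ) {n : ℕ}
    (hm : ∀ j ≤ n, Measurable fun ω => waypoint θ (P ω) j) :
    Measurable fun ω => weight θ a (P ω) n := by
  classical
  refine Measurable.ite (measurableSet_alive hθ hθ' hm) ?_ measurable_const
  have := (continuous_coord 0).measurable.comp (hm n le_rfl)
  exact (Real.measurable_exp.comp (this.const_mul a)).ennreal_ofReal

/-- The expectation of the Lyapunov function. -/
noncomputable def potential {Ω : Type*} [MeasurableSpace Ω] (μ : Measure Ω) (P : Ω → Set Plane)
    (θ a β : ℝ) (n : ℕ) : ℝ≥0∞ :=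
  ∫⁻ ω, weight θ a (P ω) n * ENNReal.ofReal (1 + β * Real.exp (lag θ (P ω) n)) ∂μ

section

variable {Ω : Type*} [MeasurableSpace Ω] {θ : ℝ} {P : Ω → Set Plane}
  {μ : Measure Ω} [IsProbabilityMeasure μ] {lam : ℝ≥0}

-- Whether the lag is below the threshold is known from the past. Below it the conditional
-- probability of a step that is not good applies; above it the trivial bound one is used.
open Classical in
lemma lintegral_not_renewal_le (hlam : 0 < lam) (hθ : 0 < θ) (hθ' : θ < Real.pi / 2)
    (hP : IsPoissonPointProcess lam P μ) (hF : IsLocallyFinitePattern P) {n : ℕ} (r : ℝ)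
    {f : Ω → ℝ≥0∞} (hf : Measurable[pastEvents θ P n] f) :
    ∫⁻ ω, f ω * (if GoodStep θ (Real.cos θ * r) (P ω) n ∧
        lag θ (P ω) n ≤ Real.cos θ * r then 0 else 1) ∂μ ≤
      ∫⁻ ω, f ω * ENNReal.ofReal
        (if lag θ (P ω) n ≤ Real.cos θ * r then 1 - goodProb lam θ r else 1) ∂μ := by
  have hle := pastEvents_le hθ hθ' hF n
  set B := {ω | lag θ (P ω) n ≤ Real.cos θ * r} with hB
  have hBm : MeasurableSet[pastEvents θ P n] B := by
    have h := @measurable_lag Ω (pastEvents θ P n) P θ n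
      fun j hj => measurable_waypoint_pastEvents θ P hj
    exact h (measurableSet_Iic (a := Real.cos θ * r))
  have hfB : Measurable[pastEvents θ P n] (B.indicator f) := hf.indicator hBm
  have hfB' : Measurable[pastEvents θ P n] (Bᶜ.indicator f) := hf.indicator hBm.compl
  calc _ ≤ ∫⁻ ω, (Bᶜ.indicator f ω +
        {ω | ¬ GoodStep θ (Real.cos θ * r) (P ω) n}.indicator (B.indicator f) ω) ∂μ := by
        refine lintegral_mono fun ω => ?_
        by_cases h1 : ω ∈ B
        · by_cases h2 : GoodStep θ (Real.cos θ * r) (P ω) n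
          · rw [if_pos ⟨h2, h1⟩, mul_zero]; exact zero_le
          · rw [if_neg fun h => h2 h.1, mul_one, Set.indicator_of_mem (s := {ω | ¬ GoodStep θ (Real.cos θ * r)
              (P ω) n}) h2,
              Set.indicator_of_mem h1]
            exact le_add_of_nonneg_left zero_le
        · rw [if_neg fun h => h1 h.2, mul_one, Set.indicator_of_mem (s := Bᶜ) h1]
          exact le_add_of_nonneg_right zero_le
    _ ≤ ∫⁻ ω, Bᶜ.indicator f ω ∂μ + ∫⁻ ω in {ω | ¬ GoodStep θ (Real.cos θ * r) (P ω) n},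
          B.indicator f ω ∂μ := by
        rw [lintegral_add_left (hfB'.mono hle le_rfl)]
        exact add_le_add le_rfl (lintegral_indicator_le _ _)
    _ ≤ ∫⁻ ω, Bᶜ.indicator f ω ∂μ +
          ENNReal.ofReal (1 - goodProb lam θ r) * ∫⁻ ω, B.indicator f ω ∂μ := by
        exact add_le_add le_rfl (setLIntegral_not_goodStep_le hlam hθ hθ' hP hF r hfB)
    _ = ∫⁻ ω, (Bᶜ.indicator f ω +
          ENNReal.ofReal (1 - goodProb lam θ r) * B.indicator f ω) ∂μ := by
        rw [lintegral_add_left (hfB'.mono hle le_rfl),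
          lintegral_const_mul _ (hfB.mono hle le_rfl)]
    _ = _ := by
        refine lintegral_congr fun ω => ?_
        by_cases h1 : ω ∈ B
        · have h2 : lag θ (P ω) n ≤ Real.cos θ * r := h1
          rw [if_pos h2, Set.indicator_of_mem h1, Set.indicator_of_notMem (by simpa using h1),
            zero_add, mul_comm]
        · have h2 : ¬ lag θ (P ω) n ≤ Real.cos θ * r := h1
          rw [if_neg h2, Set.indicator_of_notMem h1, Set.indicator_of_mem (s := Bᶜ) h1]
          simp

/-- The Lyapunov function contracts in expectation. -/
lemma potential_succ_le (hlam : 0 < lam) (hθ : 0 < θ) (hθ' : θ < Real.pi / 2)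
    (hP : IsPoissonPointProcess lam P μ) (hF : IsLocallyFinitePattern P) {a β δ r : ℝ} (ha : 0 ≤ a)
    (ha1 : a ≤ 1) (has : a ≤ Real.cos θ / 2) (hβ : 0 ≤ β) (hδ : δ < 1)
    (hpar : ∀ D : ℝ, (if D ≤ Real.cos θ * r then 1 - goodProb lam θ r else 1) +
      a * stepMoment lam θ 1 + β * stepDecay lam θ (Real.cos θ / 2) * Real.exp D +
      β * stepMoment lam θ 2 ≤ (1 - δ) * (1 + β * Real.exp D)) (n : ℕ) :
    potential μ P θ a β (n + 1) ≤ ENNReal.ofReal (1 - δ) * potential μ P θ a β n := by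
  classical
  have hc : 0 < Real.cos θ := Real.cos_pos_of_mem_Ioo ⟨by linarith, hθ'⟩
  have hle := pastEvents_le hθ hθ' hF n
  have hm : ∀ j ≤ n, Measurable[pastEvents θ P n] fun ω => waypoint θ (P ω) j :=
    fun j hj => measurable_waypoint_pastEvents θ P hj
  set f : Ω → ℝ≥0∞ := fun ω => weight θ a (P ω) n with hf
  have hfm' : Measurable[pastEvents θ P n] f :=
    @measurable_weight Ω (pastEvents θ P n) P θ hθ hθ' a n hm
  have hfm : Measurable f := hfm'.mono hle le_rfl
  have hlag' : Measurable[pastEvents θ P n] fun ω => lag θ (P ω) n :=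
    @measurable_lag Ω (pastEvents θ P n) P θ n hm
  have hg' : Measurable[pastEvents θ P n] fun ω =>
      ENNReal.ofReal (β * Real.exp (lag θ (P ω) n)) :=
    ((Real.measurable_exp.comp hlag').const_mul β).ennreal_ofReal
  have hfg' : Measurable[pastEvents θ P n] fun ω =>
      f ω * ENNReal.ofReal (β * Real.exp (lag θ (P ω) n)) := hfm'.mul hg'
  have hfg : Measurable fun ω =>
      f ω * ENNReal.ofReal (β * Real.exp (lag θ (P ω) n)) := hfg'.mono hle le_rfl
  have hYm := measurable_step hθ hθ' hF n
  have hexp : ∀ s : ℝ, Measurable fun ω => ENNReal.ofReal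
      (Real.exp (s * ‖waypoint θ (P ω) (n + 1) - waypoint θ (P ω) n‖)) := fun s =>
    (Real.measurable_exp.comp (hYm.const_mul s)).ennreal_ofReal
  have hM1 := one_le_stepMoment lam θ 1
  have hM2 := one_le_stepMoment lam θ 2
  have hρ := stepDecay_nonneg lam θ (half_pos hc)
  have hp := goodProb_le_one lam θ r
  have hif : ∀ D : ℝ, 0 ≤ (if D ≤ Real.cos θ * r then 1 - goodProb lam θ r else 1) := fun D => by
    split_ifs <;> linarith
  have hfe : ∀ s : ℝ, Measurable fun ω => f ω * ENNReal.ofReal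
      (Real.exp (s * ‖waypoint θ (P ω) (n + 1) - waypoint θ (P ω) n‖)) := fun s => hfm.mul (hexp s)
  have hfge : Measurable fun ω => f ω * ENNReal.ofReal (β * Real.exp (lag θ (P ω) n)) *
      ENNReal.ofReal (Real.exp (-(Real.cos θ / 2) *
        ‖waypoint θ (P ω) (n + 1) - waypoint θ (P ω) n‖)) := hfg.mul (hexp _)
  calc potential μ P θ a β (n + 1)
      ≤ ∫⁻ ω, (f ω * (if GoodStep θ (Real.cos θ * r) (P ω) n ∧
          lag θ (P ω) n ≤ Real.cos θ * r then 0 else 1) +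
        ENNReal.ofReal a * (f ω * ENNReal.ofReal
          (Real.exp (1 * ‖waypoint θ (P ω) (n + 1) - waypoint θ (P ω) n‖))) +
        f ω * ENNReal.ofReal (β * Real.exp (lag θ (P ω) n)) * ENNReal.ofReal
          (Real.exp (-(Real.cos θ / 2) * ‖waypoint θ (P ω) (n + 1) - waypoint θ (P ω) n‖)) +
        ENNReal.ofReal β * (f ω * ENNReal.ofReal
          (Real.exp (2 * ‖waypoint θ (P ω) (n + 1) - waypoint θ (P ω) n‖)))) ∂μ :=
        lintegral_mono fun ω => weight_mul_succ_le hθ hθ' ha ha1 has hβ _ (P ω) n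
    _ = ∫⁻ ω, f ω * (if GoodStep θ (Real.cos θ * r) (P ω) n ∧
          lag θ (P ω) n ≤ Real.cos θ * r then 0 else 1) ∂μ +
        ENNReal.ofReal a * ∫⁻ ω, f ω * ENNReal.ofReal
          (Real.exp (1 * ‖waypoint θ (P ω) (n + 1) - waypoint θ (P ω) n‖)) ∂μ +
        ∫⁻ ω, f ω * ENNReal.ofReal (β * Real.exp (lag θ (P ω) n)) * ENNReal.ofReal
          (Real.exp (-(Real.cos θ / 2) * ‖waypoint θ (P ω) (n + 1) - waypoint θ (P ω) n‖)) ∂μ +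
        ENNReal.ofReal β * ∫⁻ ω, f ω * ENNReal.ofReal
          (Real.exp (2 * ‖waypoint θ (P ω) (n + 1) - waypoint θ (P ω) n‖)) ∂μ := by
        rw [lintegral_add_right _ ((hfe 2).const_mul _), lintegral_add_right _ hfge,
          lintegral_add_right _ ((hfe 1).const_mul _), lintegral_const_mul _ (hfe 1),
          lintegral_const_mul _ (hfe 2)]
    _ ≤ ∫⁻ ω, f ω * ENNReal.ofReal
          (if lag θ (P ω) n ≤ Real.cos θ * r then 1 - goodProb lam θ r else 1) ∂μ +
        ENNReal.ofReal a * (ENNReal.ofReal (stepMoment lam θ 1) * ∫⁻ ω, f ω ∂μ) +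
        ENNReal.ofReal (stepDecay lam θ (Real.cos θ / 2)) *
          ∫⁻ ω, f ω * ENNReal.ofReal (β * Real.exp (lag θ (P ω) n)) ∂μ +
        ENNReal.ofReal β * (ENNReal.ofReal (stepMoment lam θ 2) * ∫⁻ ω, f ω ∂μ) := by
        -- Each weight is measurable with respect to the past, so each step factor is replaced by
        -- its conditional bound.
        refine add_le_add (add_le_add (add_le_add ?_ (mul_le_mul_right ?_ _)) ?_)
          (mul_le_mul_right ?_ _)
        · exact lintegral_not_renewal_le hlam hθ hθ' hP hF r hfm'
        · exact lintegral_mul_exp_step_le hlam hθ hθ' hP hF zero_le_one hfm'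
        · exact lintegral_mul_exp_neg_step_le hlam hθ hθ' hP hF (half_pos hc) hfg'
        · exact lintegral_mul_exp_step_le hlam hθ hθ' hP hF zero_le_two hfm'
    _ = ∫⁻ ω, (f ω * ENNReal.ofReal
          (if lag θ (P ω) n ≤ Real.cos θ * r then 1 - goodProb lam θ r else 1) +
        ENNReal.ofReal (a * stepMoment lam θ 1) * f ω +
        ENNReal.ofReal (stepDecay lam θ (Real.cos θ / 2)) *
          (f ω * ENNReal.ofReal (β * Real.exp (lag θ (P ω) n))) +
        ENNReal.ofReal (β * stepMoment lam θ 2) * f ω) ∂μ := by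
        rw [lintegral_add_right _ (hfm.const_mul _), lintegral_add_right _ (hfg.const_mul _),
          lintegral_add_right _ (hfm.const_mul _), lintegral_const_mul _ hfm,
          lintegral_const_mul _ hfm, lintegral_const_mul _ hfg, ENNReal.ofReal_mul ha,
          ENNReal.ofReal_mul hβ, mul_assoc, mul_assoc]
    _ ≤ ∫⁻ ω, ENNReal.ofReal (1 - δ) *
          (f ω * ENNReal.ofReal (1 + β * Real.exp (lag θ (P ω) n))) ∂μ := by
        refine lintegral_mono fun ω => ?_
        have h1 := hif (lag θ (P ω) n)
        have h2 : ∀ x y z w : ℝ≥0∞, f ω * x + y * f ω + z * (f ω * w) =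
            f ω * (x + y + z * w) := fun x y z w => by ring
        have h3 : ∀ x y : ℝ≥0∞, f ω * x + y * f ω = f ω * (x + y) := fun x y => by ring
        dsimp only
        rw [h2, h3, mul_left_comm (ENNReal.ofReal (1 - δ))]
        gcongr
        rw [← ENNReal.ofReal_mul hρ, ← ENNReal.ofReal_add h1 (by positivity),
          ← ENNReal.ofReal_add (by positivity) (by positivity),
          ← ENNReal.ofReal_add (by positivity) (by positivity),
          ← ENNReal.ofReal_mul (by linarith)]
        -- What remains is the parameter inequality at D equal to the lag.
        refine ENNReal.ofReal_le_ofReal ((le_of_eq ?_).trans (hpar (lag θ (P ω) n)))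
        ring
    _ = _ := by
        have hl : Measurable fun ω => lag θ (P ω) n := hlag'.mono hle le_rfl
        have hfl : Measurable fun ω =>
            f ω * ENNReal.ofReal (1 + β * Real.exp (lag θ (P ω) n)) :=
          hfm.mul (((Real.measurable_exp.comp hl).const_mul β).const_add 1).ennreal_ofReal
        rw [lintegral_const_mul _ hfl, potential]

end

/-! ### First renewal time and segment progress -/

lemma alive_zero (θ : ℝ) (S : Set Plane) : Alive θ S 0 := fun k hk => absurd hk (Nat.not_lt_zero k)

lemma renewalTime_one (θ : ℝ) (S : Set Plane) : renewalTime θ S 1 =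
    sInf {t : ℕ∞ | ∃ n : ℕ, t = n ∧ 0 < n ∧ history θ S n = ∅} := by
  simp [renewalTime]

lemma renewalTime_one_eq {θ : ℝ} {S : Set Plane} {n : ℕ} (h1 : Alive θ S n)
    (h2 : ¬ Alive θ S (n + 1)) : renewalTime θ S 1 = (n + 1 : ℕ) := by
  rw [renewalTime_one]
  refine le_antisymm (sInf_le ⟨n + 1, rfl, Nat.succ_pos n, ?_⟩) (le_sInf ?_)
  · by_contra h
    refine h2 fun k hk => ?_
    rcases (Nat.lt_succ_iff.1 hk).lt_or_eq with hk | rfl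
    · exact h1 k hk
    · exact Set.nonempty_iff_ne_empty.2 h
  · rintro _ ⟨m, rfl, hm, hem⟩
    rw [Nat.cast_le]
    by_contra! hlt
    obtain ⟨k, rfl⟩ := Nat.exists_eq_succ_of_ne_zero hm.ne'
    have := h1 k (by omega)
    rw [Nat.succ_eq_add_one] at hem
    rw [hem] at this
    exact Set.not_nonempty_empty this

lemma exists_last_alive {θ : ℝ} {S : Set Plane} (h : ∃ n, ¬ Alive θ S n) :
    ∃ n, Alive θ S n ∧ ¬ Alive θ S (n + 1) := by
  by_contra! hcon
  obtain ⟨n, hn⟩ := h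
  refine hn ?_
  induction n with
  | zero => exact alive_zero θ S
  | succ n ih => exact hcon n (by_contra fun h => hn (absurd (ih h) h))

/-- The conversion to ℕ sends ∞ to 0, so a positive value already forces the renewal time to be
finite. -/
lemma toNat_renewalTime_eq_iff {θ : ℝ} {S : Set Plane} {n : ℕ} :
    (renewalTime θ S 1).toNat = n + 1 ↔ Alive θ S n ∧ ¬ Alive θ S (n + 1) := by
  constructor
  · intro h
    have hex : ∃ n, ¬ Alive θ S n := by
      by_contra! hcon
      have : {t : ℕ∞ | ∃ n : ℕ, t = n ∧ 0 < n ∧ history θ S n = ∅} = ∅ := by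
        refine Set.eq_empty_iff_forall_notMem.2 ?_
        rintro _ ⟨m, rfl, hm, hem⟩
        obtain ⟨k, rfl⟩ := Nat.exists_eq_succ_of_ne_zero hm.ne'
        have := hcon (k + 1) k (Nat.lt_succ_self k)
        rw [Nat.succ_eq_add_one] at hem
        rw [hem] at this
        exact Set.not_nonempty_empty this
      rw [renewalTime_one, this] at h
      simp at h
    obtain ⟨m, h1, h2⟩ := exists_last_alive hex
    rw [renewalTime_one_eq h1 h2, ENat.toNat_natCast] at h
    obtain rfl : m = n := by omega
    exact ⟨h1, h2⟩
  · rintro ⟨h1, h2⟩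
    rw [renewalTime_one_eq h1 h2, ENat.toNat_natCast]

lemma segmentProgress_one (θ : ℝ) (S : Set Plane) :
    segmentProgress θ S 1 = waypoint θ S (renewalTime θ S 1).toNat := by
  have h0 : renewalTime θ S 0 = 0 := by simp [renewalTime]
  have h : ∀ N : ℕ, ∑ j ∈ Finset.Ioc 0 N, progress θ S j = waypoint θ S N := by
    intro N
    induction N with
    | zero => simp [waypoint]
    | succ N ih => rw [Finset.sum_Ioc_succ_top (Nat.zero_le N), ih]; simp [progress]
  rw [segmentProgress, Nat.sub_self, h0, ENat.toNat_zero, h]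

lemma history_insert {θ : ℝ} (hθ : 0 < θ) (hθ' : θ < Real.pi / 2) (S : Set Plane) :
    history θ (insert 0 S) = history θ S := by
  funext n
  induction n with
  | zero => rfl
  | succ n ih => simp only [history_succ, waypoint_insert hθ hθ', ih]

lemma renewalTime_one_insert {θ : ℝ} (hθ : 0 < θ) (hθ' : θ < Real.pi / 2) (S : Set Plane) :
    renewalTime θ (insert 0 S) 1 = renewalTime θ S 1 := by
  rw [renewalTime_one, renewalTime_one, history_insert hθ hθ']

/-- On the cone y ≤ x tan θ, so each coordinate of the vector contributes at most (a / 2) x. This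
dictates the choice of γ. -/
lemma inner_le_fst {θ : ℝ} (hθ : 0 < θ) (hθ' : θ < Real.pi / 2) {a : ℝ} (ha : 0 ≤ a) {w : Plane}
    (hw : w ∈ wedge (Real.tan θ)) :
    inner ℝ (!₂[a / 2, a / (2 * Real.tan θ)] : Plane) w ≤ a * w 0 := by
  have hk := Real.tan_pos_of_pos_of_lt_pi_div_two hθ hθ'
  rw [plane_inner]
  simp only [Matrix.cons_val_zero, Matrix.cons_val_one, Matrix.cons_val_fin_one]
  have h1 : w 1 ≤ Real.tan θ * w 0 := (le_abs_self _).trans hw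
  have h2 : a / (2 * Real.tan θ) * w 1 ≤ a / (2 * Real.tan θ) * (Real.tan θ * w 0) :=
    mul_le_mul_of_nonneg_left h1 (by positivity)
  have h3 : a / (2 * Real.tan θ) * (Real.tan θ * w 0) = a / 2 * w 0 := by field_simp
  linarith

section

variable {Ω : Type*} [MeasurableSpace Ω] {θ : ℝ} {P : Ω → Set Plane}
  {μ : Measure Ω} {lam : ℝ≥0}

lemma measurable_toNat_renewalTime (hθ : 0 < θ) (hθ' : θ < Real.pi / 2) (hF : IsLocallyFinitePattern P) :
    Measurable fun ω => (renewalTime θ (P ω) 1).toNat := by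
  have hal : ∀ n, MeasurableSet {ω | Alive θ (P ω) n} := fun n =>
    measurableSet_alive hθ hθ' fun j _ => hF.measurable_waypoint hθ hθ' j
  have hs : ∀ n, MeasurableSet {ω | (renewalTime θ (P ω) 1).toNat = n + 1} := fun n => by
    simp only [toNat_renewalTime_eq_iff]
    exact (hal n).inter (hal (n + 1)).compl
  refine measurable_to_countable' fun n => ?_
  cases n with
  | zero =>
    have : (fun ω => (renewalTime θ (P ω) 1).toNat) ⁻¹' {0} =
        (⋃ n : ℕ, {ω | (renewalTime θ (P ω) 1).toNat = n + 1})ᶜ := by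
      ext ω
      simp only [mem_preimage, mem_singleton_iff, mem_compl_iff, mem_iUnion, Set.mem_ofPred_eq,
        not_exists]
      constructor
      · intro h n; omega
      · intro h
        by_contra h0
        exact h ((renewalTime θ (P ω) 1).toNat - 1) (by omega)
    rw [this]
    exact (MeasurableSet.iUnion hs).compl
  | succ n => exact hs n

lemma measurable_segmentProgress (hθ : 0 < θ) (hθ' : θ < Real.pi / 2) (hF : IsLocallyFinitePattern P) :
    Measurable fun ω => segmentProgress θ (P ω) 1 := by
  simp only [segmentProgress_one]
  have h : Measurable fun p : ℕ × Ω => waypoint θ (P p.2) p.1 :=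
    measurable_from_prod_countable_right fun n => hF.measurable_waypoint hθ hθ' n
  exact h.comp ((measurable_toNat_renewalTime hθ hθ' hF).prodMk measurable_id)

lemma lintegral_weight_le_potential {a β : ℝ} (hβ : 0 ≤ β) (n : ℕ) :
    ∫⁻ ω, weight θ a (P ω) n ∂μ ≤ potential μ P θ a β n := by
  refine lintegral_mono fun ω => ?_
  conv_lhs => rw [← mul_one (weight θ a (P ω) n)]
  gcongr
  rw [← ENNReal.ofReal_one]
  gcongr
  have := mul_nonneg hβ (Real.exp_nonneg (lag θ (P ω) n))
  linarith

/-- The potential starts at 1 + β, the initial lag being zero, and then decays geometrically. -/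
lemma tsum_lintegral_weight_lt_top [IsProbabilityMeasure μ] {a β δ : ℝ} (hβ : 0 ≤ β) (hδ : 0 < δ)
    (h : ∀ n, potential μ P θ a β (n + 1) ≤ ENNReal.ofReal (1 - δ) * potential μ P θ a β n) :
    ∑' n, ∫⁻ ω, weight θ a (P ω) n ∂μ < ∞ := by
  have h0 : potential μ P θ a β 0 = ENNReal.ofReal (1 + β) := by
    simp [potential, weight, alive_zero, lag, reach, waypoint]
  have hn : ∀ n, potential μ P θ a β n ≤ ENNReal.ofReal (1 - δ) ^ n * ENNReal.ofReal (1 + β) := by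
    intro n
    induction n with
    | zero => rw [h0, pow_zero, one_mul]
    | succ n ih =>
      refine (h n).trans ((mul_le_mul_right ih _).trans (le_of_eq ?_))
      rw [pow_succ]
      ring
  have hlt : ENNReal.ofReal (1 - δ) < 1 := by
    rw [ENNReal.ofReal_lt_one]; linarith
  calc ∑' n, ∫⁻ ω, weight θ a (P ω) n ∂μ
      ≤ ∑' n : ℕ, ENNReal.ofReal (1 - δ) ^ n * ENNReal.ofReal (1 + β) :=
        ENNReal.tsum_le_tsum fun n => (lintegral_weight_le_potential hβ n).trans (hn n)
    _ = (1 - ENNReal.ofReal (1 - δ))⁻¹ * ENNReal.ofReal (1 + β) := by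
        rw [ENNReal.tsum_mul_right, ENNReal.tsum_geometric]
    _ < ∞ := ENNReal.mul_lt_top (ENNReal.inv_lt_top.2 (tsub_pos_of_lt hlt)) ENNReal.ofReal_lt_top

/-- Waypoints never have a negative first coordinate, so the weight is at least one while the path
is alive; yet its expectation tends to zero. -/
lemma ae_exists_not_alive (hθ : 0 < θ) (hθ' : θ < Real.pi / 2) (hF : IsLocallyFinitePattern P)
    {a : ℝ} (ha : 0 ≤ a)
    (h : ∑' n, ∫⁻ ω, weight θ a (P ω) n ∂μ < ∞) : ∀ᵐ ω ∂μ, ∃ n, ¬ Alive θ (P ω) n := by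
  have hle : ∀ n, μ {ω | ¬ ∃ n, ¬ Alive θ (P ω) n} ≤ ∫⁻ ω, weight θ a (P ω) n ∂μ := fun n => by
    calc μ {ω | ¬ ∃ n, ¬ Alive θ (P ω) n} ≤ μ {ω | 1 ≤ weight θ a (P ω) n} := by
          refine measure_mono fun ω hω => ?_
          have hal : Alive θ (P ω) n := by
            by_contra h; exact hω ⟨n, h⟩
          simp only [Set.mem_ofPred_eq, weight, if_pos hal]
          rw [← ENNReal.ofReal_one]
          gcongr
          exact Real.one_le_exp (mul_nonneg ha (waypoint_fst_nonneg hθ hθ' (P ω) n))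
      _ ≤ _ := by
          have hw : Measurable fun ω => weight θ a (P ω) n :=
            measurable_weight hθ hθ' a fun j _ => hF.measurable_waypoint hθ hθ' j
          simpa using mul_meas_ge_le_lintegral₀ (μ := μ) hw.aemeasurable 1
  have hlim := ENNReal.tendsto_atTop_zero_of_tsum_ne_top h.ne
  rw [ae_iff]
  exact le_antisymm (ge_of_tendsto' hlim hle) zero_le

/-- If `n` is the last index alive, then τ_1 = n + 1 and the segment progress is V_{n+1}. The weight
already vanishes there, so the last step is split off and the weight taken at `n`. -/
lemma exp_inner_segmentProgress_le (hθ : 0 < θ) (hθ' : θ < Real.pi / 2) {a : ℝ} (ha : 0 ≤ a)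
    {S : Set Plane} (h : ∃ n, ¬ Alive θ S n) :
    ENNReal.ofReal (Real.exp (inner ℝ (!₂[a / 2, a / (2 * Real.tan θ)] : Plane)
      (segmentProgress θ S 1))) ≤ ∑' n, weight θ a S n *
        ENNReal.ofReal (Real.exp (a * ‖waypoint θ S (n + 1) - waypoint θ S n‖)) := by
  obtain ⟨n, h1, h2⟩ := exists_last_alive h
  rw [segmentProgress_one, renewalTime_one_eq h1 h2, ENat.toNat_natCast]
  refine le_trans ?_ (ENNReal.le_tsum n)
  rw [weight, if_pos h1, ← ENNReal.ofReal_mul (Real.exp_nonneg _)]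
  refine ENNReal.ofReal_le_ofReal (le_trans (Real.exp_le_exp.2 (inner_le_fst hθ hθ' ha ?_))
    (exp_mul_fst_succ_le ha θ S n))
  simpa [waypoint] using waypoint_sub_mem_wedge hθ hθ' S (Nat.zero_le (n + 1))

lemma integrable_exp_segmentProgress [IsProbabilityMeasure μ] (hlam : 0 < lam) (hθ : 0 < θ) (hθ' : θ < Real.pi / 2)
    (hP : IsPoissonPointProcess lam P μ) (hF : IsLocallyFinitePattern P) {a : ℝ} (ha : 0 ≤ a)
    (h : ∑' n, ∫⁻ ω, weight θ a (P ω) n ∂μ < ∞) :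
    Integrable (fun ω => Real.exp (inner ℝ (!₂[a / 2, a / (2 * Real.tan θ)] : Plane)
      (segmentProgress θ (P ω) 1))) μ := by
  have hmeas : Measurable fun ω => Real.exp (inner ℝ (!₂[a / 2, a / (2 * Real.tan θ)] : Plane)
      (segmentProgress θ (P ω) 1)) :=
    Real.measurable_exp.comp (measurable_const.inner (measurable_segmentProgress hθ hθ' hF))
  have hw : ∀ n, Measurable fun ω => weight θ a (P ω) n := fun n =>
    measurable_weight hθ hθ' a fun j _ => hF.measurable_waypoint hθ hθ' j
  have hexp : ∀ n, Measurable fun ω => ENNReal.ofReal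
      (Real.exp (a * ‖waypoint θ (P ω) (n + 1) - waypoint θ (P ω) n‖)) := fun n =>
    (Real.measurable_exp.comp ((measurable_step hθ hθ' hF n).const_mul a)).ennreal_ofReal
  refine ⟨hmeas.aestronglyMeasurable, ?_⟩
  rw [hasFiniteIntegral_iff_ofReal (.of_forall fun ω => Real.exp_nonneg _)]
  calc _ ≤ ∫⁻ ω, ∑' n, weight θ a (P ω) n * ENNReal.ofReal
          (Real.exp (a * ‖waypoint θ (P ω) (n + 1) - waypoint θ (P ω) n‖)) ∂μ := by
        refine lintegral_mono_ae ?_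
        filter_upwards [ae_exists_not_alive hθ hθ' hF ha h] with ω hω
        exact exp_inner_segmentProgress_le hθ hθ' ha hω
    _ = ∑' n, ∫⁻ ω, weight θ a (P ω) n * ENNReal.ofReal
          (Real.exp (a * ‖waypoint θ (P ω) (n + 1) - waypoint θ (P ω) n‖)) ∂μ :=
        lintegral_tsum fun n => ((hw n).mul (hexp n)).aemeasurable
    _ ≤ ∑' n, ENNReal.ofReal (stepMoment lam θ a) * ∫⁻ ω, weight θ a (P ω) n ∂μ := by
        -- The split-off step has a conditional exponential moment bounded uniformly in `n`.
        refine ENNReal.tsum_le_tsum fun n => lintegral_mul_exp_step_le hlam hθ hθ' hP hF ha ?_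
        exact @measurable_weight Ω (pastEvents θ P n) P θ hθ hθ' a n
          fun j hj => measurable_waypoint_pastEvents θ P hj
    _ < ∞ := by
        rw [ENNReal.tsum_mul_left]
        exact ENNReal.mul_lt_top ENNReal.ofReal_lt_top h

end

theorem lemma3p1 (lam : ℝ≥0) (hlam : 0 < lam) (θ : ℝ) (hθ : 0 < θ) (hθ' : θ < Real.pi / 2) :
    ∃ γ : Plane, 0 < γ 0 ∧ 0 < γ 1 ∧
      ∀ (Ω : Type*) [MeasurableSpace Ω] (μ : Measure Ω) [IsProbabilityMeasure μ]
        (P : Ω → Set Plane), IsPoissonPointProcess lam P μ →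
        (∀ᵐ ω ∂μ, ∀ n : ℕ, ∃! w : Plane,
          IsSuccessor θ (insert 0 (P ω)) (waypoint θ (insert 0 (P ω)) n) w) ∧
        (∀ᵐ ω ∂μ, renewalTime θ (insert 0 (P ω)) 1 < ⊤) ∧
        Integrable (fun ω =>
          Real.exp (inner ℝ γ (segmentProgress θ (insert 0 (P ω)) 1))) μ := by
  have hk := Real.tan_pos_of_pos_of_lt_pi_div_two hθ hθ'
  have hc : 0 < Real.cos θ := Real.cos_pos_of_mem_Ioo ⟨by linarith, hθ'⟩
  -- The parameters depend on `lam` and `θ` only and are fixed before the probability space; `cos θ`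
  -- is the rate at which steps reduce the lag.
  obtain ⟨a, β, δ, r, ha, ha1, has, hβ, hδ, hδ1, -, hpar⟩ := exists_parameters hc
    (one_le_stepMoment lam θ 1) (one_le_stepMoment lam θ 2) (stepDecay_nonneg lam θ (half_pos hc))
    (stepDecay_lt_one lam θ (half_pos hc)) fun r hr => goodProb_pos hlam hθ hθ' hr
  refine ⟨!₂[a / 2, a / (2 * Real.tan θ)], ?_, ?_, ?_⟩
  · simp only [Matrix.cons_val_zero]; positivity
  · simp only [Matrix.cons_val_one, Matrix.cons_val_fin_one]; positivity
  intro Ω _ μ _ P₀ hP₀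
  -- The measurability arguments need local finiteness for every ω; the conclusions are insensitive
  -- to null sets.
  obtain ⟨P, hP, hF, hae⟩ := hP₀.exists_modification
  have hsum := tsum_lintegral_weight_lt_top (μ := μ) (P := P) hβ.le hδ fun n =>
    potential_succ_le hlam hθ hθ' hP hF ha.le ha1 has hβ.le hδ1 hpar n
  refine ⟨?_, ?_, ?_⟩
  · filter_upwards [hae, ae_waypoint_ne hlam hθ hθ' hP hF] with ω h1 h2 n
    rw [h1, waypoint_insert hθ hθ',
      isSuccessor_congr (insert_inter_cone hθ hθ' (waypoint_fst_nonneg hθ hθ' (P ω) n))]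
    exact (successor_ne_iff hθ hθ').1 (h2 n)
  · filter_upwards [hae, ae_exists_not_alive hθ hθ' hF ha.le hsum] with ω h1 h2
    rw [h1, renewalTime_one_insert hθ hθ']
    obtain ⟨n, h3, h4⟩ := exists_last_alive h2
    rw [renewalTime_one_eq h3 h4]
    exact ENat.natCast_lt_top _
  · refine (integrable_exp_segmentProgress hlam hθ hθ' hP hF ha.le hsum).congr ?_
    filter_upwards [hae] with ω h1
    rw [h1, segmentProgress_one, segmentProgress_one, renewalTime_one_insert hθ hθ',
      waypoint_insert hθ hθ']
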